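/- Let $k$ be a field, $P$ a poset all of whose intervals $[x,y]=\{z: x\le z\le y\}$ are finite, and $\sim$ an equivalence relation on the set $\mathrm{Int}(P)$ of closed intervals $[x,y]$, $x\le y$. Write $\widetilde{[x,y]}$ for the class of $[x,y]$; write $x\sim y$ if $[x,x]\sim[y,y]$, $\tilde x$ for the class of $x$, and $P/\!\sim$ for the set of these classes. Assume: 1. (order-compatibility) if $[x,y]\sim[x',y']$ and $[y,z]\sim[y',z']$, then $[x,z]\sim[x',z']$; 2. (invariance) if $[x,y]\sim[x',y']$, there is exactly one map $\tau:[x,y]\to[x',y']$ such that $[x,z]\sim[x',\tau(z)]$ and $[z,y]\sim[\tau(z),y']$ for all $z\in[x,y]$; 3. (finiteness) $P/\!\sim$ is finite; 4. (concatenation) if $x\le y_1$, $y_2\le z$ and $y_1\sim y_2$, there are $x'\le y'\le z'$ with $[x',y']\sim[x,y_1]$ and $[y',z']\sim[y_2,z]$. Then each class $\alpha=\widetilde{[x,y]}$ has a well-defined source $s(\alpha)=\tilde x$ and target $t(\alpha)=\tilde y$. Let $A=k[P]_{\mathrm{red}}$ be the reduced incidence algebra: the $k$-algebra with basis $\{\xi_\alpha\}_{\alpha\in\mathrm{Int}(P)/\sim}$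 in which $\xi_\alpha\xi_\beta=\xi_\gamma$ if there are $x\le y\le z$ with $\widetilde{[x,y]}=\alpha$, $\widetilde{[y,z]}=\beta$, $\widetilde{[x,z]}=\gamma$, and $\xi_\alpha\xi_\beta=0$ otherwise. Let $I\subset A$ be the two-sided ideal spanned by the $\xi_{\widetilde{[x,y]}}$ with $x<y$, and let $R=\mathrm{gr}_I A=\bigoplus_{d\ge0}I^d/I^{d+1}$, an $\mathbb N$-graded ring. For $\tilde x\in P/\!\sim$ let $k_{\tilde x}$ be the one-dimensional left and right $R$-module, concentrated in degree $0$, on which $R$ acts through $R\to R_0=A/I\cong\prod_{\tilde z\in P/\sim}k\,\xi_{\tilde z}\to k\,\xi_{\tilde x}\cong k$, where $\xi_{\tilde z}=\xi_{\widetilde{[z,z]}}$. For each class $\alpha$ fix a representative $[x(\alpha),y(\alpha)]$, and let $\Delta_\alpha$ be the order complex of the open interval $(x(\alpha),y(\alpha))$, i.e. the simplicial complex of its finite chains, the empty face of dimension $-1$ included. For a simplicial complex $\Delta$ and $j\in\mathbb Z$ let $\Delta^{\langle j\rangle}$ be the subcomplex generated by all faces of dimension at least $j$. For graded $R$-modules,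 let $\mathrm{Tor}^R_i(-,-)_j$ be the component of internal degree $j$ of $\mathrm{Tor}^R_i$, computed from a graded projective resolution. Then for all $\tilde x,\tilde y\in P/\!\sim$: $\mathrm{Tor}^R_0(k_{\tilde x},k_{\tilde y})$ is isomorphic to $k$ and concentrated in degree $0$ if $\tilde x=\tilde y$, and it vanishes if $\tilde x\ne\tilde y$; and for all $i\ge1$ and $j\in\mathbb Z$ there is an isomorphism of $k$-vector spaces $$\mathrm{Tor}^R_i(k_{\tilde x},k_{\tilde y})_j\;\cong\;\bigoplus_{\alpha}\tilde H_{i-2}\bigl(\Delta_\alpha^{\langle j-2\rangle},\Delta_\alpha^{\langle j-1\rangle};k\bigr),$$ the sum running over all $\alpha\in\mathrm{Int}(P)/\!\sim$ with $s(\alpha)=\tilde x$, $t(\alpha)=\tilde y$ that are classes of intervals $[x,y]$ with $x<y$. Here $\tilde H$ denotes relative reduced simplicial homology. -/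

import Mathlib

universe u v w

open DirectSum TensorProduct

namespace RedInc

section AssociatedGraded

variable (k : Type v) [Field k] {A : Type u} [Ring A] [Algebra k A] (I : Ideal A)

/-- The homogeneous component `I ^ d / I ^ (d + 1)`. -/
abbrev GrPiece (d : ℕ) : Type u := ↥(I ^ d) ⧸ (I ^ (d + 1)).submoduleOf (I ^ d)

variable {I}

/-- The class in `I ^ d / I ^ (d + 1)` of an element of `I ^ d`. -/
def grMk {d : ℕ} (a : A) (ha : a ∈ I ^ d) : GrPiece I d :=
  Submodule.Quotient.mk ⟨a, ha⟩

theorem grMk_surj {d : ℕ} (x : GrPiece I d) : ∃ a, ∃ ha : a ∈ I ^ d, x = grMk a ha := by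
  obtain ⟨⟨a, ha⟩, rfl⟩ := Submodule.Quotient.mk_surjective _ x
  exact ⟨a, ha, rfl⟩

theorem grMk_eq {d : ℕ} {a b : A} (ha : a ∈ I ^ d) (hb : b ∈ I ^ d) :
    grMk a ha = grMk b hb ↔ a - b ∈ I ^ (d + 1) := by
  unfold grMk
  rw [Submodule.Quotient.eq]
  rfl

theorem gradedMonoid_mk_grMk {m n : ℕ} {a b : A} (ha : a ∈ I ^ m) (hb : b ∈ I ^ n)
    (hmn : m = n) (hab : a = b) :
    GradedMonoid.mk (A := GrPiece I) m (grMk a ha) = GradedMonoid.mk n (grMk b hb) := by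
  subst hmn
  subst hab
  rfl

theorem one_mem_pow_zero : (1 : A) ∈ I ^ 0 := by
  rw [Submodule.pow_zero, Ideal.one_eq_top]
  trivial

variable [I.IsTwoSided]

theorem mul_mem_pow_add {m n : ℕ} {a b : A} (ha : a ∈ I ^ m) (hb : b ∈ I ^ n) :
    a * b ∈ I ^ (m + n) := by
  rw [Ideal.IsTwoSided.pow_add]
  exact Ideal.mul_mem_mul ha hb

/-- The multiplication `(a + I ^ (m + 1)) (b + I ^ (n + 1)) = a b + I ^ (m + n + 1)`. -/
def grMul {m n : ℕ} (x : GrPiece I m) (y : GrPiece I n) : GrPiece I (m + n) :=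
  Quotient.map₂ (fun a b => (⟨a.1 * b.1, mul_mem_pow_add a.2 b.2⟩ : ↥(I ^ (m + n))))
    (by
      rintro ⟨a, ha⟩ ⟨a', ha'⟩ h ⟨b, hb⟩ ⟨b', hb'⟩ h'
      have h1 : a - a' ∈ I ^ (m + 1) := by
        have : (⟨a, ha⟩ - ⟨a', ha'⟩ : ↥(I ^ m)) ∈ (I ^ (m + 1)).submoduleOf (I ^ m) :=
          (Submodule.quotientRel_def _).1 h
        exact this
      have h2 : b - b' ∈ I ^ (n + 1) := by
        have : (⟨b, hb⟩ - ⟨b', hb'⟩ : ↥(I ^ n)) ∈ (I ^ (n + 1)).submoduleOf (I ^ n) :=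
          (Submodule.quotientRel_def _).1 h'
        exact this
      refine (Submodule.quotientRel_def _).2 ?_
      change a * b - a' * b' ∈ I ^ (m + n + 1)
      have e : a * b - a' * b' = (a - a') * b + a' * (b - b') := by noncomm_ring
      rw [e]
      refine Ideal.add_mem _ ?_ ?_
      · have := mul_mem_pow_add h1 hb
        rwa [show m + 1 + n = m + n + 1 by ring] at this
      · have := mul_mem_pow_add ha' h2
        rwa [← add_assoc] at this) x y

theorem grMul_mk {m n : ℕ} {a b : A} (ha : a ∈ I ^ m) (hb : b ∈ I ^ n) :
    grMul (grMk a ha) (grMk b hb) = grMk (a * b) (mul_mem_pow_add ha hb) := rfl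

instance grGMul : GradedMonoid.GMul (GrPiece I) where
  mul := grMul

instance grGOne : GradedMonoid.GOne (GrPiece I) where
  one := grMk 1 one_mem_pow_zero

instance grMonoid : GradedMonoid.GMonoid (GrPiece I) where
  one_mul := by
    rintro ⟨m, x⟩
    obtain ⟨a, ha, rfl⟩ := grMk_surj x
    exact gradedMonoid_mk_grMk _ _ (zero_add m) (one_mul a)
  mul_one := by
    rintro ⟨m, x⟩
    obtain ⟨a, ha, rfl⟩ := grMk_surj x
    exact gradedMonoid_mk_grMk _ _ (add_zero m) (mul_one a)
  mul_assoc := by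
    rintro ⟨m, x⟩ ⟨n, y⟩ ⟨l, z⟩
    obtain ⟨a, ha, rfl⟩ := grMk_surj x
    obtain ⟨b, hb, rfl⟩ := grMk_surj y
    obtain ⟨c, hc, rfl⟩ := grMk_surj z
    exact gradedMonoid_mk_grMk _ _ (add_assoc m n l) (mul_assoc a b c)

instance grRing : DirectSum.GRing (GrPiece I) where
  __ := grMonoid
  mul_zero {m n} x := by
    obtain ⟨a, ha, rfl⟩ := grMk_surj x
    change grMul (grMk a ha) (grMk 0 (zero_mem _)) = grMk 0 (zero_mem _)
    simp [grMul_mk]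
  zero_mul {m n} x := by
    obtain ⟨a, ha, rfl⟩ := grMk_surj x
    change grMul (grMk 0 (zero_mem _)) (grMk a ha) = grMk 0 (zero_mem _)
    simp [grMul_mk]
  mul_add {m n} x y z := by
    obtain ⟨a, ha, rfl⟩ := grMk_surj x
    obtain ⟨b, hb, rfl⟩ := grMk_surj y
    obtain ⟨c, hc, rfl⟩ := grMk_surj z
    change grMk (a * (b + c)) _ = grMk (a * b + a * c) (add_mem (mul_mem_pow_add ha hb) (mul_mem_pow_add ha hc))
    simp [mul_add]
  add_mul {m n} x y z := by
    obtain ⟨a, ha, rfl⟩ := grMk_surj x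
    obtain ⟨b, hb, rfl⟩ := grMk_surj y
    obtain ⟨c, hc, rfl⟩ := grMk_surj z
    change grMk ((a + b) * c) _ = grMk (a * c + b * c) (add_mem (mul_mem_pow_add ha hc) (mul_mem_pow_add hb hc))
    simp [add_mul]
  natCast n := n • grMk 1 one_mem_pow_zero
  natCast_zero := zero_nsmul _
  natCast_succ n := by rw [succ_nsmul]; rfl
  intCast n := n • grMk 1 one_mem_pow_zero
  intCast_ofNat n := natCast_zsmul _ n
  intCast_negSucc_ofNat n := by rw [negSucc_zsmul]

instance grAlgebra : DirectSum.GAlgebra k (GrPiece I) where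
  toFun := (LinearMap.toSpanSingleton k (GrPiece I 0) (grMk 1 one_mem_pow_zero)).toAddMonoidHom
  map_one := one_smul k (grMk (I := I) 1 one_mem_pow_zero)
  map_mul r s := by
    refine gradedMonoid_mk_grMk (a := (r * s) • 1) (b := (r • 1) * (s • 1)) _ _ rfl ?_
    rw [smul_mul_smul_comm, mul_one]
  commutes := by
    rintro r ⟨m, x⟩
    obtain ⟨a, ha, rfl⟩ := grMk_surj x
    refine gradedMonoid_mk_grMk (a := (r • 1) * a) (b := a * (r • 1)) _ _ (Nat.add_comm 0 m) ?_
    simp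
  smul_def := by
    rintro r ⟨m, x⟩
    obtain ⟨a, ha, rfl⟩ := grMk_surj x
    refine gradedMonoid_mk_grMk (a := r • a) (b := (r • 1) * a) _ _ (Nat.zero_add m).symm ?_
    simp

/-- The map `a + I ^ (d + 1) ↦ f a` on `I ^ d / I ^ (d + 1)`, for a linear form `f` on `A` which
vanishes on `I`. -/
def grLift (f : A →ₗ[k] k) (hf : ∀ a ∈ I, f a = 0) (d : ℕ) : GrPiece I d →ₗ[k] k where
  toFun := Quotient.lift (fun a : ↥(I ^ d) => f a.1) (by
    rintro ⟨a, ha⟩ ⟨b, hb⟩ h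
    have h1 : (⟨a, ha⟩ - ⟨b, hb⟩ : ↥(I ^ d)) ∈ (I ^ (d + 1)).submoduleOf (I ^ d) :=
      (Submodule.quotientRel_def _).1 h
    have h2 : a - b ∈ I ^ (d + 1) := h1
    rw [Submodule.pow_succ] at h2
    have h3 := hf _ (Ideal.mul_le_right h2)
    rwa [map_sub, sub_eq_zero] at h3)
  map_add' x y := by
    obtain ⟨a, ha, rfl⟩ := grMk_surj x
    obtain ⟨b, hb, rfl⟩ := grMk_surj y
    exact map_add f a b
  map_smul' c x := by
    obtain ⟨a, ha, rfl⟩ := grMk_surj x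
    exact map_smul f c a

/-- The associated graded ring `gr_I A = ⨁ d, I ^ d / I ^ (d + 1)`. -/
abbrev GrRing {A : Type u} [Ring A] (I : Ideal A) : Type u := ⨁ d, GrPiece I d

end AssociatedGraded

section Axioms

variable {P : Type u} [PartialOrder P]

/-- The closed interval `[x, y]`, as an element of `Int(P)`. -/
def iv (x y : P) (h : x ≤ y) : NonemptyInterval P := ⟨(x, y), h⟩

/-- The axioms on an equivalence relation `∼` on the set `Int(P)` of closed intervals of `P`. -/
class IncidenceAxioms (r : Setoid (NonemptyInterval P)) : Prop where
  /-- Order-compatibility. -/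
  order_compat : ∀ {x y z x' y' z' : P} (hxy : x ≤ y) (hyz : y ≤ z) (hxy' : x' ≤ y')
    (hyz' : y' ≤ z'), r (iv x y hxy) (iv x' y' hxy') → r (iv y z hyz) (iv y' z' hyz') →
      r (iv x z (hxy.trans hyz)) (iv x' z' (hxy'.trans hyz'))
  /-- Invariance: existence and uniqueness of a map `τ : [x, y] → [x', y']` commuting with the
  interval mappings `z ↦ ([x, z]~, [z, y]~)`. -/
  invariance : ∀ {x y x' y' : P} (hxy : x ≤ y) (hxy' : x' ≤ y'),
    r (iv x y hxy) (iv x' y' hxy') →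
      ∃! τ : Set.Icc x y → Set.Icc x' y', ∀ z : Set.Icc x y,
        r (iv x z z.2.1) (iv x' (τ z) (τ z).2.1) ∧ r (iv z y z.2.2) (iv (τ z) y' (τ z).2.2)
  /-- Finiteness: the relation `x ∼ y ↔ [x, x] ∼ [y, y]` on `P` has finitely many classes. -/
  finite_classes : Finite (Quotient (Setoid.comap (NonemptyInterval.pure (α := P)) r))
  /-- Concatenation. -/
  concatenation : ∀ {x y₁ y₂ z : P} (hx : x ≤ y₁) (hz : y₂ ≤ z),
    r (NonemptyInterval.pure y₁) (NonemptyInterval.pure y₂) →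
      ∃ (x' y' z' : P) (hx' : x' ≤ y') (hz' : y' ≤ z'),
        r (iv x' y' hx') (iv x y₁ hx) ∧ r (iv y' z' hz') (iv y₂ z hz)

variable (r : Setoid (NonemptyInterval P))

/-- `Int(P)/∼`. -/
abbrev IntClass : Type u := Quotient r

/-- `P/∼`, where `x ∼ y` means `[x, x] ∼ [y, y]`. -/
abbrev PointClass : Type u := Quotient (Setoid.comap (NonemptyInterval.pure (α := P)) r)

variable {r}

/-- The class of `[x, y]` in `Int(P)/∼`. -/
def cls (x y : P) (h : x ≤ y) : IntClass r := Quotient.mk r (iv x y h)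

theorem cls_eq {x y x' y' : P} {h : x ≤ y} {h' : x' ≤ y'} :
    cls (r := r) x y h = cls x' y' h' ↔ r (iv x y h) (iv x' y' h') := Quotient.eq

theorem exists_cls (α : IntClass r) : ∃ x y h, α = cls x y h := by
  induction α using Quotient.inductionOn with
  | h I => exact ⟨I.fst, I.snd, I.fst_le_snd, rfl⟩

/-- The class of `[x, x]`, for a class of points. -/
def pointInt : PointClass r → IntClass r :=
  Quotient.map NonemptyInterval.pure fun _ _ h => h

theorem pointInt_mk (x : P) : pointInt (r := r) (Quotient.mk _ x) = cls x x le_rfl := rfl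

theorem pointInt_injective : Function.Injective (pointInt (r := r)) := by
  intro X Y
  induction X using Quotient.inductionOn with
  | h x =>
    induction Y using Quotient.inductionOn with
    | h y => exact fun h => Quotient.sound (cls_eq.1 h)

/-- A class is proper if it is the class of an interval `[x, y]` with `x < y`. -/
def IsProper (α : IntClass r) : Prop := ∃ (x y : P) (h : x < y), cls x y h.le = α

/-- There are `x ≤ y ≤ z` with `[x, y] ∈ α`, `[y, z] ∈ β` and `[x, z] ∈ γ`. -/
def Composes (α β γ : IntClass r) : Prop :=
  ∃ (x y z : P) (hxy : x ≤ y) (hyz : y ≤ z),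
    cls x y hxy = α ∧ cls y z hyz = β ∧ cls x z (hxy.trans hyz) = γ

variable [IncidenceAxioms r]

theorem Composes.unique {α β γ γ' : IntClass r} (h : Composes α β γ) (h' : Composes α β γ') :
    γ = γ' := by
  obtain ⟨x, y, z, hxy, hyz, rfl, rfl, rfl⟩ := h
  obtain ⟨x', y', z', hxy', hyz', h1, h2, rfl⟩ := h'
  exact (cls_eq.2 (IncidenceAxioms.order_compat hxy' hyz' hxy hyz (cls_eq.1 h1)
    (cls_eq.1 h2))).symm

/-- An interval equivalent to a one-point interval is a one-point interval. -/
theorem eq_of_cls_eq_point {u v x : P} (huv : u ≤ v)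
    (h : cls (r := r) u v huv = cls x x le_rfl) : u = v := by
  obtain ⟨τ, hτ, -⟩ := IncidenceAxioms.invariance huv le_rfl (cls_eq.1 h)
  obtain ⟨σ, hσ, -⟩ := IncidenceAxioms.invariance le_rfl huv (cls_eq.1 h.symm)
  have hid := (IncidenceAxioms.invariance (r := r) huv huv (Setoid.refl' r _)).unique
    (y₁ := id) (y₂ := σ ∘ τ) (fun z => ⟨Setoid.refl' r _, Setoid.refl' r _⟩)
    (fun z => ⟨Setoid.trans' r (hτ z).1 (hσ (τ z)).1, Setoid.trans' r (hτ z).2 (hσ (τ z)).2⟩)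
  have hs : ∀ a b : Set.Icc x x, a = b := fun a b =>
    Subtype.ext ((le_antisymm a.2.2 a.2.1).trans (le_antisymm b.2.2 b.2.1).symm)
  have e1 := congrFun hid ⟨u, le_rfl, huv⟩
  have e2 := congrFun hid ⟨v, huv, le_rfl⟩
  simp only [id, Function.comp] at e1 e2
  rw [hs (τ ⟨u, le_rfl, huv⟩) (τ ⟨v, huv, le_rfl⟩), ← e2] at e1
  exact congrArg Subtype.val e1

theorem lt_of_cls_eq {u v x y : P} (huv : u ≤ v) (hxy : x < y)
    (h : cls (r := r) u v huv = cls x y hxy.le) : u < v := by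
  refine lt_of_le_of_ne huv ?_
  rintro rfl
  exact hxy.ne (eq_of_cls_eq_point hxy.le h.symm)

theorem source_eq {x y x' y' : P} {h : x ≤ y} {h' : x' ≤ y'}
    (e : cls (r := r) x y h = cls x' y' h') : cls (r := r) x x le_rfl = cls x' x' le_rfl := by
  obtain ⟨τ, hτ, -⟩ := IncidenceAxioms.invariance h h' (cls_eq.1 e)
  have h1 := cls_eq.2 (hτ ⟨x, le_rfl, h⟩).1
  have h2 := eq_of_cls_eq_point _ h1.symm
  rw [h1]
  congr 1
  exact h2.symm

theorem target_eq {x y x' y' : P} {h : x ≤ y} {h' : x' ≤ y'}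
    (e : cls (r := r) x y h = cls x' y' h') : cls (r := r) y y le_rfl = cls y' y' le_rfl := by
  obtain ⟨τ, hτ, -⟩ := IncidenceAxioms.invariance h h' (cls_eq.1 e)
  have h1 := cls_eq.2 (hτ ⟨y, h, le_rfl⟩).2
  have h2 := eq_of_cls_eq_point _ h1.symm
  rw [h1]
  congr 1

/-- The source map `s : Int(P)/∼ → P/∼`, `[x, y]~ ↦ x~`. -/
def source : IntClass r → PointClass r :=
  Quotient.lift (fun I => Quotient.mk _ I.fst) fun I J h =>
    Quotient.sound (cls_eq.1 (source_eq (r := r) (h := I.fst_le_snd) (h' := J.fst_le_snd)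
      (Quotient.sound h)))

/-- The target map `t : Int(P)/∼ → P/∼`, `[x, y]~ ↦ y~`. -/
def target : IntClass r → PointClass r :=
  Quotient.lift (fun I => Quotient.mk _ I.snd) fun I J h =>
    Quotient.sound (cls_eq.1 (target_eq (r := r) (h := I.fst_le_snd) (h' := J.fst_le_snd)
      (Quotient.sound h)))

theorem composes_assoc (α β γ δ : IntClass r) :
    (∃ ε, Composes α β ε ∧ Composes ε γ δ) ↔ ∃ ε, Composes β γ ε ∧ Composes α ε δ := by
  constructor
  · rintro ⟨ε, ⟨x, y, z, hxy, hyz, rfl, rfl, rfl⟩, x', z', w', hxz', hzw', h1, rfl, rfl⟩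
    obtain ⟨τ, hτ, -⟩ := IncidenceAxioms.invariance (hxy.trans hyz) hxz' (cls_eq.1 h1.symm)
    have h2 := hτ ⟨y, hxy, hyz⟩
    have hm := (τ ⟨y, hxy, hyz⟩).2
    exact ⟨cls (τ ⟨y, hxy, hyz⟩) w' (hm.2.trans hzw'),
      ⟨_, z', w', hm.2, hzw', (cls_eq.2 h2.2).symm, rfl, rfl⟩,
      ⟨x', _, w', hm.1, hm.2.trans hzw', (cls_eq.2 h2.1).symm, rfl, rfl⟩⟩
  · rintro ⟨ε, ⟨y, z, w, hyz, hzw, rfl, rfl, rfl⟩, x', y', w', hxy', hyw', rfl, h1, rfl⟩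
    obtain ⟨τ, hτ, -⟩ := IncidenceAxioms.invariance (hyz.trans hzw) hyw' (cls_eq.1 h1.symm)
    have h2 := hτ ⟨z, hyz, hzw⟩
    have hm := (τ ⟨z, hyz, hzw⟩).2
    exact ⟨cls x' (τ ⟨z, hyz, hzw⟩) (hxy'.trans hm.1),
      ⟨x', y', _, hxy', hm.1, rfl, (cls_eq.2 h2.1).symm, rfl⟩,
      ⟨x', _, w', hxy'.trans hm.1, hm.2, rfl, (cls_eq.2 h2.2).symm, rfl⟩⟩

theorem pointInt_composes {X : PointClass r} {α γ : IntClass r} :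
    Composes (pointInt X) α γ ↔ X = source α ∧ γ = α := by
  induction X using Quotient.inductionOn with
  | h x =>
    constructor
    · rintro ⟨u, v, w, huv, hvw, h1, rfl, rfl⟩
      obtain rfl : u = v := eq_of_cls_eq_point huv h1
      exact ⟨pointInt_injective h1.symm, rfl⟩
    · rintro ⟨h, rfl⟩
      obtain ⟨y, z, hyz, rfl⟩ := exists_cls γ
      exact ⟨y, y, z, le_rfl, hyz, congrArg pointInt h.symm, rfl, rfl⟩

theorem composes_pointInt {X : PointClass r} {α γ : IntClass r} :
    Composes α (pointInt X) γ ↔ X = target α ∧ γ = α := by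
  induction X using Quotient.inductionOn with
  | h x =>
    constructor
    · rintro ⟨u, v, w, huv, hvw, rfl, h1, rfl⟩
      obtain rfl : v = w := eq_of_cls_eq_point hvw h1
      exact ⟨pointInt_injective h1.symm, rfl⟩
    · rintro ⟨h, rfl⟩
      obtain ⟨y, z, hyz, rfl⟩ := exists_cls γ
      exact ⟨y, z, z, hyz, le_rfl, rfl, congrArg pointInt h.symm, rfl⟩

theorem composes_eq_pointInt {X : PointClass r} {α β : IntClass r}
    (h : Composes α β (pointInt X)) : α = pointInt X ∧ β = pointInt X := by
  induction X using Quotient.inductionOn with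
  | h x =>
    obtain ⟨u, v, w, huv, hvw, rfl, rfl, h1⟩ := h
    obtain rfl : u = w := eq_of_cls_eq_point (huv.trans hvw) h1
    obtain rfl : u = v := le_antisymm huv hvw
    exact ⟨h1, h1⟩

theorem not_isProper_pointInt (X : PointClass r) : ¬ IsProper (pointInt X) := by
  induction X using Quotient.inductionOn with
  | h x =>
    rintro ⟨u, v, huv, h⟩
    exact huv.ne (eq_of_cls_eq_point huv.le h)

theorem IsProper.of_left {α β γ : IntClass r} (hα : IsProper α) (h : Composes α β γ) :
    IsProper γ := by
  obtain ⟨u, v, huv, rfl⟩ := hα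
  obtain ⟨x, y, z, hxy, hyz, h1, rfl, rfl⟩ := h
  exact ⟨x, z, (lt_of_cls_eq hxy huv h1).trans_le hyz, rfl⟩

theorem IsProper.of_right {α β γ : IntClass r} (hβ : IsProper β) (h : Composes α β γ) :
    IsProper γ := by
  obtain ⟨u, v, huv, rfl⟩ := hβ
  obtain ⟨x, y, z, hxy, hyz, rfl, h1, rfl⟩ := h
  exact ⟨x, z, hxy.trans_lt (lt_of_cls_eq hyz huv h1), rfl⟩

end Axioms

section Algebra

variable {P : Type u} [PartialOrder P] (k : Type v) [Field k] (r : Setoid (NonemptyInterval P))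

/-- The reduced incidence algebra `k[P]_red`: the `k`-vector space with basis `Int(P)/∼`. -/
def RedAlg : Type (max u v) := IntClass r →₀ k

noncomputable instance : AddCommGroup (RedAlg k r) := inferInstanceAs (AddCommGroup (IntClass r →₀ k))

noncomputable instance : Module k (RedAlg k r) := inferInstanceAs (Module k (IntClass r →₀ k))

variable {r}

/-- The basis vector `ξ_α`. -/
noncomputable def xi (α : IntClass r) : RedAlg k r := Finsupp.single α 1

open Classical in
/-- The product of two basis vectors: `ξ_α ξ_β = ξ_γ` if there are `x ≤ y ≤ z` with
`[x, y] ∈ α`, `[y, z] ∈ β` and `[x, z] ∈ γ`, and `ξ_α ξ_β = 0` otherwise. -/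
noncomputable def xiMul (α β : IntClass r) : RedAlg k r :=
  if h : ∃ γ, Composes α β γ then xi k h.choose else 0

/-- The bilinear extension of `xiMul`. -/
noncomputable def mulLin : RedAlg k r →ₗ[k] RedAlg k r →ₗ[k] RedAlg k r :=
  Finsupp.linearCombination k fun α => Finsupp.linearCombination k fun β => xiMul k α β

variable {k}

theorem mulLin_xi (α β : IntClass r) : mulLin k (xi k α) (xi k β) = xiMul k α β := by
  unfold mulLin xi
  erw [Finsupp.linearCombination_single, one_smul, Finsupp.linearCombination_single, one_smul]

theorem lin_ext {M : Type*} [AddCommMonoid M] [Module k M] {f g : RedAlg k r →ₗ[k] M}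
    (h : ∀ α, f (xi k α) = g (xi k α)) : f = g :=
  Finsupp.lhom_ext' fun α => LinearMap.ext_ring (h α)

theorem xiMul_of_not {α β : IntClass r} (h : ¬ ∃ γ, Composes α β γ) : xiMul k α β = 0 :=
  dif_neg h

variable [IncidenceAxioms r]

theorem xiMul_of {α β γ : IntClass r} (h : Composes α β γ) : xiMul k α β = xi k γ := by
  have h' : ∃ γ, Composes α β γ := ⟨γ, h⟩
  rw [xiMul, dif_pos h', h'.choose_spec.unique h]

theorem mul_assoc_xi (α β γ : IntClass r) :
    mulLin k (xiMul k α β) (xi k γ) = mulLin k (xi k α) (xiMul k β γ) := by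
  by_cases h : ∃ δ, ∃ ε, Composes α β ε ∧ Composes ε γ δ
  · obtain ⟨δ, h⟩ := h
    obtain ⟨ε', h1', h2'⟩ := (composes_assoc α β γ δ).1 h
    obtain ⟨ε, h1, h2⟩ := h
    rw [xiMul_of h1, xiMul_of h1', mulLin_xi, mulLin_xi, xiMul_of h2, xiMul_of h2']
  · have e1 : mulLin k (xiMul k α β) (xi k γ) = 0 := by
      by_cases hε : ∃ ε, Composes α β ε
      · obtain ⟨ε, hε⟩ := hε
        rw [xiMul_of hε, mulLin_xi, xiMul_of_not]
        exact fun ⟨δ, hδ⟩ => h ⟨δ, ε, hε, hδ⟩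
      · rw [xiMul_of_not hε, map_zero, LinearMap.zero_apply]
    have e2 : mulLin k (xi k α) (xiMul k β γ) = 0 := by
      by_cases hε : ∃ ε, Composes β γ ε
      · obtain ⟨ε, hε⟩ := hε
        rw [xiMul_of hε, mulLin_xi, xiMul_of_not]
        exact fun ⟨δ, hδ⟩ => h ⟨δ, (composes_assoc α β γ δ).2 ⟨ε, hε, hδ⟩⟩
      · rw [xiMul_of_not hε, map_zero]
    rw [e1, e2]

theorem mulLin_assoc (a b c : RedAlg k r) :
    mulLin k (mulLin k a b) c = mulLin k a (mulLin k b c) := by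
  have h1 : ∀ α β : IntClass r, mulLin k (mulLin k (xi k α) (xi k β)) =
      mulLin k (xi k α) ∘ₗ mulLin k (xi k β) := fun α β => lin_ext fun γ => by
    rw [LinearMap.comp_apply, mulLin_xi, mulLin_xi, mul_assoc_xi]
  have h2 : ∀ α : IntClass r, (mulLin k).flip c ∘ₗ mulLin k (xi k α) =
      mulLin k (xi k α) ∘ₗ (mulLin k).flip c := fun α => lin_ext fun β =>
    LinearMap.congr_fun (h1 α β) c
  have h3 : (mulLin k).flip c ∘ₗ (mulLin k).flip b = (mulLin k).flip (mulLin k b c) :=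
    lin_ext fun α => LinearMap.congr_fun (h2 α) b
  exact LinearMap.congr_fun h3 a

variable (k r) in
/-- The unit `∑ ξ_x~`, summed over the finite set `P/∼`. -/
noncomputable def redOne : RedAlg k r :=
  letI := IncidenceAxioms.finite_classes (r := r)
  letI := Fintype.ofFinite (PointClass r)
  ∑ X : PointClass r, xi k (pointInt X)

open Classical in
theorem xiMul_pointInt_left (X : PointClass r) (α : IntClass r) :
    xiMul k (pointInt X) α = if X = source α then xi k α else 0 := by
  split_ifs with h
  · exact xiMul_of (pointInt_composes.2 ⟨h, rfl⟩)
  · exact xiMul_of_not fun ⟨γ, hγ⟩ => h (pointInt_composes.1 hγ).1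

open Classical in
theorem xiMul_pointInt_right (X : PointClass r) (α : IntClass r) :
    xiMul k α (pointInt X) = if X = target α then xi k α else 0 := by
  split_ifs with h
  · exact xiMul_of (composes_pointInt.2 ⟨h, rfl⟩)
  · exact xiMul_of_not fun ⟨γ, hγ⟩ => h (composes_pointInt.1 hγ).1

theorem redOne_mulLin (a : RedAlg k r) : mulLin k (redOne k r) a = a := by
  classical
  have h : mulLin k (redOne k r) = LinearMap.id := lin_ext fun α => by
    simp [redOne, mulLin_xi, xiMul_pointInt_left]
  rw [h, LinearMap.id_apply]

theorem mulLin_redOne (a : RedAlg k r) : mulLin k a (redOne k r) = a := by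
  classical
  have h : (mulLin k).flip (redOne k r) = LinearMap.id := lin_ext fun α => by
    simp [redOne, mulLin_xi, xiMul_pointInt_right]
  exact LinearMap.congr_fun h a

noncomputable instance : Ring (RedAlg k r) where
  __ := (inferInstance : AddCommGroup (RedAlg k r))
  mul a b := mulLin k a b
  one := redOne k r
  left_distrib a b c := map_add (mulLin k a) b c
  right_distrib a b c := LinearMap.map_add₂ (mulLin k) a b c
  zero_mul a := LinearMap.map_zero₂ (mulLin k) a
  mul_zero a := map_zero (mulLin k a)
  mul_assoc := mulLin_assoc
  one_mul := redOne_mulLin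
  mul_one := mulLin_redOne

theorem red_mul_def (a b : RedAlg k r) : a * b = mulLin k a b := rfl

noncomputable instance : Algebra k (RedAlg k r) :=
  Algebra.ofModule (fun c a b => LinearMap.map_smul₂ (mulLin k) c a b)
    (fun c a b => map_smul (mulLin k a) c b)

theorem red_induction {p : RedAlg k r → Prop} (a : RedAlg k r) (h0 : p 0)
    (hadd : ∀ a b, p a → p b → p (a + b)) (hsmul : ∀ (c : k) a, p a → p (c • a))
    (hxi : ∀ α, p (xi k α)) : p a := by
  refine Finsupp.induction_linear (motive := p) a h0 hadd fun α c => ?_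
  have : Finsupp.single α c = c • xi k α := by
    unfold xi
    erw [Finsupp.smul_single, smul_eq_mul, mul_one]
  erw [this]
  exact hsmul _ _ (hxi α)

theorem mul_xi_mem (a : RedAlg k r) {β : IntClass r} (hβ : IsProper β) :
    a * xi k β ∈ Submodule.span k (Set.range fun γ : {γ : IntClass r // IsProper γ} => xi k γ.1) := by
  induction a using red_induction with
  | h0 => rw [zero_mul]; exact zero_mem _
  | hadd a b ha hb => rw [add_mul]; exact add_mem ha hb
  | hsmul c a ha => rw [smul_mul_assoc]; exact Submodule.smul_mem _ _ ha
  | hxi α =>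
    rw [red_mul_def, mulLin_xi]
    by_cases h : ∃ γ, Composes α β γ
    · obtain ⟨γ, h⟩ := h
      rw [xiMul_of h]
      exact Submodule.subset_span ⟨⟨γ, hβ.of_right h⟩, rfl⟩
    · rw [xiMul_of_not h]
      exact zero_mem _

theorem xi_mul_mem (a : RedAlg k r) {β : IntClass r} (hβ : IsProper β) :
    xi k β * a ∈ Submodule.span k (Set.range fun γ : {γ : IntClass r // IsProper γ} => xi k γ.1) := by
  induction a using red_induction with
  | h0 => rw [mul_zero]; exact zero_mem _
  | hadd a b ha hb => rw [mul_add]; exact add_mem ha hb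
  | hsmul c a ha => rw [mul_smul_comm]; exact Submodule.smul_mem _ _ ha
  | hxi α =>
    rw [red_mul_def, mulLin_xi]
    by_cases h : ∃ γ, Composes β α γ
    · obtain ⟨γ, h⟩ := h
      rw [xiMul_of h]
      exact Submodule.subset_span ⟨⟨γ, hβ.of_left h⟩, rfl⟩
    · rw [xiMul_of_not h]
      exact zero_mem _

variable (k r) in
/-- The ideal `I` of `k[P]_red`: the `k`-span of the `ξ_α` with `α` the class of an interval
`[x, y]`, `x < y`. -/
noncomputable def redIdeal : Ideal (RedAlg k r) where
  __ := Submodule.span k (Set.range fun γ : {γ : IntClass r // IsProper γ} => xi k γ.1)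
  smul_mem' c x hx := by
    change c * x ∈ Submodule.span k _
    change x ∈ Submodule.span k _ at hx
    induction hx using Submodule.span_induction with
    | mem x hx =>
      obtain ⟨γ, rfl⟩ := hx
      exact mul_xi_mem c γ.2
    | zero => rw [mul_zero]; exact zero_mem _
    | add x y _ _ hx hy => rw [mul_add]; exact add_mem hx hy
    | smul a x _ hx => rw [mul_smul_comm]; exact Submodule.smul_mem _ _ hx

theorem mem_redIdeal {x : RedAlg k r} : x ∈ redIdeal k r ↔
    x ∈ Submodule.span k (Set.range fun γ : {γ : IntClass r // IsProper γ} => xi k γ.1) := Iff.rfl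

instance : (redIdeal k r).IsTwoSided where
  mul_mem_of_left {x} b hx := by
    rw [mem_redIdeal] at hx ⊢
    induction hx using Submodule.span_induction with
    | mem x hx =>
      obtain ⟨γ, rfl⟩ := hx
      exact xi_mul_mem b γ.2
    | zero => rw [zero_mul]; exact zero_mem _
    | add x y _ _ hx hy => rw [add_mul]; exact add_mem hx hy
    | smul a x _ hx => rw [smul_mul_assoc]; exact Submodule.smul_mem _ _ hx

/-- The coefficient of `ξ_x~`, as a linear form on `k[P]_red`. -/
noncomputable def pointCoeff (X : PointClass r) : RedAlg k r →ₗ[k] k :=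
  Finsupp.lapply (pointInt X)

open Classical in
theorem pointCoeff_xi (X : PointClass r) (α : IntClass r) :
    pointCoeff X (xi k α) = if α = pointInt X then 1 else 0 :=
  Finsupp.single_apply

theorem pointCoeff_mul (X : PointClass r) (a b : RedAlg k r) :
    pointCoeff X (a * b) = pointCoeff X a * pointCoeff X b := by
  classical
  induction a using red_induction with
  | h0 => simp
  | hadd a a' h h' => rw [add_mul, map_add, map_add, h, h', add_mul]
  | hsmul c a h => rw [smul_mul_assoc, map_smul, map_smul, h, smul_mul_assoc]
  | hxi α =>
    induction b using red_induction with
    | h0 => simp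
    | hadd a a' h h' => rw [mul_add, map_add, map_add, h, h', mul_add]
    | hsmul c a h => rw [mul_smul_comm, map_smul, map_smul, h, mul_smul_comm]
    | hxi β =>
      rw [red_mul_def, mulLin_xi, pointCoeff_xi, pointCoeff_xi]
      by_cases h : ∃ γ, Composes α β γ
      · obtain ⟨γ, h⟩ := h
        rw [xiMul_of h, pointCoeff_xi]
        by_cases hγ : γ = pointInt X
        · subst hγ
          obtain ⟨rfl, rfl⟩ := composes_eq_pointInt h
          simp
        · rw [if_neg hγ]
          by_cases hα : α = pointInt X
          · subst hα
            rw [if_neg (fun e => hγ ((pointInt_composes.1 h).2.trans e)), mul_zero]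
          · rw [if_neg hα, zero_mul]
      · rw [xiMul_of_not h, map_zero]
        by_cases hα : α = pointInt X
        · subst hα
          rw [if_pos rfl, one_mul, if_neg]
          rintro rfl
          exact h ⟨pointInt X, pointInt_composes.2 ⟨by
            induction X using Quotient.inductionOn with
            | h x => rfl, rfl⟩⟩
        · rw [if_neg hα, zero_mul]

theorem pointCoeff_one (X : PointClass r) : pointCoeff X (1 : RedAlg k r) = 1 := by
  classical
  change pointCoeff X (redOne k r) = 1
  simp [redOne, pointCoeff_xi, pointInt_injective.eq_iff]

theorem pointCoeff_of_mem (X : PointClass r) {a : RedAlg k r} (ha : a ∈ redIdeal k r) :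
    pointCoeff X a = 0 := by
  classical
  rw [mem_redIdeal] at ha
  induction ha using Submodule.span_induction with
  | mem x hx =>
    obtain ⟨γ, rfl⟩ := hx
    rw [pointCoeff_xi, if_neg]
    rintro h
    exact not_isProper_pointInt X (h ▸ γ.2)
  | zero => exact map_zero _
  | add x y _ _ hx hy => rw [map_add, hx, hy, add_zero]
  | smul a x _ hx => rw [map_smul, hx, smul_zero]

end Algebra

section Tor

variable (k : Type v) [Field k] (R : Type u) [Ring R] [Algebra k R]

/-- The relations `m r ⊗ n = m ⊗ r n` defining the tensor product over `R`. -/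
def balanced (M N : Type*) [AddCommGroup M] [Module k M] [Module Rᵐᵒᵖ M]
    [AddCommGroup N] [Module k N] [Module R N] : Submodule k (M ⊗[k] N) :=
  Submodule.span k {t | ∃ (m : M) (a : R) (n : N),
    t = (MulOpposite.op a • m) ⊗ₜ[k] n - m ⊗ₜ[k] (a • n)}

/-- The tensor product `M ⊗_R N` of a right module and a left module over a `k`-algebra `R`. -/
abbrev TensorOver (M N : Type*) [AddCommGroup M] [Module k M] [Module Rᵐᵒᵖ M]
    [AddCommGroup N] [Module k N] [Module R N] : Type _ :=
  (M ⊗[k] N) ⧸ balanced k R M N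

variable {R}

/-- The map `1 ⊗ f : M ⊗_R N → M ⊗_R N'` induced by an `R`-linear map `f`. -/
noncomputable def tensorMap (M : Type*) [AddCommGroup M] [Module k M] [Module Rᵐᵒᵖ M]
    {N N' : Type*} [AddCommGroup N] [Module k N] [Module R N] [IsScalarTower k R N]
    [AddCommGroup N'] [Module k N'] [Module R N'] [IsScalarTower k R N'] (f : N →ₗ[R] N') :
    TensorOver k R M N →ₗ[k] TensorOver k R M N' :=
  Submodule.mapQ _ _ (LinearMap.lTensor M (f.restrictScalars k)) <| by
    refine Submodule.span_le.2 ?_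
    rintro _ ⟨m, a, n, rfl⟩
    exact Submodule.subset_span ⟨m, a, f n, by simp⟩

/-- The degree `j` component of `M ⊗_R N`, for `ℤ`-graded modules `M` and `N`. -/
def tensorDegree {M N : Type*} [AddCommGroup M] [Module k M] [Module Rᵐᵒᵖ M]
    [AddCommGroup N] [Module k N] [Module R N]
    (degM : ℤ → Submodule k M) (degN : ℤ → Submodule k N) (j : ℤ) :
    Submodule k (TensorOver k R M N) :=
  Submodule.span k {t | ∃ a b : ℤ, a + b = j ∧ ∃ m ∈ degM a, ∃ n ∈ degN b,
    t = (balanced k R M N).mkQ (m ⊗ₜ[k] n)}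

/-- `deg` is a `ℤ`-grading of the left module `N` over the graded ring `R = ⨁ d, gr d`. -/
structure IsGradedModule (gr : ℕ → Submodule k R) {N : Type*} [AddCommGroup N] [Module k N]
    [Module R N] (deg : ℤ → Submodule k N) : Prop where
  isInternal : DirectSum.IsInternal deg
  smul_mem : ∀ {a : ℕ} {b : ℤ} {x : R} {n : N}, x ∈ gr a → n ∈ deg b → x • n ∈ deg (a + b)

/-- A graded projective resolution `⋯ → X 1 → X 0 → N → 0` of a `ℤ`-graded left module `N` over
the `ℕ`-graded ring `R`; all maps are `R`-linear and preserve degrees. -/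
structure GradedProjectiveResolution (gr : ℕ → Submodule k R) (N : Type*) [AddCommGroup N]
    [Module k N] [Module R N] (degN : ℤ → Submodule k N) where
  /-- The modules of the resolution. -/
  X : ℕ → Type w
  [addCommGroup : ∀ i, AddCommGroup (X i)]
  [moduleField : ∀ i, Module k (X i)]
  [module : ∀ i, Module R (X i)]
  [isScalarTower : ∀ i, IsScalarTower k R (X i)]
  /-- The gradings. -/
  deg : ∀ i, ℤ → Submodule k (X i)
  isGraded : ∀ i, IsGradedModule k gr (deg i)
  projective : ∀ i, Module.Projective R (X i)
  /-- The differentials. -/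
  d : ∀ i, X (i + 1) →ₗ[R] X i
  d_mem : ∀ i j x, x ∈ deg (i + 1) j → d i x ∈ deg i j
  /-- The augmentation. -/
  aug : X 0 →ₗ[R] N
  aug_mem : ∀ j x, x ∈ deg 0 j → aug x ∈ degN j
  aug_surjective : Function.Surjective aug
  exact_zero : Function.Exact (d 0) aug
  exact_succ : ∀ i, Function.Exact (d (i + 1)) (d i)

attribute [instance] GradedProjectiveResolution.addCommGroup
  GradedProjectiveResolution.moduleField GradedProjectiveResolution.module
  GradedProjectiveResolution.isScalarTower

namespace GradedProjectiveResolution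

variable {k} {gr : ℕ → Submodule k R} {N : Type*} [AddCommGroup N] [Module k N] [Module R N]
  {degN : ℤ → Submodule k N} (Q : GradedProjectiveResolution.{u, v, w} k gr N degN)
  (M : Type*) [AddCommGroup M] [Module k M] [Module Rᵐᵒᵖ M]

/-- The cycles of the complex `M ⊗_R X`. -/
noncomputable def cycles : (i : ℕ) → Submodule k (TensorOver k R M (Q.X i))
  | 0 => ⊤
  | i + 1 => LinearMap.ker (tensorMap k M (Q.d i))

/-- The boundaries of the complex `M ⊗_R X`. -/
noncomputable def boundaries (i : ℕ) : Submodule k (TensorOver k R M (Q.X i)) :=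
  LinearMap.range (tensorMap k M (Q.d i))

/-- `Tor_i^R(M, N)`, computed from the given resolution of `N`: the homology of `M ⊗_R X`. -/
abbrev Tor (i : ℕ) : Type _ := ↥(Q.cycles M i) ⧸ (Q.boundaries M i).submoduleOf (Q.cycles M i)

/-- The component `Tor_i^R(M, N)_j` of internal degree `j`: the classes of the cycles that are
homogeneous of degree `j`. -/
noncomputable def torDegree {M : Type*} [AddCommGroup M] [Module k M] [Module Rᵐᵒᵖ M]
    (degM : ℤ → Submodule k M) (i : ℕ) (j : ℤ) : Submodule k (Q.Tor M i) :=
  ((tensorDegree k degM (Q.deg i) j).submoduleOf (Q.cycles M i)).map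
    ((Q.boundaries M i).submoduleOf (Q.cycles M i)).mkQ

end GradedProjectiveResolution

end Tor

section PointModules

variable {P : Type u} [PartialOrder P] (k : Type v) [Field k] (r : Setoid (NonemptyInterval P))
  [IncidenceAxioms r]

/-- The ring `R = gr_I A` for `A = k[P]_red`. -/
abbrev RedGr : Type (max u v) := GrRing (redIdeal k r)

/-- The homogeneous component `R_d = I ^ d / I ^ (d + 1)`, as a subspace of `R`. -/
noncomputable def redGrading (d : ℕ) : Submodule k (RedGr k r) :=
  LinearMap.range (DirectSum.lof k ℕ (GrPiece (redIdeal k r)) d)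

variable {r}

/-- The linear form `I ^ d / I ^ (d + 1) → k`, `a + I ^ (d + 1) ↦` the coefficient of `ξ_x~` in
`a`. It vanishes for `d ≥ 1`. -/
noncomputable def pieceCoeff (X : PointClass r) (d : ℕ) : GrPiece (redIdeal k r) d →ₗ[k] k :=
  grLift k (pointCoeff X) (fun _ h => pointCoeff_of_mem X h) d

theorem pieceCoeff_grMk (X : PointClass r) {d : ℕ} {a : RedAlg k r} (ha : a ∈ redIdeal k r ^ d) :
    pieceCoeff k X d (grMk a ha) = pointCoeff X a := rfl

/-- The character `R → R_0 = ∏ k_x~ → k_x~ = k`. -/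
noncomputable def pointChar (X : PointClass r) : RedGr k r →ₐ[k] k :=
  DirectSum.toAlgebra k _ (pieceCoeff k X)
    ((pieceCoeff_grMk k X one_mem_pow_zero).trans (pointCoeff_one X))
    (fun {i j} x y => by
      obtain ⟨a, ha, rfl⟩ := grMk_surj x
      obtain ⟨b, hb, rfl⟩ := grMk_surj y
      exact pointCoeff_mul X a b)

/-- The one-dimensional left and right `R`-module `k_x~ = k ξ_x~`, concentrated in degree `0`. -/
def PointModule (_X : PointClass r) : Type v := k

variable (X : PointClass r)

noncomputable instance : AddCommGroup (PointModule k X) := inferInstanceAs (AddCommGroup k)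

noncomputable instance : Module k (PointModule k X) := inferInstanceAs (Module k k)

noncomputable instance : Module (RedGr k r) (PointModule k X) :=
  Module.compHom k (pointChar k X).toRingHom

noncomputable instance : Module (RedGr k r)ᵐᵒᵖ (PointModule k X) :=
  Module.compHom k ((pointChar k X).toRingHom.fromOpposite fun _ _ => Commute.all _ _)

instance : IsScalarTower k (RedGr k r) (PointModule k X) where
  smul_assoc c a m := by
    have h (m : k) : pointChar k X (c • a) * m = c * (pointChar k X a * m) := by
      rw [map_smul, smul_eq_mul, mul_assoc]
    exact h m

instance : IsScalarTower k (RedGr k r)ᵐᵒᵖ (PointModule k X) where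
  smul_assoc c a m := by
    have h (m : k) : pointChar k X (c • a.unop) * m = c * (pointChar k X a.unop * m) := by
      rw [map_smul, smul_eq_mul, mul_assoc]
    exact h m

/-- The grading of `k_x~`, concentrated in degree `0`. -/
noncomputable def pointDegree (j : ℤ) : Submodule k (PointModule k X) := if j = 0 then ⊤ else ⊥

end PointModules

section Simplicial

variable (k : Type v) [Field k] (V : Type u)

/-- Abstract simplicial complexes on a set `V`. The empty face, of dimension `-1`, is allowed, and
so is the void complex without faces. -/
structure FaceComplex where
  /-- The faces. -/
  faces : Set (Finset V)
  down_closed : ∀ {F G : Finset V}, F ∈ faces → G ⊆ F → G ∈ faces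

variable {V}

/-- The sequential layer `Δ^⟨j⟩`: the subcomplex generated by the faces of dimension at least
`j`. -/
def FaceComplex.layer (Δ : FaceComplex V) (j : ℤ) : FaceComplex V where
  faces := {F | ∃ G ∈ Δ.faces, F ⊆ G ∧ j ≤ (G.card : ℤ) - 1}
  down_closed := fun ⟨G, hG, hF, hj⟩ h => ⟨G, hG, h.trans hF, hj⟩

/-- The order complex of a subset `S` of a poset: its faces are the finite chains in `S`. -/
def orderComplex [PartialOrder V] (S : Set V) : FaceComplex V where
  faces := {F | (F : Set V) ⊆ S ∧ IsChain (· ≤ ·) (F : Set V)}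
  down_closed := fun ⟨hS, hc⟩ h =>
    ⟨(Finset.coe_subset.2 h).trans hS, hc.mono (Finset.coe_subset.2 h)⟩

/-- The vector space with the finite subsets of `V` as basis. -/
def ChainSpace (V : Type u) : Type (max u v) := Finset V →₀ k

noncomputable instance (V : Type u) : AddCommGroup (ChainSpace k V) :=
  inferInstanceAs (AddCommGroup (Finset V →₀ k))

noncomputable instance (V : Type u) : Module k (ChainSpace k V) :=
  inferInstanceAs (Module k (Finset V →₀ k))

/-- The basis vector of a finite subset `F`. -/
noncomputable def face (F : Finset V) : ChainSpace k V := Finsupp.single F 1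

/-- The space of simplicial `n`-chains of `Δ`, `n ≥ -1`, with the faces as basis. -/
noncomputable def FaceComplex.chains (Δ : FaceComplex V) (n : ℤ) : Submodule k (ChainSpace k V) :=
  Submodule.span k (face k '' {F | F ∈ Δ.faces ∧ (F.card : ℤ) - 1 = n})

open Classical in
/-- The augmented simplicial boundary map on faces which are chains in a poset, with vertices
ordered increasingly:
`∂ {v_0 < ⋯ < v_n} = ∑ i, (-1) ^ i {v_0 < ⋯ < v_n} \ {v_i}`. -/
noncomputable def boundary [PartialOrder V] : ChainSpace k V →ₗ[k] ChainSpace k V :=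
  Finsupp.linearCombination k fun F =>
    ∑ v ∈ F, (-1 : k) ^ (F.filter (· < v)).card • face k (F.erase v)

open Classical in
theorem boundary_face [PartialOrder V] (F : Finset V) : boundary k (face k F) =
    ∑ v ∈ F, (-1 : k) ^ (F.filter (· < v)).card • face k (F.erase v) := by
  unfold boundary face
  erw [Finsupp.linearCombination_single, one_smul]

/-- Relative cycles: the `n`-chains of `Δ` whose boundary lies in `Γ`. -/
noncomputable def relCycles [PartialOrder V] (Δ Γ : FaceComplex V) (n : ℤ) :
    Submodule k (ChainSpace k V) :=
  Δ.chains k n ⊓ (Γ.chains k (n - 1)).comap (boundary k)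

/-- Relative boundaries: sums of boundaries of `(n + 1)`-chains of `Δ` and `n`-chains of `Γ`. -/
noncomputable def relBoundaries [PartialOrder V] (Δ Γ : FaceComplex V) (n : ℤ) :
    Submodule k (ChainSpace k V) :=
  (Δ.chains k (n + 1)).map (boundary k) ⊔ Γ.chains k n

/-- The relative reduced simplicial homology `H̃_n(Δ, Γ; k)`, for a complex `Δ` whose faces are
chains in a poset, and a subcomplex `Γ`. -/
abbrev RelHomology [PartialOrder V] (Δ Γ : FaceComplex V) (n : ℤ) : Type (max u v) :=
  ↥(relCycles k Δ Γ n) ⧸ (relBoundaries k Δ Γ n).submoduleOf (relCycles k Δ Γ n)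

end Simplicial

end RedInc

open RedInc

/-!
The classes `ζ_α` of the `ξ_α`, with `α` placed in degree `rk α`, form a basis of `R`, and
`ζ_α ζ_β` is `ζ_γ` if `γ` is the composite of `α` and `β` and `rk γ = rk α + rk β`, and `0`
otherwise. The normalized bar resolution relative to the point idempotents therefore computes
`Tor` as the homology of the complex of paths of composable proper classes, which splits
according to the composite `α` of the path. By invariance a path with composite the class of
`[x, y]` is the same as a chain in `(x, y)`, and its degree is the largest number of steps of a
refinement of the chain. So the paths of degree `j` are the faces of the order complex
that lie in a face of dimension `j - 2` but in none of dimension `j - 1`; these span the relative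
chains. Merging two neighbours of a path deletes a point of the chain, and gives `0` in `R`
exactly when the deletion raises the degree.
-/

namespace RedInc

section Subquotient

variable {k V V' : Type*} [Ring k] [AddCommGroup V] [Module k V] [AddCommGroup V'] [Module k V']

/-- The subquotient `Z / (Z ∩ B)` of a module: the homology of a complex with cycles `Z` and
boundaries `B`. -/
abbrev Subquotient (Z B : Submodule k V) : Type _ := ↥Z ⧸ B.submoduleOf Z

/-- The submodule of `Z / (Z ∩ B)` of the classes which have a representative in `D`. -/
def subquotientPart (Z B D : Submodule k V) : Submodule k (Subquotient Z B) :=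
  (D.submoduleOf Z).map (B.submoduleOf Z).mkQ

variable {Z B D : Submodule k V} {Z' B' D' : Submodule k V'} (f : V →ₗ[k] V')

/-- The isomorphism of subquotients induced by a linear map of the ambient modules. -/
noncomputable def subquotientEquiv (hZ : ∀ z ∈ Z, f z ∈ Z') (hB : ∀ z ∈ Z, f z ∈ B' ↔ z ∈ B)
    (hsurj : ∀ w ∈ Z', ∃ z ∈ Z, f z - w ∈ B') : Subquotient Z B ≃ₗ[k] Subquotient Z' B' :=
  LinearEquiv.ofBijective
    (Submodule.mapQ (B.submoduleOf Z) (B'.submoduleOf Z') (f.restrict hZ) fun z hz =>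
      (hB z z.2).2 hz) <| by
    constructor
    · rw [← LinearMap.ker_eq_bot, LinearMap.ker_eq_bot']
      intro q hq
      obtain ⟨z, rfl⟩ := Submodule.Quotient.mk_surjective _ q
      have hfz : f.restrict hZ z ∈ B'.submoduleOf Z' := (Submodule.Quotient.mk_eq_zero _).1 hq
      exact (Submodule.Quotient.mk_eq_zero _).2 ((hB z z.2).1 hfz)
    · intro q
      obtain ⟨w, rfl⟩ := Submodule.Quotient.mk_surjective _ q
      obtain ⟨z, hz, h⟩ := hsurj w w.2
      exact ⟨Submodule.Quotient.mk ⟨z, hz⟩, (Submodule.Quotient.eq _).2 h⟩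

theorem map_subquotientPart_subquotientEquiv (hZ : ∀ z ∈ Z, f z ∈ Z')
    (hB : ∀ z ∈ Z, f z ∈ B' ↔ z ∈ B) (hsurj : ∀ w ∈ Z', ∃ z ∈ Z, f z - w ∈ B')
    (hD : ∀ z ∈ Z, z ∈ D → f z ∈ D')
    (hsurjD : ∀ w ∈ Z', w ∈ D' → ∃ z ∈ Z, z ∈ D ∧ f z - w ∈ B') :
    (subquotientPart Z B D).map (subquotientEquiv f hZ hB hsurj).toLinearMap =
      subquotientPart Z' B' D' := by
  apply le_antisymm
  · rintro _ ⟨_, ⟨z, hz, rfl⟩, rfl⟩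
    exact ⟨⟨f z, hZ z z.2⟩, hD z z.2 hz, rfl⟩
  · rintro _ ⟨w, hw, rfl⟩
    obtain ⟨z, hz, hzD, h⟩ := hsurjD w w.2 hw
    exact ⟨_, ⟨⟨z, hz⟩, hzD, rfl⟩, (Submodule.Quotient.eq _).2 h⟩

variable (Z B D) in
/-- The classes with a representative in `D` form the subquotient `(D ∩ Z) / (D ∩ Z ∩ B)`. -/
noncomputable def subquotientPartEquiv : Subquotient (D ⊓ Z) B ≃ₗ[k] subquotientPart Z B D :=
  let φ : Subquotient (D ⊓ Z) B →ₗ[k] Subquotient Z B :=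
    Submodule.mapQ _ _ (Submodule.inclusion inf_le_right) fun _ hz => hz
  have hφ : Function.Injective φ := by
    rw [← LinearMap.ker_eq_bot, LinearMap.ker_eq_bot']
    intro q hq
    obtain ⟨z, rfl⟩ := Submodule.Quotient.mk_surjective _ q
    have hz : Submodule.inclusion inf_le_right z ∈ B.submoduleOf Z :=
      (Submodule.Quotient.mk_eq_zero _).1 hq
    exact (Submodule.Quotient.mk_eq_zero _).2 hz
  have hrange : LinearMap.range φ = subquotientPart Z B D := by
    apply le_antisymm
    · rintro _ ⟨q, rfl⟩
      obtain ⟨z, rfl⟩ := Submodule.Quotient.mk_surjective _ q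
      exact ⟨⟨z, z.2.2⟩, z.2.1, rfl⟩
    · rintro _ ⟨z, hz, rfl⟩
      exact ⟨Submodule.Quotient.mk ⟨z, hz, z.2⟩, rfl⟩
  (LinearEquiv.ofInjective φ hφ).trans (LinearEquiv.ofEq _ _ hrange)

/-- A chain map which maps `Cₙ` onto `Dₙ` with kernel `Gₙ` induces an isomorphism from the
homology of the pair `(C, G)` to the homology of `D`. -/
theorem nonempty_relative_subquotientEquiv {d : V →ₗ[k] V} {d' : V' →ₗ[k] V'}
    {C C₁ G G₀ : Submodule k V} {E E₁ : Submodule k V'} (hC : C.map f = E) (hC₁ : C₁.map f = E₁)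
    (hG : ∀ z ∈ C, f z = 0 ↔ z ∈ G) (hG₀ : ∀ z ∈ C, f (d z) = 0 ↔ d z ∈ G₀) (hGC : G ≤ C)
    (h₁ : ∀ z ∈ C₁, d z ∈ C) (hf : ∀ z ∈ C, f (d z) = d' (f z))
    (hf₁ : ∀ z ∈ C₁, f (d z) = d' (f z)) :
    Nonempty (Subquotient (C ⊓ G₀.comap d) (C₁.map d ⊔ G) ≃ₗ[k]
      Subquotient (E ⊓ LinearMap.ker d') (E₁.map d')) := by
  subst hC hC₁
  refine ⟨subquotientEquiv f ?_ ?_ ?_⟩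
  · rintro z ⟨hz, hd⟩
    exact ⟨⟨z, hz, rfl⟩, (hf z hz).symm.trans ((hG₀ z hz).2 hd)⟩
  · rintro z ⟨hz, -⟩
    constructor
    · rintro ⟨_, ⟨c, hc, rfl⟩, h⟩
      rw [← hf₁ c hc] at h
      have hzc : z - d c ∈ G := (hG _ (sub_mem hz (h₁ c hc))).1 (by rw [map_sub, h, sub_self])
      rw [← add_sub_cancel (d c) z]
      exact Submodule.add_mem_sup ⟨c, hc, rfl⟩ hzc
    · intro h
      obtain ⟨_, ⟨c, hc, rfl⟩, g, hg, rfl⟩ := Submodule.mem_sup.1 h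
      rw [map_add, (hG g (hGC hg)).2 hg, add_zero, hf₁ c hc]
      exact ⟨_, ⟨c, hc, rfl⟩, rfl⟩
  · rintro _ ⟨⟨c, hc, rfl⟩, h⟩
    exact ⟨c, ⟨hc, (hG₀ c hc).1 ((hf c hc).trans h)⟩, by rw [sub_self]; exact zero_mem _⟩

end Subquotient

section Labels

theorem iSupIndep_of_separating {k M ι : Type*} [Ring k] [AddCommGroup M] [Module k M]
    {p : ι → Submodule k M} (π : ι → M →ₗ[k] M) (hself : ∀ i, ∀ x ∈ p i, π i x = x)
    (hne : ∀ i j, i ≠ j → ∀ x ∈ p j, π i x = 0) : iSupIndep p := by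
  intro i
  rw [Submodule.disjoint_def]
  intro x hx hx'
  have hker : ⨆ j, ⨆ (_ : j ≠ i), p j ≤ LinearMap.ker (π i) :=
    iSup₂_le fun j hj y hy => hne i j hj.symm y hy
  rw [← hself i x hx]
  exact hker hx'

variable {k : Type*} [Ring k] {ι κ L : Type*} (label : ι → L) (label' : κ → L)

open Classical in
/-- The projection of `ι →₀ k` onto the span of the basis vectors with a given label. -/
noncomputable def labelProj (l : L) : (ι →₀ k) →ₗ[k] (ι →₀ k) where
  toFun := Finsupp.filter (label · = l)
  map_add' _ _ := Finsupp.filter_add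
  map_smul' _ _ := Finsupp.filter_smul

variable {label label'}

theorem labelProj_of_mem {l : L} {z : ι →₀ k}
    (hz : z ∈ Finsupp.supported k k (label ⁻¹' {l})) : labelProj label l z = z := by
  classical
  exact (Finsupp.filter_eq_self_iff _ _).2 fun _ hx => hz (Finsupp.mem_support_iff.2 hx)

theorem labelProj_eq_zero {l : L} {s : Set ι} (hs : ∀ i ∈ s, label i ≠ l) {z : ι →₀ k}
    (hz : z ∈ Finsupp.supported k k s) : labelProj label l z = 0 := by
  classical
  refine (Finsupp.filter_eq_zero_iff _ _).2 fun x hx => by_contra fun hzx => ?_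
  exact hs x (hz (Finsupp.mem_support_iff.2 hzx)) hx

theorem labelProj_of_mem_of_ne {l l' : L} (h : l ≠ l') {z : ι →₀ k}
    (hz : z ∈ Finsupp.supported k k (label ⁻¹' {l'})) : labelProj label l z = 0 :=
  labelProj_eq_zero (fun _ hi e => h (e.symm.trans hi)) hz

theorem labelProj_single (i : ι) (l : L) [Decidable (label i = l)] :
    labelProj label l (Finsupp.single i (1 : k)) =
      if label i = l then Finsupp.single i 1 else 0 := by
  split_ifs with h
  · exact labelProj_of_mem (Finsupp.single_mem_supported k 1 h)
  · exact labelProj_of_mem_of_ne (Ne.symm h) (Finsupp.single_mem_supported k 1 rfl)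

theorem labelProj_mem (l : L) (z : ι →₀ k) :
    labelProj label l z ∈ Finsupp.supported k k (label ⁻¹' {l}) := by
  classical
  intro x hx
  exact (Finset.mem_filter.1 hx).2

theorem labelProj_mem_supported {s : Set ι} {z : ι →₀ k} (hz : z ∈ Finsupp.supported k k s)
    (l : L) : labelProj label l z ∈ Finsupp.supported k k s := by
  classical
  exact fun x hx => hz (Finset.mem_filter.1 hx).1

open Classical in
theorem sum_labelProj (z : ι →₀ k) :
    ∑ l ∈ z.support.image label, labelProj label l z = z := by
  ext x
  rw [Finsupp.finsetSum_apply]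
  simp only [labelProj, LinearMap.coe_mk, AddHom.coe_mk, Finsupp.filter_apply]
  rw [Finset.sum_ite_eq, ite_eq_left_iff]
  intro h
  by_contra hx
  exact h (Finset.mem_image_of_mem _ (Finsupp.mem_support_iff.2 (Ne.symm hx)))

theorem labelProj_comm {T : (ι →₀ k) →ₗ[k] (κ →₀ k)} {s : Set ι}
    (hT : ∀ i ∈ s, T (Finsupp.single i 1) ∈ Finsupp.supported k k (label' ⁻¹' {label i}))
    {z : ι →₀ k} (hz : z ∈ Finsupp.supported k k s) (l : L) :
    labelProj label' l (T z) = T (labelProj label l z) := by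
  rw [Finsupp.supported_eq_span_single] at hz
  induction hz using Submodule.span_induction with
  | mem z hz =>
    obtain ⟨i, hi, rfl⟩ := hz
    have hmem : Finsupp.single i (1 : k) ∈ Finsupp.supported k k (label ⁻¹' {label i}) :=
      Finsupp.single_mem_supported k _ rfl
    by_cases h : l = label i
    · rw [h, labelProj_of_mem (hT i hi), labelProj_of_mem hmem]
    · rw [labelProj_of_mem_of_ne h (hT i hi), labelProj_of_mem_of_ne h hmem, map_zero]
  | zero => simp only [map_zero]
  | add x y _ _ hx hy => simp only [map_add, hx, hy]
  | smul c x _ hx => simp only [map_smul, hx]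

theorem isInternal_subquotientPart {J : Type*} [DecidableEq J] {Z B : Submodule k (ι →₀ k)}
    (hZ : ∀ l, ∀ z ∈ Z, labelProj label l z ∈ Z) (hB : ∀ l, ∀ z ∈ B, labelProj label l z ∈ B)
    {e : J → L} (he : Function.Injective e)
    (hsupp : Z ≤ Finsupp.supported k k (label ⁻¹' Set.range e)) :
    DirectSum.IsInternal fun j =>
      subquotientPart Z B (Finsupp.supported k k (label ⁻¹' {e j})) := by
  classical
  rw [DirectSum.isInternal_submodule_iff_iSupIndep_and_iSup_eq_top]
  constructor
  · refine iSupIndep_of_separating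
      (fun j => Submodule.mapQ _ _ ((labelProj label (e j)).restrict (hZ (e j))) fun z hz =>
        hB (e j) z hz) ?_ ?_
    · rintro j _ ⟨z, hz, rfl⟩
      exact congrArg Submodule.Quotient.mk (Subtype.ext (labelProj_of_mem hz))
    · rintro i j hij _ ⟨z, hz, rfl⟩
      refine (Submodule.Quotient.mk_eq_zero _).2 ?_
      have h0 : labelProj label (e i) z.1 = 0 := labelProj_of_mem_of_ne (he.ne hij) hz
      change labelProj label (e i) z.1 ∈ B
      exact h0 ▸ zero_mem B
  · rw [eq_top_iff]
    rintro q -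
    obtain ⟨z, rfl⟩ := Submodule.Quotient.mk_surjective _ q
    have hsum : z = ∑ l ∈ z.1.support.image label, ⟨labelProj label l z, hZ l z z.2⟩ :=
      Subtype.ext (by rw [AddSubmonoidClass.coe_finsetSum]; exact (sum_labelProj z.1).symm)
    rw [hsum, ← Submodule.mkQ_apply, map_sum]
    refine sum_mem fun l hl => ?_
    obtain ⟨i, hi, rfl⟩ := Finset.mem_image.1 hl
    obtain ⟨j, hj⟩ := hsupp z.2 hi
    rw [← hj]
    exact Submodule.mem_iSup_of_mem j ⟨_, labelProj_mem _ _, rfl⟩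

end Labels

theorem isInternal_of_map_equiv {k M M' ι : Type*} [Ring k] [AddCommGroup M] [Module k M]
    [AddCommGroup M'] [Module k M'] [DecidableEq ι] {p : ι → Submodule k M} (e : M ≃ₗ[k] M')
    (h : DirectSum.IsInternal fun i => (p i).map e.toLinearMap) : DirectSum.IsInternal p := by
  rw [DirectSum.isInternal_submodule_iff_iSupIndep_and_iSup_eq_top] at h ⊢
  refine ⟨(iSupIndep_map_orderIso_iff (Submodule.orderIsoMapComap e)).1 h.1, ?_⟩
  refine Submodule.map_injective_of_injective (f := e.toLinearMap) e.injective ?_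
  rw [Submodule.map_iSup, h.2, Submodule.map_top, LinearEquiv.range]

/-- An internal direct sum decomposition, with the summands replaced by isomorphic modules. -/
noncomputable def internalEquivDirectSum {k M ι : Type*} [Ring k] [AddCommGroup M] [Module k M]
    [DecidableEq ι] {p : ι → Submodule k M} (h : DirectSum.IsInternal p) {N : ι → Type*}
    [∀ i, AddCommGroup (N i)] [∀ i, Module k (N i)] (e : ∀ i, p i ≃ₗ[k] N i) :
    M ≃ₗ[k] ⨁ i, N i :=
  (LinearEquiv.ofBijective (DirectSum.coeLinearMap p) h).symm.trans
    (DFinsupp.mapRange.linearEquiv e)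

section GradedVectorSpace

variable {k N N' ι : Type*} [Ring k] [AddCommGroup N] [Module k N] [AddCommGroup N']
  [Module k N'] [DecidableEq ι] {deg : ι → Submodule k N} {deg' : ι → Submodule k N'}

theorem graded_linearMap_ext (h : DirectSum.IsInternal deg) {f g : N →ₗ[k] N'}
    (hfg : ∀ i, ∀ x ∈ deg i, f x = g x) : f = g := by
  have hle : ⨆ i, deg i ≤ LinearMap.eqLocus f g := iSup_le hfg
  rw [h.submodule_iSup_eq_top] at hle
  exact LinearMap.ext fun x => hle trivial

/-- The linear map out of a graded module with given restrictions to the components. -/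
noncomputable def gradedDesc (h : DirectSum.IsInternal deg) (f : ∀ i, deg i →ₗ[k] N') :
    N →ₗ[k] N' :=
  DirectSum.toModule k ι N' f ∘ₗ (LinearEquiv.ofBijective (DirectSum.coeLinearMap deg) h).symm

theorem gradedDesc_apply (h : DirectSum.IsInternal deg) (f : ∀ i, deg i →ₗ[k] N') {i : ι} {x : N}
    (hx : x ∈ deg i) : gradedDesc h f x = f i ⟨x, hx⟩ := by
  have hsymm : (LinearEquiv.ofBijective (DirectSum.coeLinearMap deg) h).symm x =
      DirectSum.lof k ι (fun i => deg i) i ⟨x, hx⟩ := by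
    rw [LinearEquiv.symm_apply_eq]
    exact (DirectSum.coeLinearMap_lof deg i ⟨x, hx⟩).symm
  rw [gradedDesc, LinearMap.comp_apply, LinearEquiv.coe_coe, hsymm, DirectSum.toModule_lof]

/-- The projection of a graded module onto one of its components. -/
noncomputable def gradedProj (h : DirectSum.IsInternal deg) (i : ι) : N →ₗ[k] N :=
  gradedDesc h fun j => if j = i then (deg j).subtype else 0

theorem gradedProj_of_mem (h : DirectSum.IsInternal deg) {i : ι} {x : N} (hx : x ∈ deg i) :
    gradedProj h i x = x := by
  rw [gradedProj, gradedDesc_apply h _ hx, if_pos rfl, Submodule.subtype_apply]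

theorem gradedProj_of_mem_of_ne (h : DirectSum.IsInternal deg) {i j : ι} (hij : i ≠ j) {x : N}
    (hx : x ∈ deg i) : gradedProj h j x = 0 := by
  rw [gradedProj, gradedDesc_apply h _ hx, if_neg hij, LinearMap.zero_apply]

theorem gradedProj_mem (h : DirectSum.IsInternal deg) (i : ι) (x : N) :
    gradedProj h i x ∈ deg i := by
  suffices hle : ⨆ j, deg j ≤ (deg i).comap (gradedProj h i) by
    rw [h.submodule_iSup_eq_top] at hle
    exact hle trivial
  refine iSup_le fun j x hx => ?_
  rw [Submodule.mem_comap]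
  by_cases hji : j = i
  · subst hji
    rwa [gradedProj_of_mem h hx]
  · rw [gradedProj_of_mem_of_ne h hji hx]
    exact zero_mem _

theorem map_gradedProj (h : DirectSum.IsInternal deg) (h' : DirectSum.IsInternal deg')
    {f : N →ₗ[k] N'} {σ : ι → ι} (hσ : Function.Injective σ)
    (hf : ∀ i, ∀ x ∈ deg i, f x ∈ deg' (σ i)) (i : ι) (x : N) :
    f (gradedProj h i x) = gradedProj h' (σ i) (f x) := by
  suffices hcomp : f ∘ₗ gradedProj h i = gradedProj h' (σ i) ∘ₗ f from LinearMap.congr_fun hcomp x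
  refine graded_linearMap_ext h fun j x hx => ?_
  rw [LinearMap.comp_apply, LinearMap.comp_apply]
  by_cases hji : j = i
  · subst hji
    rw [gradedProj_of_mem h hx, gradedProj_of_mem h' (hf j x hx)]
  · rw [gradedProj_of_mem_of_ne h hji hx, map_zero,
      gradedProj_of_mem_of_ne h' (hσ.ne hji) (hf j x hx)]

end GradedVectorSpace

theorem exists_projective_lift {R Q M M' : Type*} [Ring R] [AddCommGroup Q] [Module R Q]
    [AddCommGroup M] [Module R M] [AddCommGroup M'] [Module R M'] [Module.Projective R Q]
    (g : M' →ₗ[R] M) (φ : Q →ₗ[R] M) (h : ∀ x, ∃ y, g y = φ x) :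
    ∃ ψ : Q →ₗ[R] M', ∀ x, g (ψ x) = φ x := by
  obtain ⟨ψ, hψ⟩ := Module.projective_lifting_property g.rangeRestrict
    (φ.codRestrict (LinearMap.range g) h) g.surjective_rangeRestrict
  exact ⟨ψ, fun x => congrArg Subtype.val (LinearMap.congr_fun hψ x)⟩

section GradedLift

variable {k R Q M M' : Type*} [Field k] [Ring R] [Algebra k R] {gr : ℕ → Submodule k R}
  [AddCommGroup Q] [Module k Q] [Module R Q] [IsScalarTower k R Q]
  [AddCommGroup M] [Module k M] [Module R M] [IsScalarTower k R M]
  [AddCommGroup M'] [Module k M'] [Module R M'] [IsScalarTower k R M']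
  {degQ : ℤ → Submodule k Q} {degM : ℤ → Submodule k M} {degM' : ℤ → Submodule k M'}

theorem gradedProj_smul (h : IsGradedModule k gr degM) {a : ℕ} {x : R} (hx : x ∈ gr a) (b : ℤ)
    (m : M) : gradedProj h.isInternal (a + b) (x • m) = x • gradedProj h.isInternal b m :=
  (map_gradedProj (f := Algebra.lsmul k k M x) h.isInternal
    h.isInternal (add_right_injective (a : ℤ)) (fun _ _ hm => h.smul_mem hx hm) b m).symm

theorem exists_degree_zero_part (hgr : ⨆ d, gr d = ⊤) (hQ : IsGradedModule k gr degQ)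
    (hM : IsGradedModule k gr degM) (f : Q →ₗ[R] M) : ∃ f₀ : Q →ₗ[R] M,
      ∀ j, ∀ x ∈ degQ j, f₀ x = gradedProj hM.isInternal j (f x) := by
  let g : Q →ₗ[k] M := gradedDesc hQ.isInternal fun j =>
    gradedProj hM.isInternal j ∘ₗ f.restrictScalars k ∘ₗ (degQ j).subtype
  have hg : ∀ j, ∀ x ∈ degQ j, g x = gradedProj hM.isInternal j (f x) := fun j x hx =>
    gradedDesc_apply hQ.isInternal _ hx
  have hsmul_gr : ∀ d, ∀ a ∈ gr d, ∀ x, g (a • x) = a • g x := by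
    intro d a ha
    suffices hcomp : g ∘ₗ Algebra.lsmul k k Q a = Algebra.lsmul k k M a ∘ₗ g from
      LinearMap.congr_fun hcomp
    refine graded_linearMap_ext hQ.isInternal fun j x hx => ?_
    simp only [LinearMap.comp_apply, Algebra.lsmul_coe]
    rw [hg _ _ (hQ.smul_mem ha hx), hg _ _ hx, map_smul, gradedProj_smul hM ha]
  refine ⟨{ g with map_smul' := fun a x => ?_ }, hg⟩
  change g (a • x) = a • g x
  have ha : a ∈ ⨆ d, gr d := hgr ▸ trivial
  induction ha using Submodule.iSup_induction' with
  | mem d a ha => exact hsmul_gr d a ha x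
  | zero => simp only [zero_smul, map_zero]
  | add a b _ _ ha hb => rw [add_smul, map_add, ha, hb, add_smul]

theorem exists_graded_projective_lift [Module.Projective R Q] (hgr : ⨆ d, gr d = ⊤)
    (hQ : IsGradedModule k gr degQ) (hM : DirectSum.IsInternal degM)
    (hM' : IsGradedModule k gr degM')
    (g : M' →ₗ[R] M) (hg : ∀ j, ∀ x ∈ degM' j, g x ∈ degM j)
    (φ : Q →ₗ[R] M) (hφ : ∀ j, ∀ x ∈ degQ j, φ x ∈ degM j) (h : ∀ x, ∃ y, g y = φ x) :
    ∃ ψ : Q →ₗ[R] M', (∀ j, ∀ x ∈ degQ j, ψ x ∈ degM' j) ∧ ∀ x, g (ψ x) = φ x := by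
  obtain ⟨ψ, hψ⟩ := exists_projective_lift g φ h
  obtain ⟨ψ₀, hψ₀⟩ := exists_degree_zero_part hgr hQ hM' ψ
  refine ⟨ψ₀, fun j x hx => ?_, ?_⟩
  · rw [hψ₀ j x hx]
    exact gradedProj_mem _ _ _
  · suffices hcomp : (g ∘ₗ ψ₀).restrictScalars k = φ.restrictScalars k from
      LinearMap.congr_fun hcomp
    refine graded_linearMap_ext hQ.isInternal fun j x hx => ?_
    have hproj := map_gradedProj (f := g.restrictScalars k) hM'.isInternal hM
      Function.injective_id hg j (ψ x)
    simp only [LinearMap.restrictScalars_apply, id_eq] at hproj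
    rw [LinearMap.restrictScalars_apply, LinearMap.comp_apply, hψ₀ j x hx, hproj, hψ,
      gradedProj_of_mem hM (hφ j x hx), LinearMap.restrictScalars_apply]

end GradedLift

theorem exists_seq_of_step {α : ℕ → Type*} {q : α 0 → Prop} {p : ∀ i, α i → α (i + 1) → Prop}
    (h0 : ∃ a b, q a ∧ p 0 a b) (hs : ∀ i a b, p i a b → ∃ c, p (i + 1) b c) :
    ∃ f : ∀ i, α i, q (f 0) ∧ ∀ i, p i (f i) (f (i + 1)) := by
  obtain ⟨a, b, hq, hp⟩ := h0
  choose next hnext using hs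
  let seq : ∀ i, {s : α i × α (i + 1) // p i s.1 s.2} := fun i =>
    Nat.rec ⟨(a, b), hp⟩ (fun i s => ⟨(s.1.2, next i s.1.1 s.1.2 s.2), hnext i _ _ s.2⟩) i
  exact ⟨fun i => (seq i).1.1, hq, fun i => (seq i).2⟩

namespace GradedProjectiveResolution

universe w'

variable {k : Type v} [Field k] {R : Type u} [Ring R] [Algebra k R] {gr : ℕ → Submodule k R}
  {N : Type*} [AddCommGroup N] [Module k N] [Module R N]
  {degN : ℤ → Submodule k N} (Q : GradedProjectiveResolution.{u, v, w} k gr N degN)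
  (B : GradedProjectiveResolution.{u, v, w'} k gr N degN)

theorem d_d (i : ℕ) (x : Q.X (i + 2)) : Q.d i (Q.d (i + 1) x) = 0 :=
  (Q.exact_succ i _).2 ⟨x, rfl⟩

theorem aug_d (x : Q.X 1) : Q.aug (Q.d 0 x) = 0 :=
  (Q.exact_zero _).2 ⟨x, rfl⟩

theorem exists_comparison [IsScalarTower k R N] (hgr : ⨆ d, gr d = ⊤)
    (hN : DirectSum.IsInternal degN) :
    ∃ f : ∀ i, Q.X i →ₗ[R] B.X i, (∀ i j, ∀ x ∈ Q.deg i j, f i x ∈ B.deg i j) ∧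
      (∀ i x, B.d i (f (i + 1) x) = f i (Q.d i x)) ∧ ∀ x, B.aug (f 0 x) = Q.aug x := by
  have := Q.projective
  suffices h : ∃ f : ∀ i, {f : Q.X i →ₗ[R] B.X i // ∀ j, ∀ x ∈ Q.deg i j, f x ∈ B.deg i j},
      (∀ x, B.aug ((f 0).1 x) = Q.aug x) ∧
        ∀ i, ∀ x, B.d i ((f (i + 1)).1 x) = (f i).1 (Q.d i x) by
    obtain ⟨f, h0, h⟩ := h
    exact ⟨fun i => (f i).1, fun i => (f i).2, h, h0⟩
  refine exists_seq_of_step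
    (α := fun i => {f : Q.X i →ₗ[R] B.X i // ∀ j, ∀ x ∈ Q.deg i j, f x ∈ B.deg i j})
    (q := fun f => ∀ x, B.aug (f.1 x) = Q.aug x)
    (p := fun i f g => ∀ x, B.d i (g.1 x) = f.1 (Q.d i x)) ?_ ?_
  · obtain ⟨a, ha, hca⟩ := exists_graded_projective_lift hgr (Q.isGraded 0) hN (B.isGraded 0)
      B.aug B.aug_mem Q.aug Q.aug_mem (fun x => B.aug_surjective _)
    obtain ⟨b, hb, hcb⟩ := exists_graded_projective_lift hgr (Q.isGraded 1)
      (B.isGraded 0).isInternal (B.isGraded 1) (B.d 0) (B.d_mem 0) (a ∘ₗ Q.d 0)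
      (fun j x hx => ha j _ (Q.d_mem 0 j x hx)) (fun x => (B.exact_zero _).1 (by
        rw [LinearMap.comp_apply, hca, Q.aug_d]))
    exact ⟨⟨a, ha⟩, ⟨b, hb⟩, hca, hcb⟩
  · rintro i ⟨a, ha⟩ ⟨b, hb⟩ hab
    obtain ⟨c, hc, hcc⟩ := exists_graded_projective_lift hgr (Q.isGraded (i + 2))
      (B.isGraded (i + 1)).isInternal (B.isGraded (i + 2)) (B.d (i + 1)) (B.d_mem (i + 1))
      (b ∘ₗ Q.d (i + 1))
      (fun j x hx => hb j _ (Q.d_mem (i + 1) j x hx)) (fun x => (B.exact_succ i _).1 (by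
        rw [LinearMap.comp_apply, hab, Q.d_d, map_zero]))
    exact ⟨⟨c, hc⟩, hcc⟩

theorem exists_homotopy (φ : ∀ i, Q.X i →ₗ[R] B.X i)
    (hφ : ∀ i x, B.d i (φ (i + 1) x) = φ i (Q.d i x)) (h0 : ∀ x, B.aug (φ 0 x) = 0) :
    ∃ h : ∀ i, Q.X i →ₗ[R] B.X (i + 1), (∀ x, B.d 0 (h 0 x) = φ 0 x) ∧
      ∀ i x, B.d (i + 1) (h (i + 1) x) + h i (Q.d i x) = φ (i + 1) x := by
  have := Q.projective
  have hstep : ∀ i (a : Q.X i →ₗ[R] B.X (i + 1)),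
      (∀ x, B.d i (φ (i + 1) x - a (Q.d i x)) = 0) →
        ∃ b : Q.X (i + 1) →ₗ[R] B.X (i + 2), ∀ x, B.d (i + 1) (b x) + a (Q.d i x) =
          φ (i + 1) x := by
    intro i a ha
    obtain ⟨b, hb⟩ := exists_projective_lift (B.d (i + 1)) (φ (i + 1) - a ∘ₗ Q.d i)
      fun x => (B.exact_succ i _).1 (ha x)
    exact ⟨b, fun x => eq_sub_iff_add_eq.1 (hb x)⟩
  refine exists_seq_of_step (α := fun i => Q.X i →ₗ[R] B.X (i + 1))
    (q := fun h => ∀ x, B.d 0 (h x) = φ 0 x)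
    (p := fun i a b => ∀ x, B.d (i + 1) (b x) + a (Q.d i x) = φ (i + 1) x) ?_ ?_
  · obtain ⟨a, ha⟩ := exists_projective_lift (B.d 0) (φ 0) fun x => (B.exact_zero _).1 (h0 x)
    obtain ⟨b, hb⟩ := hstep 0 a fun x => by rw [map_sub, hφ, ha, sub_self]
    exact ⟨a, b, ha, hb⟩
  · intro i a b hab
    refine hstep (i + 1) b fun x => ?_
    have hd := hab (Q.d (i + 1) x)
    rw [Q.d_d, map_zero, add_zero] at hd
    rw [map_sub, hφ, hd, sub_self]

end GradedProjectiveResolution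

section TensorOver

variable (k : Type v) [Field k] {R : Type u} [Ring R] [Algebra k R]
  (M : Type*) [AddCommGroup M] [Module k M] [Module Rᵐᵒᵖ M]
  {N N' N'' : Type*} [AddCommGroup N] [Module k N] [Module R N] [IsScalarTower k R N]
  [AddCommGroup N'] [Module k N'] [Module R N'] [IsScalarTower k R N']
  [AddCommGroup N''] [Module k N''] [Module R N''] [IsScalarTower k R N'']

omit [Algebra k R] [IsScalarTower k R N] in
theorem tensorOver_ext {V : Type*} [AddCommGroup V] [Module k V]
    {f g : TensorOver k R M N →ₗ[k] V}
    (h : ∀ m n, f ((balanced k R M N).mkQ (m ⊗ₜ n)) = g ((balanced k R M N).mkQ (m ⊗ₜ n))) :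
    f = g :=
  Submodule.linearMap_qext _ (TensorProduct.ext' h)

theorem tensorMap_comp (f : N →ₗ[R] N') (g : N' →ₗ[R] N'') :
    tensorMap k M (g ∘ₗ f) = tensorMap k M g ∘ₗ tensorMap k M f :=
  tensorOver_ext k M fun _ _ => rfl

theorem tensorMap_id : tensorMap k M (LinearMap.id : N →ₗ[R] N) = LinearMap.id :=
  tensorOver_ext k M fun _ _ => rfl

theorem tensorMap_add (f g : N →ₗ[R] N') :
    tensorMap k M (f + g) = tensorMap k M f + tensorMap k M g :=
  tensorOver_ext k M fun m n =>
    congrArg (balanced k R M N').mkQ (TensorProduct.tmul_add m (f n) (g n))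

theorem tensorMap_sub (f g : N →ₗ[R] N') :
    tensorMap k M (f - g) = tensorMap k M f - tensorMap k M g := by
  rw [eq_sub_iff_add_eq, ← tensorMap_add, sub_add_cancel]

variable {M}

theorem tensorMap_mem_tensorDegree {degM : ℤ → Submodule k M} {deg : ℤ → Submodule k N}
    {deg' : ℤ → Submodule k N'} {f : N →ₗ[R] N'} (hf : ∀ j, ∀ x ∈ deg j, f x ∈ deg' j) (j : ℤ) :
    ∀ x ∈ tensorDegree (R := R) k degM deg j,
      tensorMap k M f x ∈ tensorDegree (R := R) k degM deg' j := by
  suffices hle : tensorDegree (R := R) k degM deg j ≤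
      (tensorDegree (R := R) k degM deg' j).comap (tensorMap k M f) from hle
  refine Submodule.span_le.2 ?_
  rintro _ ⟨a, b, hab, m, hm, n, hn, rfl⟩
  exact Submodule.subset_span ⟨a, b, hab, m, hm, f n, hf b n hn, rfl⟩

end TensorOver

namespace GradedProjectiveResolution

universe w'

variable {k : Type v} [Field k] {R : Type u} [Ring R] [Algebra k R] {gr : ℕ → Submodule k R}
  {N : Type*} [AddCommGroup N] [Module k N] [Module R N]
  {degN : ℤ → Submodule k N} (Q : GradedProjectiveResolution.{u, v, w} k gr N degN)
  (B : GradedProjectiveResolution.{u, v, w'} k gr N degN)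
  (M : Type*) [AddCommGroup M] [Module k M] [Module Rᵐᵒᵖ M]

section ChainMap

variable {Q B} {f : ∀ i, Q.X i →ₗ[R] B.X i} (hf : ∀ i x, B.d i (f (i + 1) x) = f i (Q.d i x))

include hf

theorem tensorMap_d_comm (i : ℕ) (x : TensorOver k R M (Q.X (i + 1))) :
    tensorMap k M (B.d i) (tensorMap k M (f (i + 1)) x) =
      tensorMap k M (f i) (tensorMap k M (Q.d i) x) := by
  have hcomp : B.d i ∘ₗ f (i + 1) = f i ∘ₗ Q.d i := LinearMap.ext (hf i)
  rw [← LinearMap.comp_apply, ← LinearMap.comp_apply, ← tensorMap_comp, ← tensorMap_comp, hcomp]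

theorem tensorMap_mem_cycles (i : ℕ) :
    ∀ z ∈ Q.cycles M i, tensorMap k M (f i) z ∈ B.cycles M i := by
  intro z hz
  cases i with
  | zero => trivial
  | succ i => exact (tensorMap_d_comm M hf i z).trans (by rw [LinearMap.mem_ker.1 hz, map_zero])

theorem tensorMap_mem_boundaries (i : ℕ) :
    ∀ z ∈ Q.boundaries M i, tensorMap k M (f i) z ∈ B.boundaries M i := by
  rintro _ ⟨z, rfl⟩
  exact ⟨tensorMap k M (f (i + 1)) z, tensorMap_d_comm M hf i z⟩

end ChainMap

theorem tensorMap_sub_self_mem_boundaries {φ : ∀ i, Q.X i →ₗ[R] Q.X i}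
    (hφ : ∀ i x, Q.d i (φ (i + 1) x) = φ i (Q.d i x)) (hφ0 : ∀ x, Q.aug (φ 0 x) = Q.aug x)
    (i : ℕ) : ∀ z ∈ Q.cycles M i, tensorMap k M (φ i) z - z ∈ Q.boundaries M i := by
  obtain ⟨h, h0, hs⟩ := exists_homotopy Q Q (fun i => φ i - LinearMap.id)
    (fun i x => by simp only [LinearMap.sub_apply, LinearMap.id_apply, map_sub, hφ])
    (fun x => by rw [LinearMap.sub_apply, LinearMap.id_apply, map_sub, hφ0, sub_self])
  intro z hz
  have hsub : tensorMap k M (φ i) z - z = tensorMap k M (φ i - LinearMap.id) z := by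
    rw [tensorMap_sub, tensorMap_id, LinearMap.sub_apply, LinearMap.id_apply]
  rw [hsub]
  cases i with
  | zero =>
    have hzero : Q.d 0 ∘ₗ h 0 = φ 0 - LinearMap.id := LinearMap.ext h0
    exact ⟨tensorMap k M (h 0) z, by rw [← hzero, tensorMap_comp, LinearMap.comp_apply]⟩
  | succ i =>
    have hsucc : Q.d (i + 1) ∘ₗ h (i + 1) + h i ∘ₗ Q.d i = φ (i + 1) - LinearMap.id :=
      LinearMap.ext (hs i)
    refine ⟨tensorMap k M (h (i + 1)) z, ?_⟩
    rw [← hsucc, tensorMap_add, tensorMap_comp, tensorMap_comp, LinearMap.add_apply,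
      LinearMap.comp_apply, LinearMap.comp_apply, LinearMap.mem_ker.1 hz, map_zero, add_zero]

variable {M}

theorem exists_torEquiv [IsScalarTower k R N] (hgr : ⨆ d, gr d = ⊤)
    (hN : DirectSum.IsInternal degN) (degM : ℤ → Submodule k M) (i : ℕ) :
    ∃ e : Q.Tor M i ≃ₗ[k] B.Tor M i,
      ∀ j, (Q.torDegree degM i j).map e.toLinearMap = B.torDegree degM i j := by
  obtain ⟨f, hfd, hf, hf0⟩ := exists_comparison Q B hgr hN
  obtain ⟨g, hgd, hg, hg0⟩ := exists_comparison B Q hgr hN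
  have hgf : ∀ z ∈ Q.cycles M i,
      tensorMap k M (g i) (tensorMap k M (f i) z) - z ∈ Q.boundaries M i := by
    have := Q.tensorMap_sub_self_mem_boundaries M (φ := fun i => g i ∘ₗ f i)
      (fun i x => by simp only [LinearMap.comp_apply, hf, hg])
      (fun x => by simp only [LinearMap.comp_apply, hf0, hg0]) i
    simpa only [tensorMap_comp, LinearMap.comp_apply] using this
  have hfg : ∀ w ∈ B.cycles M i,
      tensorMap k M (f i) (tensorMap k M (g i) w) - w ∈ B.boundaries M i := by
    have := B.tensorMap_sub_self_mem_boundaries M (φ := fun i => f i ∘ₗ g i)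
      (fun i x => by simp only [LinearMap.comp_apply, hf, hg])
      (fun x => by simp only [LinearMap.comp_apply, hf0, hg0]) i
    simpa only [tensorMap_comp, LinearMap.comp_apply] using this
  have hgZ := tensorMap_mem_cycles M hg i
  refine ⟨subquotientEquiv (tensorMap k M (f i)) (tensorMap_mem_cycles M hf i)
    (fun z hz => ⟨fun h => ?_, tensorMap_mem_boundaries M hf i z⟩)
    (fun w hw => ⟨_, hgZ w hw, hfg w hw⟩), fun j => ?_⟩
  · rw [← sub_sub_cancel (tensorMap k M (g i) (tensorMap k M (f i) z)) z]
    exact sub_mem (tensorMap_mem_boundaries M hg i _ h) (hgf z hz)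
  · exact map_subquotientPart_subquotientEquiv _ _ _ _
      (fun z _ hz => tensorMap_mem_tensorDegree k (hfd i) j z hz)
      (fun w hw hwj =>
        ⟨_, hgZ w hw, tensorMap_mem_tensorDegree k (hgd i) j w hwj, hfg w hw⟩)

end GradedProjectiveResolution

theorem supported_le {k ι : Type*} [Field k] {s : Set ι} {S : Submodule k (ι →₀ k)}
    (h : ∀ i ∈ s, Finsupp.single i 1 ∈ S) : Finsupp.supported k k s ≤ S := by
  rw [Finsupp.supported_eq_span_single, Submodule.span_le]
  exact Set.image_subset_iff.2 h

/-- A homogeneous basis, indexed by `E`, of an algebra graded in nonnegative degrees, adapted to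
the Peirce decomposition `⨁ e_X R e_Y` for idempotents `e_X`, `X : V`, which are themselves basis
elements and are the only ones of degree `0`. The basis element `α` lies in
`e_(source α) R e_(target α)`. -/
structure PeirceBasis (k : Type*) [Field k] (R : Type*) [Ring R] [Algebra k R] (V E : Type*) where
  /-- The basis. -/
  basis : Module.Basis E k R
  /-- The degrees of the basis elements. -/
  deg : E → ℕ
  /-- The index of the idempotent fixing a basis element on the left. -/
  source : E → V
  /-- The index of the idempotent fixing a basis element on the right. -/
  target : E → V
  /-- The indices of the idempotents. -/
  idem : V → E
  source_idem : ∀ X, source (idem X) = X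
  target_idem : ∀ X, target (idem X) = X
  deg_eq_zero_iff : ∀ α, deg α = 0 ↔ α = idem (source α)
  idem_mul : ∀ α, basis (idem (source α)) * basis α = basis α
  mul_idem : ∀ α, basis α * basis (idem (target α)) = basis α
  mul_support : ∀ α β γ, basis.repr (basis α * basis β) γ ≠ 0 →
    source γ = source α ∧ target γ = target β ∧ deg γ = deg α + deg β

namespace PeirceBasis

variable {k : Type*} [Field k] {R : Type*} [Ring R] [Algebra k R] {V E : Type*}
  (b : PeirceBasis k R V E)

/-- The homogeneous component of degree `d` of the algebra. -/
def grading (d : ℕ) : Submodule k R :=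
  Submodule.span k (b.basis '' {α | b.deg α = d})

/-- The list `l` is a sequence of composable basis elements of positive degree leading from `X`
to `Y`. -/
def IsPath (Y : V) : V → List E → Prop
  | X, [] => X = Y
  | X, α :: l => b.source α = X ∧ 0 < b.deg α ∧ IsPath Y (b.target α) l

/-- The total degree of a list of basis elements. -/
def weight (l : List E) : ℤ :=
  (l.map fun α => (b.deg α : ℤ)).sum

/-- The span of the lists of total degree `j`. -/
def weightSpan (j : ℤ) : Submodule k (List E →₀ k) :=
  Finsupp.supported k k (b.weight ⁻¹' {j})

/-- The span of the paths from `X` to `Y` of length `n`. -/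
def pathSpan (X Y : V) (n : ℕ) : Submodule k (List E →₀ k) :=
  Finsupp.supported k k {l | b.IsPath Y X l ∧ l.length = n}

/-- Prepending an element of the algebra, expanded in the basis, to a combination of lists. -/
noncomputable def cons : R →ₗ[k] (List E →₀ k) →ₗ[k] (List E →₀ k) :=
  b.basis.constr k fun α => Finsupp.lmapDomain k k (List.cons α)

/-- Multiplying the first entry of a list on the left by an element of the algebra. The empty list
is sent to `0`. -/
noncomputable def mulHead : R →ₗ[k] (List E →₀ k) →ₗ[k] (List E →₀ k) :=
  LinearMap.flip <| Finsupp.lsum k fun l => LinearMap.toSpanSingleton k _ <|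
    match l with
    | [] => 0
    | β :: l => b.cons.flip (Finsupp.single l 1) ∘ₗ LinearMap.mulRight k (b.basis β)

/-- The alternating sum of the lists obtained by multiplying two consecutive entries of a list. -/
noncomputable def mergeList : List E → (List E →₀ k)
  | [] => 0
  | α :: l => b.mulHead (b.basis α) (Finsupp.single l 1) - b.cons (b.basis α) (mergeList l)

/-- The differential of the reduced bar complex, which is spanned by the paths. -/
noncomputable def merge : (List E →₀ k) →ₗ[k] (List E →₀ k) :=
  Finsupp.linearCombination k b.mergeList

variable {b}

theorem deg_idem (X : V) : b.deg (b.idem X) = 0 := by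
  rw [b.deg_eq_zero_iff, b.source_idem]

theorem weight_cons (α : E) (l : List E) : b.weight (α :: l) = b.deg α + b.weight l :=
  rfl

theorem cons_basis (α : E) (l : List E) :
    b.cons (b.basis α) (Finsupp.single l 1) = Finsupp.single (α :: l) 1 := by
  rw [cons, Module.Basis.constr_basis, Finsupp.lmapDomain_apply, Finsupp.mapDomain_single]

theorem mulHead_nil (x : R) : b.mulHead x (Finsupp.single [] 1) = 0 := by
  simp only [mulHead, LinearMap.flip_apply, Finsupp.lsum_single,
    LinearMap.toSpanSingleton_apply, smul_zero, LinearMap.zero_apply]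

theorem mulHead_cons (x y : R) (v : List E →₀ k) :
    b.mulHead x (b.cons y v) = b.cons (x * y) v := by
  suffices h : ∀ β l, b.mulHead x (b.cons (b.basis β) (Finsupp.single l 1)) =
      b.cons (x * b.basis β) (Finsupp.single l 1) by
    suffices hcomp : b.cons.compr₂ (b.mulHead x) = b.cons ∘ₗ LinearMap.mulLeft k x from
      LinearMap.congr_fun₂ hcomp y v
    exact b.basis.ext fun β => Finsupp.lhom_ext' fun l => LinearMap.ext_ring (h β l)
  intro β l
  simp only [cons_basis, mulHead, LinearMap.flip_apply, Finsupp.lsum_single,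
    LinearMap.toSpanSingleton_apply, one_smul, LinearMap.comp_apply, LinearMap.mulRight_apply]

theorem mulHead_mulHead (x y : R) (v : List E →₀ k) :
    b.mulHead x (b.mulHead y v) = b.mulHead (x * y) v := by
  suffices hcomp : b.mulHead x ∘ₗ b.mulHead y = b.mulHead (x * y) from
    LinearMap.congr_fun hcomp v
  refine Finsupp.lhom_ext' fun l => LinearMap.ext_ring ?_
  cases l with
  | nil => simp only [LinearMap.comp_apply, Finsupp.lsingle_apply, mulHead_nil, map_zero]
  | cons α l =>
    simp only [LinearMap.comp_apply, Finsupp.lsingle_apply]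
    rw [← cons_basis (b := b), mulHead_cons, mulHead_cons, mulHead_cons, mul_assoc]

theorem merge_single (l : List E) : b.merge (Finsupp.single l 1) = b.mergeList l := by
  rw [merge, Finsupp.linearCombination_single, one_smul]

theorem merge_cons (x : R) (v : List E →₀ k) :
    b.merge (b.cons x v) = b.mulHead x v - b.cons x (b.merge v) := by
  suffices hcomp : b.cons.compr₂ b.merge + b.cons.compl₂ b.merge = b.mulHead from
    eq_sub_of_add_eq (LinearMap.congr_fun₂ hcomp x v)
  refine b.basis.ext fun α => Finsupp.lhom_ext' fun l => LinearMap.ext_ring ?_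
  change b.merge (b.cons (b.basis α) (Finsupp.single l 1)) +
      b.cons (b.basis α) (b.merge (Finsupp.single l 1)) =
    b.mulHead (b.basis α) (Finsupp.single l 1)
  rw [cons_basis, merge_single, merge_single, mergeList, sub_add_cancel]

theorem merge_mulHead (x : R) (v : List E →₀ k) :
    b.merge (b.mulHead x v) = b.mulHead x (b.merge v) := by
  suffices hcomp : b.merge ∘ₗ b.mulHead x = b.mulHead x ∘ₗ b.merge from
    LinearMap.congr_fun hcomp v
  refine Finsupp.lhom_ext' fun l => LinearMap.ext_ring ?_
  simp only [LinearMap.comp_apply, Finsupp.lsingle_apply]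
  cases l with
  | nil => rw [mulHead_nil, merge_single, mergeList, map_zero, map_zero]
  | cons β l =>
    rw [← cons_basis (b := b), mulHead_cons, merge_cons, merge_cons, map_sub, mulHead_mulHead,
      mulHead_cons]

theorem merge_merge (v : List E →₀ k) : b.merge (b.merge v) = 0 := by
  suffices hcomp : b.merge ∘ₗ b.merge = 0 from LinearMap.congr_fun hcomp v
  refine Finsupp.lhom_ext' fun l => LinearMap.ext_ring ?_
  change b.merge (b.merge (Finsupp.single l 1)) = 0
  induction l with
  | nil => rw [merge_single, mergeList, map_zero]
  | cons α l ih =>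
    rw [← cons_basis (b := b), merge_cons, map_sub, merge_cons, merge_mulHead, ih, map_zero,
      sub_zero, sub_self]

theorem basis_mul_mem_span (α β : E) : b.basis α * b.basis β ∈
    Submodule.span k (b.basis '' {γ | b.source γ = b.source α ∧ b.target γ = b.target β ∧
      b.deg γ = b.deg α + b.deg β}) :=
  b.basis.mem_span_image.2 fun γ hγ => b.mul_support α β γ (Finsupp.mem_support_iff.1 hγ)

theorem cons_mem_supported {s : Set E} {t t' : Set (List E)}
    (h : ∀ α ∈ s, ∀ l ∈ t, α :: l ∈ t') {x : R} (hx : x ∈ Submodule.span k (b.basis '' s))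
    {v : List E →₀ k} (hv : v ∈ Finsupp.supported k k t) :
    b.cons x v ∈ Finsupp.supported k k t' := by
  suffices hle : Submodule.span k (b.basis '' s) ≤
      (Finsupp.supported k k t').comap (b.cons.flip v) from hle hx
  refine Submodule.span_le.2 ?_
  rintro _ ⟨α, hα, rfl⟩
  suffices hle : Finsupp.supported k k t ≤
      (Finsupp.supported k k t').comap (b.cons (b.basis α)) from hle hv
  refine supported_le fun l hl => ?_
  rw [Submodule.mem_comap, cons_basis]
  exact Finsupp.single_mem_supported k 1 (h α hα l hl)

theorem cons_basis_mem_supported {t t' : Set (List E)} {α : E} (h : ∀ l ∈ t, α :: l ∈ t')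
    {v : List E →₀ k} (hv : v ∈ Finsupp.supported k k t) :
    b.cons (b.basis α) v ∈ Finsupp.supported k k t' :=
  cons_mem_supported (s := {α}) (fun _ hα => hα ▸ h)
    (Submodule.subset_span (Set.mem_image_of_mem _ rfl)) hv

theorem cons_basis_mul_mem_supported {t' : Set (List E)} {α β : E} {l : List E}
    (h : ∀ γ, b.source γ = b.source α → b.target γ = b.target β →
      b.deg γ = b.deg α + b.deg β → γ :: l ∈ t') :
    b.cons (b.basis α * b.basis β) (Finsupp.single l 1) ∈ Finsupp.supported k k t' :=
  cons_mem_supported (t := {l}) (fun γ hγ _ hl => hl ▸ h γ hγ.1 hγ.2.1 hγ.2.2)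
    (basis_mul_mem_span α β) (Finsupp.single_mem_supported k 1 rfl)

theorem single_mem_weightSpan (l : List E) : Finsupp.single l 1 ∈ b.weightSpan (b.weight l) :=
  Finsupp.single_mem_supported k 1 rfl

theorem mulHead_basis_single_mem_weightSpan (α : E) (l : List E) :
    b.mulHead (b.basis α) (Finsupp.single l 1) ∈ b.weightSpan (b.deg α + b.weight l) := by
  cases l with
  | nil => exact (mulHead_nil (b := b) (b.basis α)).symm ▸ zero_mem _
  | cons β l =>
    rw [← cons_basis (b := b), mulHead_cons]
    refine cons_basis_mul_mem_supported fun γ _ _ hγ => ?_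
    change b.weight _ = _
    rw [weight_cons, weight_cons, hγ, Nat.cast_add, add_assoc]

theorem mulHead_mem_weightSpan {a : ℕ} {x : R} (hx : x ∈ b.grading a) {j : ℤ}
    {v : List E →₀ k} (hv : v ∈ b.weightSpan j) : b.mulHead x v ∈ b.weightSpan (a + j) := by
  suffices hle : b.grading a ≤ (b.weightSpan (a + j)).comap (b.mulHead.flip v) from hle hx
  refine Submodule.span_le.2 ?_
  rintro _ ⟨α, rfl, rfl⟩
  suffices hle : b.weightSpan j ≤
      (b.weightSpan (b.deg α + j)).comap (b.mulHead (b.basis α)) from hle hv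
  refine supported_le fun l hl => ?_
  obtain rfl : b.weight l = j := hl
  exact mulHead_basis_single_mem_weightSpan α l

theorem mergeList_mem_weightSpan (l : List E) : b.mergeList l ∈ b.weightSpan (b.weight l) := by
  induction l with
  | nil => exact zero_mem _
  | cons α l ih =>
    rw [mergeList, weight_cons]
    refine sub_mem (mulHead_basis_single_mem_weightSpan α l)
      (cons_basis_mem_supported (fun m hm => ?_) ih)
    exact (weight_cons (b := b) α m).trans (congrArg _ hm)

theorem mergeList_mem_pathSpan {n : ℕ} {X Y : V} {l : List E} (hl : b.IsPath Y X l)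
    (hn : l.length = n + 1) : b.mergeList l ∈ b.pathSpan X Y n := by
  induction l generalizing X n with
  | nil => exact zero_mem _
  | cons α l ih =>
    obtain ⟨rfl, hα, hl⟩ := hl
    cases l with
    | nil =>
      rw [mergeList, mulHead_nil, mergeList, map_zero, sub_zero]
      exact zero_mem _
    | cons β l =>
      obtain rfl : l.length + 1 = n := Nat.succ_injective hn
      rw [mergeList, ← cons_basis (b := b), mulHead_cons]
      refine sub_mem (cons_basis_mul_mem_supported fun γ hs ht hd => ?_)
        (cons_basis_mem_supported (fun m hm => ?_) (ih hl rfl))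
      · exact ⟨⟨hs, hd ▸ Nat.add_pos_left hα _, ht ▸ hl.2.2⟩, rfl⟩
      · exact ⟨⟨rfl, hα, hm.1⟩, congrArg (· + 1) hm.2⟩

end PeirceBasis

namespace PeirceBasis

variable {k : Type*} [Field k] {R : Type*} [Ring R] [Algebra k R] {V E : Type*}
  (b : PeirceBasis k R V E)

/-- The list `L` stands for an element of the normalized bar resolution: its first entry is an
arbitrary basis element, the coefficient, and it is followed by a path of length `i` to `Y`. -/
def IsBarList (Y : V) (i : ℕ) : List E → Prop
  | [] => False
  | α :: l => b.IsPath Y (b.target α) l ∧ l.length = i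

/-- The `i`-th term of the normalized bar resolution of the simple module at `Y`, relative to the
span of the idempotents. -/
def Bar (Y : V) (i : ℕ) : Type _ :=
  ↥(Finsupp.supported k k {L | b.IsBarList Y i L})

variable {b} {X Y : V} {i : ℕ}

noncomputable instance : AddCommGroup (b.Bar Y i) :=
  inferInstanceAs (AddCommGroup ↥(Finsupp.supported k k {L | b.IsBarList Y i L}))

noncomputable instance : Module k (b.Bar Y i) :=
  inferInstanceAs (Module k ↥(Finsupp.supported k k {L | b.IsBarList Y i L}))

variable (b Y i) in
/-- The inclusion of a term of the bar resolution in the space spanned by all lists. -/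
noncomputable def barSubtype : b.Bar Y i →ₗ[k] (List E →₀ k) :=
  (Finsupp.supported k k {L | b.IsBarList Y i L}).subtype

theorem barSubtype_injective : Function.Injective (b.barSubtype Y i) :=
  Subtype.val_injective

/-- The element of the bar resolution with coefficient `α` given by the path `l`. -/
noncomputable def barVec (α : E) (l : List E) (hl : b.IsPath Y (b.target α) l)
    (hi : l.length = i) : b.Bar Y i :=
  ⟨Finsupp.single (α :: l) 1, Finsupp.single_mem_supported k 1 ⟨hl, hi⟩⟩

theorem bar_induction {S : Submodule k (b.Bar Y i)}
    (h : ∀ α l hl hi, barVec α l hl hi ∈ S) (v : b.Bar Y i) : v ∈ S := by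
  suffices hle : Finsupp.supported k k {L | b.IsBarList Y i L} ≤ S.map (b.barSubtype Y i) by
    obtain ⟨w, hw, hwv⟩ := hle v.2
    exact barSubtype_injective hwv ▸ hw
  refine supported_le fun L hL => ?_
  cases L with
  | nil => exact hL.elim
  | cons α l => exact ⟨_, h α l hL.1 hL.2, rfl⟩

theorem bar_linearMap_ext {W : Type*} [AddCommGroup W] [Module k W] {f g : b.Bar Y i →ₗ[k] W}
    (h : ∀ α l hl hi, f (barVec α l hl hi) = g (barVec α l hl hi)) : f = g :=
  LinearMap.ext (bar_induction (S := LinearMap.eqLocus f g) h)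

theorem mulHead_barSubtype_mem (x : R) (v : b.Bar Y i) :
    b.mulHead x (b.barSubtype Y i v) ∈ Finsupp.supported k k {L | b.IsBarList Y i L} := by
  refine bar_induction (S := (Finsupp.supported k k {L | b.IsBarList Y i L}).comap
    (b.mulHead x ∘ₗ b.barSubtype Y i))
    (fun β l hl hi => ?_) v
  suffices hle : (⊤ : Submodule k R) ≤ Submodule.comap (b.mulHead.flip
      (Finsupp.single (β :: l) 1)) (Finsupp.supported k k {L | b.IsBarList Y i L}) from
    hle (Submodule.mem_top (x := x))
  rw [← b.basis.span_eq, Submodule.span_le]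
  rintro _ ⟨α, rfl⟩
  change b.mulHead (b.basis α) (Finsupp.single (β :: l) 1) ∈
    Finsupp.supported k k {L | b.IsBarList Y i L}
  rw [← cons_basis (b := b), mulHead_cons]
  exact cons_basis_mul_mem_supported fun γ _ ht _ => ⟨ht ▸ hl, hi⟩

noncomputable instance : Module R (b.Bar Y i) where
  smul x v := ⟨b.mulHead x (b.barSubtype Y i v), mulHead_barSubtype_mem x v⟩
  one_smul v := by
    refine barSubtype_injective ?_
    change b.mulHead 1 (b.barSubtype Y i v) = b.barSubtype Y i v
    suffices hcomp : b.mulHead 1 ∘ₗ b.barSubtype Y i = b.barSubtype Y i from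
      LinearMap.congr_fun hcomp v
    refine bar_linearMap_ext fun α l hl hi => ?_
    change b.mulHead 1 (Finsupp.single (α :: l) 1) = Finsupp.single (α :: l) 1
    rw [← cons_basis (b := b), mulHead_cons, one_mul]
  mul_smul x y v := Subtype.ext (mulHead_mulHead x y _).symm
  smul_zero x := Subtype.ext (map_zero (b.mulHead x))
  smul_add x v w := Subtype.ext (map_add (b.mulHead x) v.1 w.1)
  add_smul x y v := Subtype.ext (LinearMap.map_add₂ b.mulHead x y v.1)
  zero_smul v := Subtype.ext (LinearMap.map_zero₂ b.mulHead v.1)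

theorem barSubtype_smul (x : R) (v : b.Bar Y i) :
    b.barSubtype Y i (x • v) = b.mulHead x (b.barSubtype Y i v) := rfl

instance : IsScalarTower k R (b.Bar Y i) where
  smul_assoc c x v := Subtype.ext (LinearMap.map_smul₂ b.mulHead c x v.1)

theorem basis_smul_barVec_idem (α : E) (l : List E) (hl : b.IsPath Y (b.target α) l)
    (hi : l.length = i) (h : b.IsPath Y (b.target (b.idem (b.target α))) l) :
    b.basis α • barVec (b.idem (b.target α)) l h hi = barVec α l hl hi := by
  refine barSubtype_injective ?_
  change b.mulHead (b.basis α) (Finsupp.single (b.idem (b.target α) :: l) 1) =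
    Finsupp.single (α :: l) 1
  rw [← cons_basis (b := b), mulHead_cons, b.mul_idem, cons_basis]

variable (b Y i) in
/-- The degrees in the bar resolution. -/
noncomputable def barDegree (j : ℤ) : Submodule k (b.Bar Y i) :=
  (b.weightSpan j).comap (b.barSubtype Y i)

theorem isInternal_barDegree : DirectSum.IsInternal (b.barDegree Y i) := by
  classical
  have hstable : ∀ j, ∀ v ∈ Finsupp.supported k k {L | b.IsBarList Y i L},
      labelProj b.weight j v ∈ Finsupp.supported k k {L | b.IsBarList Y i L} :=
    fun j _ hv => labelProj_mem_supported hv j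
  refine (DirectSum.isInternal_submodule_iff_iSupIndep_and_iSup_eq_top _).2 ⟨?_, ?_⟩
  · exact iSupIndep_of_separating
      (fun j => ((labelProj b.weight j).restrict (hstable j) : b.Bar Y i →ₗ[k] b.Bar Y i))
      (fun j v hv => barSubtype_injective (labelProj_of_mem hv))
      (fun j j' hj v hv => barSubtype_injective (labelProj_of_mem_of_ne hj hv))
  · refine eq_top_iff.2 fun v _ => bar_induction (fun α l hl hi => ?_) v
    exact Submodule.mem_iSup_of_mem _ (single_mem_weightSpan (b := b) (α :: l))

theorem isGradedModule_bar : IsGradedModule k b.grading (b.barDegree Y i) where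
  isInternal := isInternal_barDegree
  smul_mem hx hv := mulHead_mem_weightSpan hx hv

variable (b) in
/-- Moving the first entry `α` of a list to the coefficients, and putting the idempotent fixing `α`
on the right in its place. It splits the surjection from a free module onto `b.Bar Y i`. -/
noncomputable def unhead : (List E →₀ k) →ₗ[k] (List E →₀ R) :=
  Finsupp.linearCombination k fun L =>
    match L with
    | [] => 0
    | α :: l => Finsupp.single (b.idem (b.target α) :: l) (b.basis α)

theorem unhead_single_cons (α : E) (l : List E) :
    b.unhead (Finsupp.single (α :: l) 1) =
      Finsupp.single (b.idem (b.target α) :: l) (b.basis α) := by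
  simp only [unhead, Finsupp.linearCombination_single, one_smul]

theorem unhead_cons {x : R} {Z : V} (hx : x ∈ Submodule.span k (b.basis '' {γ | b.target γ = Z}))
    (l : List E) :
    b.unhead (b.cons x (Finsupp.single l 1)) = Finsupp.single (b.idem Z :: l) x := by
  induction hx using Submodule.span_induction with
  | mem x hx =>
    obtain ⟨α, rfl, rfl⟩ := hx
    rw [cons_basis, unhead_single_cons]
  | zero => rw [map_zero, LinearMap.zero_apply, map_zero, Finsupp.single_zero]
  | add x y _ _ hx hy => rw [map_add, LinearMap.add_apply, map_add, hx, hy, Finsupp.single_add]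
  | smul c x _ hx => rw [map_smul, LinearMap.smul_apply, map_smul, hx, Finsupp.smul_single]

theorem unhead_smul (x : R) (v : b.Bar Y i) :
    b.unhead (b.barSubtype Y i (x • v)) = x • b.unhead (b.barSubtype Y i v) := by
  suffices h : (b.mulHead.compl₂ (b.barSubtype Y i)).compr₂ b.unhead =
      (Algebra.lsmul k k (List E →₀ R)).toLinearMap.compl₂ (b.unhead ∘ₗ b.barSubtype Y i) from
    LinearMap.congr_fun₂ h x v
  refine b.basis.ext fun α => bar_linearMap_ext fun β l hl hi => ?_
  change b.unhead (b.mulHead (b.basis α) (Finsupp.single (β :: l) 1)) =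
    b.basis α • b.unhead (Finsupp.single (β :: l) 1)
  rw [unhead_single_cons, ← cons_basis (b := b), mulHead_cons, unhead_cons (Z := b.target β),
    Finsupp.smul_single, smul_eq_mul]
  exact Submodule.span_mono (Set.image_mono fun γ hγ => hγ.2.1) (basis_mul_mem_span α β)

theorem projective_bar : Module.Projective R (b.Bar Y i) := by
  classical
  let p : (List E →₀ R) →ₗ[R] b.Bar Y i := Finsupp.linearCombination R fun L =>
    match L with
    | [] => 0
    | α :: l => if h : b.IsPath Y (b.target α) l ∧ l.length = i then barVec α l h.1 h.2 else 0
  refine Module.Projective.of_split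
    { toFun := fun v => b.unhead (b.barSubtype Y i v)
      map_add' := fun v w => by rw [map_add, map_add]
      map_smul' := unhead_smul } p (LinearMap.ext fun v => ?_)
  suffices h : (p.restrictScalars k) ∘ₗ b.unhead ∘ₗ b.barSubtype Y i = LinearMap.id from
    LinearMap.congr_fun h v
  refine bar_linearMap_ext fun α l hl hi => ?_
  change p (b.unhead (Finsupp.single (α :: l) 1)) = barVec α l hl hi
  have h : b.IsPath Y (b.target (b.idem (b.target α))) l := by rwa [b.target_idem]
  rw [unhead_single_cons, Finsupp.linearCombination_single]
  refine (congrArg (b.basis α • ·) (dif_pos ⟨h, hi⟩)).trans ?_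
  exact basis_smul_barVec_idem α l hl hi h

end PeirceBasis

namespace PeirceBasis

variable {k : Type*} [Field k] {R : Type*} [Ring R] [Algebra k R] {V E : Type*}
  (b : PeirceBasis k R V E)

/-- The character of the simple module at `X`: the coefficient of the idempotent `e_X`. -/
noncomputable def character (X : V) : R →ₗ[k] k :=
  b.basis.coord (b.idem X)

/-- The application of the character at `X` to the first entry of a list. -/
noncomputable def strip (X : V) : (List E →₀ k) →ₗ[k] (List E →₀ k) :=
  Finsupp.lcomapDomain (List.cons (b.idem X)) List.cons_injective

/-- The first entry of the list has positive degree and source `X`. -/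
def HasProperHead (X : V) : List E → Prop
  | [] => False
  | α :: _ => b.source α = X ∧ 0 < b.deg α

/-- The contracting homotopy of the bar resolution. -/
noncomputable def contract : (List E →₀ k) →ₗ[k] (List E →₀ k) :=
  Finsupp.linearCombination k fun L =>
    match L with
    | [] => 0
    | α :: l => if b.deg α = 0 then 0 else Finsupp.single (b.idem (b.source α) :: α :: l) 1

variable {b} {X Y : V} {i : ℕ}

theorem source_eq_target {α : E} (h : b.deg α = 0) : b.source α = b.target α := by
  conv_rhs => rw [(b.deg_eq_zero_iff α).1 h, b.target_idem]

theorem character_idem (X : V) : b.character X (b.basis (b.idem X)) = 1 := by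
  rw [character, Module.Basis.coord_apply, Module.Basis.repr_self, Finsupp.single_eq_same]

theorem character_basis {α : E} (h : α ≠ b.idem X) : b.character X (b.basis α) = 0 := by
  rw [character, Module.Basis.coord_apply, Module.Basis.repr_self, Finsupp.single_eq_of_ne' h]

theorem character_basis_of_pos {α : E} (h : 0 < b.deg α) : b.character X (b.basis α) = 0 :=
  character_basis fun hα => h.ne' (hα ▸ deg_idem X)

theorem character_mul (X : V) (x y : R) :
    b.character X (x * y) = b.character X x * b.character X y := by
  suffices h : ∀ α β, b.character X (b.basis α * b.basis β) =
      b.character X (b.basis α) * b.character X (b.basis β) by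
    suffices hcomp : (LinearMap.mul k R).compr₂ (b.character X) =
        (LinearMap.mul k k).compl₁₂ (b.character X) (b.character X) from
      LinearMap.congr_fun₂ hcomp x y
    exact b.basis.ext fun α => b.basis.ext fun β => h α β
  intro α β
  by_cases hne : b.character X (b.basis α * b.basis β) = 0
  · rw [hne, eq_comm, mul_eq_zero]
    by_contra! hαβ
    obtain rfl : α = b.idem X := by_contra fun h => hαβ.1 (character_basis h)
    obtain rfl : β = b.idem X := by_contra fun h => hαβ.2 (character_basis h)
    have hmul := b.idem_mul (b.idem X)
    rw [b.source_idem] at hmul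
    rw [hmul, character_idem] at hne
    exact one_ne_zero hne
  · obtain ⟨hs, ht, hd⟩ := b.mul_support α β (b.idem X) hne
    rw [deg_idem, eq_comm, Nat.add_eq_zero_iff] at hd
    rw [b.source_idem] at hs
    rw [b.target_idem] at ht
    obtain rfl : α = b.idem X := hs ▸ (b.deg_eq_zero_iff α).1 hd.1
    obtain rfl : β = b.idem X := by
      rw [ht, ← source_eq_target hd.2]
      exact (b.deg_eq_zero_iff β).1 hd.2
    have hmul := b.idem_mul (b.idem X)
    rw [b.source_idem] at hmul
    rw [hmul, character_idem, one_mul]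

theorem strip_cons (x : R) (v : List E →₀ k) :
    b.strip X (b.cons x v) = b.character X x • v := by
  suffices hcomp : b.cons.compr₂ (b.strip X) = (LinearMap.lsmul k _).comp (b.character X) from
    LinearMap.congr_fun₂ hcomp x v
  refine b.basis.ext fun α => Finsupp.lhom_ext' fun l => LinearMap.ext_ring ?_
  change b.strip X (b.cons (b.basis α) (Finsupp.single l 1)) =
    b.character X (b.basis α) • Finsupp.single l 1
  rw [cons_basis]
  by_cases h : α = b.idem X
  · rw [h, character_idem, one_smul]
    exact Finsupp.comapDomain_single _ _ _ _
  · rw [character_basis h, zero_smul]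
    ext m
    exact Finsupp.single_eq_of_ne fun hm => h (List.cons.inj hm).1.symm

theorem strip_mulHead (x : R) (v : List E →₀ k) :
    b.strip X (b.mulHead x v) = b.character X x • b.strip X v := by
  suffices hcomp : b.strip X ∘ₗ b.mulHead x = b.character X x • b.strip X from
    LinearMap.congr_fun hcomp v
  refine Finsupp.lhom_ext' fun l => LinearMap.ext_ring ?_
  change b.strip X (b.mulHead x (Finsupp.single l 1)) =
    b.character X x • b.strip X (Finsupp.single l 1)
  cases l with
  | nil =>
    have hnil : b.strip X (Finsupp.single [] 1) = 0 := by
      ext m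
      exact Finsupp.single_eq_of_ne (List.cons_ne_nil _ _)
    rw [mulHead_nil, hnil, map_zero, smul_zero]
  | cons α l =>
    rw [← cons_basis (b := b), mulHead_cons, strip_cons, strip_cons, character_mul, mul_smul]

theorem contract_cons_idem (X : V) (v : List E →₀ k) :
    b.contract (b.cons (b.basis (b.idem X)) v) = 0 := by
  suffices hcomp : b.contract ∘ₗ b.cons (b.basis (b.idem X)) = 0 from
    LinearMap.congr_fun hcomp v
  refine Finsupp.lhom_ext' fun l => LinearMap.ext_ring ?_
  change b.contract (b.cons (b.basis (b.idem X)) (Finsupp.single l 1)) = 0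
  rw [cons_basis, contract, Finsupp.linearCombination_single, one_smul]
  exact if_pos (deg_idem X)

theorem contract_of_mem {v : List E →₀ k}
    (hv : v ∈ Finsupp.supported k k {L | b.HasProperHead X L}) :
    b.contract v = b.cons (b.basis (b.idem X)) v := by
  suffices hle : Finsupp.supported k k {L | b.HasProperHead X L} ≤
      LinearMap.eqLocus b.contract (b.cons (b.basis (b.idem X))) from hle hv
  refine supported_le fun L hL => ?_
  cases L with
  | nil => exact hL.elim
  | cons α l =>
    obtain ⟨rfl, hα⟩ := hL
    rw [LinearMap.mem_eqLocus, cons_basis, contract, Finsupp.linearCombination_single, one_smul]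
    exact if_neg hα.ne'

theorem contract_single {α : E} (hα : 0 < b.deg α) (l : List E) :
    b.contract (Finsupp.single (α :: l) 1) =
      b.cons (b.basis (b.idem (b.source α))) (Finsupp.single (α :: l) 1) := by
  refine contract_of_mem (Finsupp.single_mem_supported k 1 ?_)
  exact ⟨rfl, hα⟩

theorem mergeList_cons_mem {α : E} (hα : 0 < b.deg α) (l : List E) :
    b.mergeList (α :: l) ∈ Finsupp.supported k k {L | b.HasProperHead (b.source α) L} := by
  have hcons : ∀ l ∈ Set.univ, b.HasProperHead (b.source α) (α :: l) := fun _ _ => ⟨rfl, hα⟩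
  refine sub_mem ?_ (cons_basis_mem_supported hcons
    ((Finsupp.mem_supported k _).2 (Set.subset_univ _)))
  cases l with
  | nil => exact (mulHead_nil (b := b) (b.basis α)).symm ▸ zero_mem _
  | cons β l =>
    rw [← cons_basis (b := b), mulHead_cons]
    exact cons_basis_mul_mem_supported fun γ hs _ hd => ⟨hs, hd ▸ Nat.add_pos_left hα _⟩

theorem homotopy_of_pos {α : E} (hα : 0 < b.deg α) (l : List E) :
    b.merge (b.contract (Finsupp.single (α :: l) 1)) +
      b.contract (b.merge (Finsupp.single (α :: l) 1)) = Finsupp.single (α :: l) 1 := by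
  rw [contract_single hα, merge_cons, merge_single, contract_of_mem (mergeList_cons_mem hα l),
    sub_add_cancel, ← cons_basis (b := b), mulHead_cons, b.idem_mul]

theorem homotopy_of_eq_zero {α β : E} (hα : b.deg α = 0) (hs : b.source β = b.target α)
    (hβ : 0 < b.deg β) (l : List E) :
    b.merge (b.contract (Finsupp.single (α :: β :: l) 1)) +
      b.contract (b.merge (Finsupp.single (α :: β :: l) 1)) =
    Finsupp.single (α :: β :: l) 1 := by
  obtain ⟨X, rfl⟩ : ∃ X, α = b.idem X := ⟨_, (b.deg_eq_zero_iff α).1 hα⟩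
  obtain rfl : b.source β = X := hs.trans (b.target_idem X)
  rw [← cons_basis (b := b) (b.idem _), contract_cons_idem, map_zero, zero_add, merge_cons,
    map_sub, contract_cons_idem, sub_zero, ← cons_basis (b := b) β, mulHead_cons, b.idem_mul,
    cons_basis, contract_single hβ]

theorem merge_contract_add_contract_merge (v : b.Bar Y (i + 1)) :
    b.merge (b.contract (b.barSubtype Y (i + 1) v)) +
      b.contract (b.merge (b.barSubtype Y (i + 1) v)) = b.barSubtype Y (i + 1) v := by
  suffices hcomp : (b.merge ∘ₗ b.contract + b.contract ∘ₗ b.merge) ∘ₗ b.barSubtype Y (i + 1) =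
      b.barSubtype Y (i + 1) from LinearMap.congr_fun hcomp v
  refine bar_linearMap_ext fun α l hl hi => ?_
  obtain hα | hα := Nat.eq_zero_or_pos (b.deg α)
  · cases l with
    | nil => exact (Nat.succ_ne_zero i hi.symm).elim
    | cons β l => exact homotopy_of_eq_zero hα hl.1 hl.2.1 l
  · exact homotopy_of_pos hα l

theorem merge_contract_add_smul (v : b.Bar Y 0) :
    b.merge (b.contract (b.barSubtype Y 0 v)) +
      (b.strip Y (b.barSubtype Y 0 v) []) • Finsupp.single [b.idem Y] 1 =
    b.barSubtype Y 0 v := by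
  suffices hcomp : (b.merge ∘ₗ b.contract + LinearMap.toSpanSingleton k _
      (Finsupp.single [b.idem Y] 1) ∘ₗ Finsupp.lapply [] ∘ₗ b.strip Y) ∘ₗ b.barSubtype Y 0 =
      b.barSubtype Y 0 from LinearMap.congr_fun hcomp v
  refine bar_linearMap_ext fun α l hl hi => ?_
  obtain rfl := List.length_eq_zero_iff.1 hi
  change b.merge (b.contract (Finsupp.single [α] 1)) +
    (b.strip Y (Finsupp.single [α] 1) []) • Finsupp.single [b.idem Y] 1 = Finsupp.single [α] 1
  obtain rfl : b.target α = Y := hl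
  obtain hα | hα := Nat.eq_zero_or_pos (b.deg α)
  · have hidem : α = b.idem (b.target α) := by
      rw [← source_eq_target hα]
      exact (b.deg_eq_zero_iff α).1 hα
    rw [← hidem, ← cons_basis (b := b), strip_cons, hidem, contract_cons_idem, b.target_idem,
      character_idem, map_zero, zero_add, one_smul, Finsupp.single_eq_same, one_smul]
  · have hmerge := homotopy_of_pos (b := b) hα []
    rw [merge_single, mergeList, mulHead_nil, mergeList, map_zero, sub_zero, map_zero,
      add_zero] at hmerge
    rw [hmerge, ← cons_basis (b := b), strip_cons, character_basis_of_pos hα, zero_smul,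
      Finsupp.zero_apply, zero_smul, add_zero]

end PeirceBasis

namespace PeirceBasis

section BarResolution

variable {k : Type*} [Field k] {R : Type*} [Ring R] [Algebra k R] {V E : Type*}
  {b : PeirceBasis k R V E} {X Y : V} {i : ℕ}

theorem merge_mem_weightSpan {j : ℤ} {v : List E →₀ k} (hv : v ∈ b.weightSpan j) :
    b.merge v ∈ b.weightSpan j := by
  suffices hle : b.weightSpan j ≤ (b.weightSpan j).comap b.merge from hle hv
  refine supported_le fun l hl => ?_
  obtain rfl : b.weight l = j := hl
  rw [Submodule.mem_comap, merge_single]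
  exact mergeList_mem_weightSpan l

theorem merge_barSubtype_mem (v : b.Bar Y (i + 1)) : b.merge (b.barSubtype Y (i + 1) v) ∈
    Finsupp.supported k k {L | b.IsBarList Y i L} := by
  refine bar_induction (S := (Finsupp.supported k k {L | b.IsBarList Y i L}).comap
    (b.merge ∘ₗ b.barSubtype Y (i + 1))) (fun α l hl hi => ?_) v
  change b.merge (Finsupp.single (α :: l) 1) ∈ Finsupp.supported k k {L | b.IsBarList Y i L}
  rw [merge_single, mergeList]
  refine sub_mem ?_
    (cons_basis_mem_supported (fun m hm => ?_) (mergeList_mem_pathSpan hl hi))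
  · cases l with
    | nil => exact (Nat.succ_ne_zero i hi.symm).elim
    | cons β l =>
      rw [← cons_basis (b := b), mulHead_cons]
      refine cons_basis_mul_mem_supported fun γ _ ht _ => ?_
      exact ⟨ht ▸ hl.2.2, Nat.succ_injective hi⟩
  · exact hm

theorem contract_barSubtype_mem (v : b.Bar Y i) : b.contract (b.barSubtype Y i v) ∈
    Finsupp.supported k k {L | b.IsBarList Y (i + 1) L} := by
  refine bar_induction (S := (Finsupp.supported k k {L | b.IsBarList Y (i + 1) L}).comap
    (b.contract ∘ₗ b.barSubtype Y i)) (fun α l hl hi => ?_) v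
  change b.contract (Finsupp.single (α :: l) 1) ∈
    Finsupp.supported k k {L | b.IsBarList Y (i + 1) L}
  rw [contract, Finsupp.linearCombination_single, one_smul]
  change (if b.deg α = 0 then 0 else Finsupp.single (b.idem (b.source α) :: α :: l) 1) ∈ _
  split_ifs with hα
  · exact zero_mem _
  · refine Finsupp.single_mem_supported k 1 ?_
    exact ⟨⟨(b.target_idem _).symm, Nat.pos_of_ne_zero hα, hl⟩, congrArg (· + 1) hi⟩

variable (b Y i) in
/-- The differential of the bar resolution. -/
noncomputable def barD : b.Bar Y (i + 1) →ₗ[R] b.Bar Y i where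
  toFun v := ⟨b.merge (b.barSubtype Y (i + 1) v), merge_barSubtype_mem v⟩
  map_add' v w := barSubtype_injective ((congrArg b.merge (map_add _ v w)).trans (map_add _ _ _))
  map_smul' x v := barSubtype_injective (merge_mulHead x (b.barSubtype Y (i + 1) v))

theorem barSubtype_barD (v : b.Bar Y (i + 1)) :
    b.barSubtype Y i (b.barD Y i v) = b.merge (b.barSubtype Y (i + 1) v) := rfl

theorem exact_barD : Function.Exact (b.barD Y (i + 1)) (b.barD Y i) := by
  intro v
  constructor
  · intro hv
    refine ⟨⟨_, contract_barSubtype_mem v⟩, barSubtype_injective ?_⟩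
    have hmerge : b.merge (b.barSubtype Y (i + 1) v) = 0 := congrArg (b.barSubtype Y i) hv
    have h := merge_contract_add_contract_merge v
    rw [hmerge, map_zero, add_zero] at h
    exact h
  · rintro ⟨w, rfl⟩
    exact barSubtype_injective (merge_merge _)

theorem merge_eq_zero {v : List E →₀ k} (hv : v ∈ b.pathSpan X Y i) (hi : i ≤ 1) :
    b.merge v = 0 := by
  suffices hle : b.pathSpan X Y i ≤ LinearMap.ker b.merge from hle hv
  refine supported_le fun l hl => ?_
  rw [LinearMap.mem_ker, merge_single]
  match l, hl.2.trans_le hi with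
  | [], _ => rfl
  | [α], _ => rw [mergeList, mulHead_nil, mergeList, map_zero, sub_zero]

theorem strip_barVec_idem (X : V) (l : List E) (hl : b.IsPath Y (b.target (b.idem X)) l)
    (hi : l.length = i) :
    b.strip X (b.barSubtype Y i (barVec (b.idem X) l hl hi)) = Finsupp.single l 1 := by
  change b.strip X (Finsupp.single (b.idem X :: l) 1) = Finsupp.single l 1
  rw [← cons_basis (b := b), strip_cons, character_idem, one_smul]

theorem strip_mem_pathSpan (v : b.Bar Y i) :
    b.strip X (b.barSubtype Y i v) ∈ b.pathSpan X Y i := by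
  refine bar_induction (S := (b.pathSpan X Y i).comap (b.strip X ∘ₗ b.barSubtype Y i))
    (fun α l hl hi => ?_) v
  by_cases h : α = b.idem X
  · subst h
    rw [Submodule.mem_comap, LinearMap.comp_apply, strip_barVec_idem]
    refine Finsupp.single_mem_supported k 1 ?_
    exact ⟨by rwa [b.target_idem] at hl, hi⟩
  · change b.strip X (Finsupp.single (α :: l) 1) ∈ b.pathSpan X Y i
    rw [← cons_basis (b := b), strip_cons, character_basis h, zero_smul]
    exact zero_mem _

theorem strip_merge (v : b.Bar Y (i + 1)) :
    b.strip X (b.merge (b.barSubtype Y (i + 1) v)) =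
      -b.merge (b.strip X (b.barSubtype Y (i + 1) v)) := by
  suffices hcomp : b.strip X ∘ₗ b.merge ∘ₗ b.barSubtype Y (i + 1) =
      -(b.merge ∘ₗ b.strip X ∘ₗ b.barSubtype Y (i + 1)) from LinearMap.congr_fun hcomp v
  refine bar_linearMap_ext fun α l hl hi => ?_
  change b.strip X (b.merge (Finsupp.single (α :: l) 1)) =
    -b.merge (b.strip X (Finsupp.single (α :: l) 1))
  cases l with
  | nil => exact (Nat.succ_ne_zero i hi.symm).elim
  | cons β l =>
    -- The first entry `β` of a path has positive degree, so characters vanish on it.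
    rw [← cons_basis (b := b) α, strip_cons, merge_cons, map_sub, strip_mulHead, strip_cons,
      ← cons_basis (b := b) β, strip_cons, character_basis_of_pos hl.2.1, zero_smul, smul_zero,
      zero_sub, map_smul]

variable {N : Type*} [AddCommGroup N] [Module k N] [Module R N]

/-- The augmentation of the bar resolution of a simple module `N` at `Y`. -/
noncomputable def barAug (η : k ≃ₗ[k] N)
    (hN : ∀ (x : R) (n : N), x • n = b.character Y x • n) : b.Bar Y 0 →ₗ[R] N where
  toFun v := η (b.strip Y (b.barSubtype Y 0 v) [])
  map_add' v w := by rw [map_add, map_add, Finsupp.add_apply, map_add]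
  map_smul' x v := by
    rw [barSubtype_smul, strip_mulHead, Finsupp.smul_apply, map_smul, RingHom.id_apply, hN]

variable {η : k ≃ₗ[k] N} {hN : ∀ (x : R) (n : N), x • n = b.character Y x • n}

theorem barAug_eq_zero_iff {v : b.Bar Y 0} :
    barAug η hN v = 0 ↔ b.strip Y (b.barSubtype Y 0 v) [] = 0 :=
  η.map_eq_zero_iff

theorem barAug_surjective : Function.Surjective (barAug η hN) := by
  intro n
  have hnil : b.IsPath Y (b.target (b.idem Y)) [] := b.target_idem Y
  have hstrip := strip_barVec_idem Y [] hnil List.length_nil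
  refine ⟨η.symm n • barVec (b.idem Y) [] hnil List.length_nil, ?_⟩
  refine (congrArg (fun v => η (b.strip Y v [])) (map_smul (b.barSubtype Y 0) _ _)).trans ?_
  rw [map_smul, hstrip, Finsupp.smul_apply, Finsupp.single_eq_same, smul_eq_mul, mul_one,
    η.apply_symm_apply]

theorem exact_barAug : Function.Exact (b.barD Y 0) (barAug η hN) := by
  intro v
  rw [barAug_eq_zero_iff]
  constructor
  · intro hv
    refine ⟨⟨_, contract_barSubtype_mem v⟩, barSubtype_injective ?_⟩
    have h := merge_contract_add_smul v
    rw [hv, zero_smul, add_zero] at h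
    exact h
  · rintro ⟨w, rfl⟩
    rw [barSubtype_barD, strip_merge, merge_eq_zero (strip_mem_pathSpan w) le_rfl, neg_zero,
      Finsupp.zero_apply]

theorem barAug_mem {degN : ℤ → Submodule k N} (hdeg : degN 0 = ⊤) (j : ℤ) (v : b.Bar Y 0)
    (hv : v ∈ b.barDegree Y 0 j) : barAug η hN v ∈ degN j := by
  obtain rfl | hj := eq_or_ne j 0
  · exact hdeg ▸ Submodule.mem_top
  · suffices h0 : barAug η hN v = 0 from h0 ▸ zero_mem _
    rw [barAug_eq_zero_iff]
    by_contra h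
    have hweight : b.weight [b.idem Y] = j := hv (Finsupp.mem_support_iff.2 h)
    rw [weight_cons, deg_idem] at hweight
    exact hj hweight.symm

/-- The normalized bar resolution of a simple module at `Y`, concentrated in degree `0`. -/
noncomputable def barResolution (η : k ≃ₗ[k] N)
    (hN : ∀ (x : R) (n : N), x • n = b.character Y x • n) {degN : ℤ → Submodule k N}
    (hdeg : degN 0 = ⊤) : GradedProjectiveResolution k b.grading N degN where
  X := b.Bar Y
  deg := b.barDegree Y
  isGraded _ := isGradedModule_bar
  projective _ := projective_bar
  d := b.barD Y
  d_mem _ _ _ hv := merge_mem_weightSpan hv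
  aug := barAug η hN
  aug_mem := barAug_mem hdeg
  aug_surjective := barAug_surjective
  exact_zero := exact_barAug
  exact_succ _ := exact_barD

end BarResolution

end PeirceBasis

namespace PeirceBasis

section TorOfSimples

variable {k : Type*} [Field k] {R : Type*} [Ring R] [Algebra k R] {V E : Type*}
  {b : PeirceBasis k R V E} {X Y : V} {i : ℕ}
  {M : Type*} [AddCommGroup M] [Module k M] [Module Rᵐᵒᵖ M]
  (κ : M ≃ₗ[k] k) (hM : ∀ (x : R) (m : M), MulOpposite.op x • m = b.character X x • m)

variable (Y i) in
/-- The isomorphism of `M ⊗_R Bar Y i`, for a simple right module `M` at `X`, with the span of the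
paths of length `i` from `X` to `Y`, as a map to the space spanned by all lists. -/
noncomputable def tensorToPath : TensorOver k R M (b.Bar Y i) →ₗ[k] (List E →₀ k) :=
  (balanced k R M (b.Bar Y i)).liftQ
    (TensorProduct.lift ((LinearMap.lsmul k (List E →₀ k)).compl₁₂ κ.toLinearMap
      (b.strip X ∘ₗ b.barSubtype Y i))) <| by
    refine Submodule.span_le.2 ?_
    rintro _ ⟨m, x, v, rfl⟩
    refine LinearMap.sub_mem_ker_iff.2 ?_
    change κ (MulOpposite.op x • m) • b.strip X (b.barSubtype Y i v) =
      κ m • b.strip X (b.barSubtype Y i (x • v))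
    rw [hM, map_smul, barSubtype_smul, strip_mulHead, smul_comm, smul_assoc]

theorem tensorToPath_mk (m : M) (v : b.Bar Y i) :
    tensorToPath Y i κ hM ((balanced k R M (b.Bar Y i)).mkQ (m ⊗ₜ v)) =
      κ m • b.strip X (b.barSubtype Y i v) := rfl

open Classical in
variable (b X Y i) in
/-- The inverse of `tensorToPath` on the span of the paths of length `i` from `X` to `Y`. -/
noncomputable def pathToTensor : (List E →₀ k) →ₗ[k] TensorOver k R M (b.Bar Y i) :=
  Finsupp.linearCombination k fun l =>
    if h : b.IsPath Y (b.target (b.idem X)) l ∧ l.length = i then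
      (balanced k R M (b.Bar Y i)).mkQ (κ.symm 1 ⊗ₜ barVec (b.idem X) l h.1 h.2)
    else 0

theorem pathToTensor_single {l : List E} (hl : b.IsPath Y (b.target (b.idem X)) l)
    (hi : l.length = i) : pathToTensor b X Y i κ (Finsupp.single l 1) =
      (balanced k R M (b.Bar Y i)).mkQ (κ.symm 1 ⊗ₜ barVec (b.idem X) l hl hi) := by
  rw [pathToTensor, Finsupp.linearCombination_single, one_smul, dif_pos ⟨hl, hi⟩]

theorem tensorToPath_pathToTensor {v : List E →₀ k} (hv : v ∈ b.pathSpan X Y i) :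
    tensorToPath Y i κ hM (pathToTensor b X Y i κ v) = v := by
  suffices hle : b.pathSpan X Y i ≤ LinearMap.eqLocus
      (tensorToPath Y i κ hM ∘ₗ pathToTensor b X Y i κ) LinearMap.id from hle hv
  refine supported_le fun l hl => ?_
  have hpath : b.IsPath Y (b.target (b.idem X)) l := (b.target_idem X).symm ▸ hl.1
  rw [LinearMap.mem_eqLocus, LinearMap.comp_apply, pathToTensor_single κ hpath hl.2,
    tensorToPath_mk, strip_barVec_idem, κ.apply_symm_apply, one_smul, LinearMap.id_apply]

include hM in
theorem mkQ_tmul_barVec_eq_zero (m : M) {α : E} (h : α ≠ b.idem X) (l : List E)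
    (hl : b.IsPath Y (b.target α) l) (hi : l.length = i) :
    (balanced k R M (b.Bar Y i)).mkQ (m ⊗ₜ barVec α l hl hi) = 0 := by
  have hidem : b.IsPath Y (b.target (b.idem (b.target α))) l := by rwa [b.target_idem]
  rw [← basis_smul_barVec_idem α l hl hi hidem]
  have hbal : (balanced k R M (b.Bar Y i)).mkQ
      ((MulOpposite.op (b.basis α) • m) ⊗ₜ barVec (b.idem (b.target α)) l hidem hi) =
      (balanced k R M (b.Bar Y i)).mkQ
        (m ⊗ₜ (b.basis α • barVec (b.idem (b.target α)) l hidem hi)) :=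
    (Submodule.Quotient.eq _).2 (Submodule.subset_span ⟨m, b.basis α, _, rfl⟩)
  rw [← hbal, hM, character_basis h, zero_smul, TensorProduct.zero_tmul, map_zero]

theorem pathToTensor_tensorToPath (t : TensorOver k R M (b.Bar Y i)) :
    pathToTensor b X Y i κ (tensorToPath Y i κ hM t) = t := by
  suffices hcomp : pathToTensor b X Y i κ ∘ₗ tensorToPath Y i κ hM = LinearMap.id from
    LinearMap.congr_fun hcomp t
  refine tensorOver_ext k M fun m v => ?_
  suffices h : pathToTensor b X Y i κ ∘ₗ (κ m • (b.strip X ∘ₗ b.barSubtype Y i)) =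
      (balanced k R M (b.Bar Y i)).mkQ ∘ₗ TensorProduct.mk k M _ m from LinearMap.congr_fun h v
  refine bar_linearMap_ext fun α l hl hi => ?_
  change pathToTensor b X Y i κ (κ m • b.strip X (b.barSubtype Y i (barVec α l hl hi))) =
    (balanced k R M (b.Bar Y i)).mkQ (m ⊗ₜ barVec α l hl hi)
  by_cases h : α = b.idem X
  · subst h
    rw [strip_barVec_idem, map_smul, pathToTensor_single κ hl hi, ← map_smul,
      TensorProduct.smul_tmul', ← map_smul, smul_eq_mul, mul_one, κ.symm_apply_apply]
  · have hstrip : b.strip X (b.barSubtype Y i (barVec α l hl hi)) = 0 := by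
      change b.strip X (Finsupp.single (α :: l) 1) = 0
      rw [← cons_basis (b := b), strip_cons, character_basis h, zero_smul]
    rw [mkQ_tmul_barVec_eq_zero hM m h, hstrip, smul_zero, map_zero]

theorem tensorToPath_injective : Function.Injective (tensorToPath (b := b) Y i κ hM) :=
  Function.LeftInverse.injective (pathToTensor_tensorToPath κ hM)

theorem tensorToPath_mem_pathSpan (t : TensorOver k R M (b.Bar Y i)) :
    tensorToPath Y i κ hM t ∈ b.pathSpan X Y i := by
  obtain ⟨t, rfl⟩ := Submodule.mkQ_surjective _ t
  induction t using TensorProduct.induction_on with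
  | zero => rw [map_zero, map_zero]; exact zero_mem _
  | tmul m v => exact Submodule.smul_mem _ _ (strip_mem_pathSpan v)
  | add s t hs ht => rw [map_add, map_add]; exact add_mem hs ht

theorem tensorToPath_tensorMap (t : TensorOver k R M (b.Bar Y (i + 1))) :
    tensorToPath Y i κ hM (tensorMap k M (b.barD Y i) t) =
      -b.merge (tensorToPath Y (i + 1) κ hM t) := by
  suffices hcomp : tensorToPath Y i κ hM ∘ₗ tensorMap k M (b.barD Y i) =
      -(b.merge ∘ₗ tensorToPath Y (i + 1) κ hM) from LinearMap.congr_fun hcomp t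
  refine tensorOver_ext k M fun m v => ?_
  change κ m • b.strip X (b.merge (b.barSubtype Y (i + 1) v)) =
    -b.merge (κ m • b.strip X (b.barSubtype Y (i + 1) v))
  rw [strip_merge, smul_neg, map_smul]

variable {degM : ℤ → Submodule k M}

theorem strip_mem_weightSpan {c : ℤ} {v : List E →₀ k} (hv : v ∈ b.weightSpan c) :
    b.strip X v ∈ b.weightSpan c := by
  intro l hl
  have hne : b.strip X v l ≠ 0 := Finsupp.mem_support_iff.1 (Finset.mem_coe.1 hl)
  have hweight : b.weight (b.idem X :: l) = c := hv (Finsupp.mem_support_iff.2 hne)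
  rwa [weight_cons, deg_idem, Nat.cast_zero, zero_add] at hweight

theorem tensorToPath_mem_weightSpan (hdegM : ∀ j ≠ 0, degM j = ⊥) {j : ℤ}
    {t : TensorOver k R M (b.Bar Y i)} (ht : t ∈ tensorDegree k degM (b.barDegree Y i) j) :
    tensorToPath Y i κ hM t ∈ b.weightSpan j := by
  suffices hle : tensorDegree (R := R) k degM (b.barDegree Y i) j ≤
      (b.weightSpan j).comap (tensorToPath Y i κ hM) from hle ht
  refine Submodule.span_le.2 ?_
  rintro _ ⟨a, c, rfl, m, hm, v, hv, rfl⟩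
  obtain rfl | ha := eq_or_ne a 0
  · rw [zero_add]
    exact Submodule.smul_mem _ _ (strip_mem_weightSpan hv)
  · rw [hdegM a ha, Submodule.mem_bot] at hm
    rw [hm, TensorProduct.zero_tmul, map_zero]
    exact zero_mem _

theorem pathToTensor_mem_tensorDegree (hdegM₀ : degM 0 = ⊤) {j : ℤ} {v : List E →₀ k}
    (hv : v ∈ b.weightSpan j) :
    pathToTensor b X Y i κ v ∈ tensorDegree k degM (b.barDegree Y i) j := by
  suffices hle : b.weightSpan j ≤ (tensorDegree (R := R) k degM (b.barDegree Y i) j).comap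
      (pathToTensor b X Y i κ) from hle hv
  refine supported_le fun l hl => ?_
  obtain rfl : b.weight l = j := hl
  rw [Submodule.mem_comap]
  by_cases h : b.IsPath Y (b.target (b.idem X)) l ∧ l.length = i
  · rw [pathToTensor_single κ h.1 h.2]
    refine Submodule.subset_span ⟨0, b.weight l, zero_add _, _, hdegM₀ ▸ Submodule.mem_top, _, ?_,
      rfl⟩
    refine Finsupp.single_mem_supported k 1 ?_
    change b.weight (b.idem X :: l) = b.weight l
    rw [weight_cons, deg_idem, Nat.cast_zero, zero_add]
  · rw [pathToTensor, Finsupp.linearCombination_single, dif_neg h, smul_zero]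
    exact zero_mem _

variable {N : Type*} [AddCommGroup N] [Module k N] [Module R N]
  {η : k ≃ₗ[k] N} {hN : ∀ (x : R) (n : N), x • n = b.character Y x • n}
  {degN : ℤ → Submodule k N} {hdegN : degN 0 = ⊤}

theorem mem_cycles_barResolution {t : TensorOver k R M (b.Bar Y i)} :
    t ∈ (barResolution η hN hdegN).cycles M i ↔ b.merge (tensorToPath Y i κ hM t) = 0 := by
  cases i with
  | zero =>
    have hzero := merge_eq_zero (tensorToPath_mem_pathSpan κ hM t) zero_le_one
    exact ⟨fun _ => hzero, fun _ => trivial⟩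
  | succ i =>
    change tensorMap k M (b.barD Y i) t = 0 ↔ _
    rw [← (tensorToPath_injective κ hM).eq_iff, tensorToPath_tensorMap, map_zero, neg_eq_zero]

theorem mem_boundaries_barResolution {t : TensorOver k R M (b.Bar Y i)} :
    t ∈ (barResolution η hN hdegN).boundaries M i ↔
      tensorToPath Y i κ hM t ∈ (b.pathSpan X Y (i + 1)).map b.merge := by
  constructor
  · rintro ⟨s, rfl⟩
    refine ⟨-tensorToPath Y (i + 1) κ hM s, neg_mem (tensorToPath_mem_pathSpan κ hM s), ?_⟩
    rw [map_neg]
    exact (tensorToPath_tensorMap κ hM s).symm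
  · rintro ⟨v, hv, h⟩
    refine ⟨-pathToTensor b X Y (i + 1) κ v, tensorToPath_injective κ hM ?_⟩
    refine (tensorToPath_tensorMap κ hM _).trans ?_
    rw [map_neg, map_neg, neg_neg, tensorToPath_pathToTensor κ hM hv, h]

/-- The homology at the paths of length `i` of the reduced bar complex. -/
abbrev PathHomology (b : PeirceBasis k R V E) (X Y : V) (i : ℕ) : Type _ :=
  Subquotient (b.pathSpan X Y i ⊓ LinearMap.ker b.merge) ((b.pathSpan X Y (i + 1)).map b.merge)

/-- The component of total degree `j` of the homology of the reduced bar complex. -/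
noncomputable def pathHomologyDegree (b : PeirceBasis k R V E) (X Y : V) (i : ℕ) (j : ℤ) :
    Submodule k (b.PathHomology X Y i) :=
  subquotientPart _ _ (b.weightSpan j)

include κ hM in
theorem exists_barTorEquiv (hdegM₀ : degM 0 = ⊤) (hdegM : ∀ j ≠ 0, degM j = ⊥) (i : ℕ) :
    ∃ e : (barResolution η hN hdegN).Tor M i ≃ₗ[k] b.PathHomology X Y i,
      ∀ j, ((barResolution η hN hdegN).torDegree degM i j).map e.toLinearMap =
        b.pathHomologyDegree X Y i j := by
  have hsurj : ∀ v ∈ b.pathSpan X Y i ⊓ LinearMap.ker b.merge,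
      pathToTensor b X Y i κ v ∈ (barResolution η hN hdegN).cycles M i ∧
        tensorToPath Y i κ hM (pathToTensor b X Y i κ v) - v ∈
          (b.pathSpan X Y (i + 1)).map b.merge := by
    intro v hv
    have h := tensorToPath_pathToTensor κ hM hv.1
    exact ⟨(mem_cycles_barResolution κ hM).2 (h.symm ▸ hv.2), by
      rw [h, sub_self]; exact zero_mem _⟩
  exact ⟨subquotientEquiv (tensorToPath Y i κ hM)
      (fun t ht => ⟨tensorToPath_mem_pathSpan κ hM t, (mem_cycles_barResolution κ hM).1 ht⟩)
      (fun t _ => (mem_boundaries_barResolution κ hM).symm) fun v hv => ⟨_, hsurj v hv⟩,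
    fun j => map_subquotientPart_subquotientEquiv _ _ _ _
      (fun t _ ht => tensorToPath_mem_weightSpan κ hM hdegM ht)
      fun v hv hvj => ⟨_, (hsurj v hv).1, pathToTensor_mem_tensorDegree κ hdegM₀ hvj,
        (hsurj v hv).2⟩⟩

theorem labelProj_merge (j : ℤ) (v : List E →₀ k) :
    labelProj b.weight j (b.merge v) = b.merge (labelProj b.weight j v) := by
  refine labelProj_comm (s := Set.univ) (fun l _ => ?_)
    ((Finsupp.mem_supported k _).2 (Set.subset_univ _)) j
  rw [merge_single]
  exact mergeList_mem_weightSpan l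

theorem iSup_grading (b : PeirceBasis k R V E) : ⨆ d, b.grading d = ⊤ := by
  refine top_le_iff.1 (b.basis.span_eq.ge.trans (Submodule.span_le.2 ?_))
  rintro _ ⟨α, rfl⟩
  exact Submodule.mem_iSup_of_mem (b.deg α) (Submodule.subset_span ⟨α, rfl, rfl⟩)

theorem isInternal_pathHomologyDegree (b : PeirceBasis k R V E) (X Y : V) (i : ℕ) :
    DirectSum.IsInternal (b.pathHomologyDegree X Y i) := by
  refine isInternal_subquotientPart (label := b.weight) (e := id) (fun j v hv => ?_)
    (fun j v hv => ?_) Function.injective_id ?_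
  · refine ⟨labelProj_mem_supported hv.1 j, ?_⟩
    refine LinearMap.mem_ker.2 ?_
    rw [← labelProj_merge, LinearMap.mem_ker.1 hv.2, map_zero]
  · obtain ⟨w, hw, rfl⟩ := hv
    exact ⟨_, labelProj_mem_supported hw j, (labelProj_merge j w).symm⟩
  · rw [Set.range_id, Set.preimage_univ, Finsupp.supported_univ]
    exact le_top

include κ hM η hN in
theorem exists_torEquiv_pathHomology [IsScalarTower k R N]
    (Q : GradedProjectiveResolution k b.grading N degN) (hdegN₀ : degN 0 = ⊤)
    (hdegN : DirectSum.IsInternal degN) (hdegM₀ : degM 0 = ⊤) (hdegM : ∀ j ≠ 0, degM j = ⊥)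
    (i : ℕ) :
    ∃ e : Q.Tor M i ≃ₗ[k] b.PathHomology X Y i,
      ∀ j, (Q.torDegree degM i j).map e.toLinearMap = b.pathHomologyDegree X Y i j := by
  obtain ⟨e, he⟩ := Q.exists_torEquiv (barResolution η hN hdegN₀) b.iSup_grading hdegN degM i
  obtain ⟨e', he'⟩ := exists_barTorEquiv κ hM (η := η) (hN := hN) (hdegN := hdegN₀) hdegM₀
    hdegM i
  refine ⟨e.trans e', fun j => ?_⟩
  rw [LinearEquiv.coe_trans, Submodule.map_comp, he, he']

end TorOfSimples

end PeirceBasis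

section Composition

variable {P : Type u} [PartialOrder P] {r : Setoid (NonemptyInterval P)}

variable (r) in
open Classical in
/-- The class of `[x, y]` as a total function of its endpoints, with the junk value `[x, x]~`
unless `x ≤ y`. -/
noncomputable def cl (x y : P) : IntClass r :=
  if h : x ≤ y then cls x y h else cls x x le_rfl

theorem cl_of_le {x y : P} (h : x ≤ y) : cl r x y = cls x y h :=
  dif_pos h

theorem exists_cl (α : IntClass r) : ∃ x y, x ≤ y ∧ cl r x y = α := by
  obtain ⟨x, y, h, rfl⟩ := exists_cls α
  exact ⟨x, y, h, cl_of_le h⟩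

theorem composes_cl {x y z : P} (hxy : x ≤ y) (hyz : y ≤ z) :
    Composes (cl r x y) (cl r y z) (cl r x z) :=
  ⟨x, y, z, hxy, hyz, (cl_of_le _).symm, (cl_of_le _).symm, (cl_of_le _).symm⟩

theorem pointInt_mk_eq_cl (x : P) : pointInt (r := r) (Quotient.mk _ x) = cl r x x := by
  rw [cl_of_le le_rfl, pointInt_mk]

variable [IncidenceAxioms r]

theorem source_cl {x y : P} (h : x ≤ y) : source (cl r x y) = Quotient.mk _ x := by
  rw [cl_of_le h]
  rfl

theorem target_cl {x y : P} (h : x ≤ y) : target (cl r x y) = Quotient.mk _ y := by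
  rw [cl_of_le h]
  rfl

theorem isProper_cl_iff {x y : P} (h : x ≤ y) : IsProper (cl r x y) ↔ x < y := by
  rw [cl_of_le h]
  refine ⟨?_, fun hlt => ⟨x, y, hlt, rfl⟩⟩
  rintro ⟨u, v, huv, e⟩
  exact lt_of_cls_eq h huv e.symm

theorem exists_cl_eq_cl {x y z x' y' : P} (hxz : x ≤ z) (hzy : z ≤ y) (h' : x' ≤ y')
    (e : cl r x y = cl r x' y') :
    ∃ z', x' ≤ z' ∧ z' ≤ y' ∧ cl r x z = cl r x' z' ∧ cl r z y = cl r z' y' := by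
  rw [cl_of_le (hxz.trans hzy), cl_of_le h', cls_eq] at e
  obtain ⟨τ, hτ, -⟩ := IncidenceAxioms.invariance (hxz.trans hzy) h' e
  obtain ⟨h₁, h₂⟩ := hτ ⟨z, hxz, hzy⟩
  generalize τ ⟨z, hxz, hzy⟩ = z' at h₁ h₂
  obtain ⟨z', hxz', hzy'⟩ := z'
  refine ⟨z', hxz', hzy', ?_, ?_⟩
  · rw [cl_of_le hxz, cl_of_le hxz']
    exact cls_eq.2 h₁
  · rw [cl_of_le hzy, cl_of_le hzy']
    exact cls_eq.2 h₂

theorem eq_of_cl_eq_cl {x y z z' : P} (hxz : x ≤ z) (hzy : z ≤ y) (hxz' : x ≤ z') (hzy' : z' ≤ y)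
    (e₁ : cl r x z = cl r x z') (e₂ : cl r z y = cl r z' y) : z = z' := by
  classical
  rw [cl_of_le hxz, cl_of_le hxz', cls_eq] at e₁
  rw [cl_of_le hzy, cl_of_le hzy', cls_eq] at e₂
  let τ : Set.Icc x y → Set.Icc x y := Function.update id ⟨z, hxz, hzy⟩ ⟨z', hxz', hzy'⟩
  have hτ : ∀ a : Set.Icc x y, r (iv x a a.2.1) (iv x (τ a) (τ a).2.1) ∧
      r (iv a y a.2.2) (iv (τ a) y (τ a).2.2) := by
    intro a
    rcases eq_or_ne a ⟨z, hxz, hzy⟩ with rfl | ha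
    · simp only [τ, Function.update_self]
      exact ⟨e₁, e₂⟩
    · simp only [τ, Function.update_of_ne ha]
      exact ⟨Setoid.refl' r _, Setoid.refl' r _⟩
  have hid : id = τ := (IncidenceAxioms.invariance (r := r) (hxz.trans hzy) (hxz.trans hzy)
    (Setoid.refl' r _)).unique (fun _ => ⟨Setoid.refl' r _, Setoid.refl' r _⟩) hτ
  have h := congrArg Subtype.val (congrFun hid ⟨z, hxz, hzy⟩)
  simpa only [τ, id, Function.update_self] using h

theorem composes_cl_iff {x y : P} (h : x ≤ y) {α β : IntClass r} :
    Composes α β (cl r x y) ↔ ∃ z, x ≤ z ∧ z ≤ y ∧ cl r x z = α ∧ cl r z y = β := by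
  constructor
  · rintro ⟨a, b, c, hab, hbc, rfl, rfl, e⟩
    rw [← cl_of_le (hab.trans hbc)] at e
    obtain ⟨z, hxz, hzy, e₁, e₂⟩ := exists_cl_eq_cl hab hbc h e
    exact ⟨z, hxz, hzy, by rw [← e₁, cl_of_le], by rw [← e₂, cl_of_le]⟩
  · rintro ⟨z, hxz, hzy, rfl, rfl⟩
    exact composes_cl hxz hzy

theorem Composes.source_eq {α β γ : IntClass r} (h : Composes α β γ) : source γ = source α := by
  obtain ⟨x, y, z, hxy, hyz, rfl, rfl, rfl⟩ := h
  rfl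

theorem Composes.target_eq {α β γ : IntClass r} (h : Composes α β γ) : target γ = target β := by
  obtain ⟨x, y, z, hxy, hyz, rfl, rfl, rfl⟩ := h
  rfl

theorem Composes.target_eq_source {α β γ : IntClass r} (h : Composes α β γ) :
    target α = source β := by
  obtain ⟨x, y, z, hxy, hyz, rfl, rfl, rfl⟩ := h
  rfl

theorem exists_composes {α β : IntClass r} (h : target α = source β) : ∃ γ, Composes α β γ := by
  obtain ⟨x, y₁, h₁, rfl⟩ := exists_cls α
  obtain ⟨y₂, z, h₂, rfl⟩ := exists_cls β
  obtain ⟨x', y', z', h₁', h₂', e₁, e₂⟩ := IncidenceAxioms.concatenation h₁ h₂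
    (cls_eq.1 (congrArg pointInt h))
  exact ⟨cls x' z' (h₁'.trans h₂'), x', y', z', h₁', h₂', cls_eq.2 e₁, cls_eq.2 e₂, rfl⟩

theorem source_pointInt (X : PointClass r) : source (pointInt X) = X :=
  Quotient.inductionOn X fun _ => rfl

theorem target_pointInt (X : PointClass r) : target (pointInt X) = X :=
  Quotient.inductionOn X fun _ => rfl

theorem isProper_iff_ne_pointInt {α : IntClass r} : IsProper α ↔ α ≠ pointInt (source α) := by
  constructor
  · rintro h e
    exact not_isProper_pointInt (source α) (e ▸ h)
  · obtain ⟨x, y, h, rfl⟩ := exists_cl α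
    intro hne
    refine (isProper_cl_iff h).2 (h.lt_of_ne ?_)
    rintro rfl
    exact hne (by rw [source_cl le_rfl, pointInt_mk_eq_cl])

end Composition

section Rank

variable {P : Type u} [PartialOrder P] {r : Setoid (NonemptyInterval P)}

/-- The chain condition `x < p₁ < ⋯ < pₘ < y`. -/
def IsChainBetween (x : P) (p : List P) (y : P) : Prop :=
  (x :: (p ++ [y])).IsChain (· < ·)

theorem isChainBetween_nil {x y : P} : IsChainBetween x [] y ↔ x < y :=
  List.isChain_pair

theorem isChainBetween_cons {x v y : P} {p : List P} :
    IsChainBetween x (v :: p) y ↔ x < v ∧ IsChainBetween v p y :=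
  List.isChain_cons_cons

theorem isChainBetween_append_cons {x v y : P} {p q : List P} :
    IsChainBetween x (p ++ v :: q) y ↔ IsChainBetween x p v ∧ IsChainBetween v q y := by
  rw [IsChainBetween, List.append_assoc]
  exact List.isChain_cons_split

theorem isChainBetween_iff {x y : P} {p : List P} : IsChainBetween x p y ↔
    x < y ∧ p.Pairwise (· < ·) ∧ ∀ z ∈ p, z ∈ Set.Ioo x y := by
  simp only [IsChainBetween, List.isChain_iff_pairwise, List.pairwise_cons, List.pairwise_append,
    List.mem_append, List.mem_singleton, Set.mem_Ioo]
  grind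

theorem IsChainBetween.lt {x y : P} {p : List P} (h : IsChainBetween x p y) : x < y :=
  (isChainBetween_iff.1 h).1

theorem IsChainBetween.pairwise {x y : P} {p : List P} (h : IsChainBetween x p y) :
    p.Pairwise (· < ·) :=
  (isChainBetween_iff.1 h).2.1

theorem IsChainBetween.mem_Ioo {x y z : P} {p : List P} (h : IsChainBetween x p y) (hz : z ∈ p) :
    z ∈ Set.Ioo x y :=
  (isChainBetween_iff.1 h).2.2 z hz

theorem IsChainBetween.length_le {x y : P} {p : List P} (h : IsChainBetween x p y)
    (hfin : (Set.Icc x y).Finite) : p.length ≤ (Set.Icc x y).ncard := by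
  classical
  have hnodup : p.Nodup := h.pairwise.imp fun hlt => hlt.ne
  rw [← List.toFinset_card_of_nodup hnodup, ← Set.ncard_coe_finset]
  exact Set.ncard_le_ncard
    (fun z hz => Set.Ioo_subset_Icc_self (h.mem_Ioo (List.mem_toFinset.1 hz))) hfin

/-- The rank of the class of `[x, y]`: the length of the longest chain from `x` to `y`. It is `0`
for the classes of one-point intervals, as the supremum of the empty set. -/
noncomputable def rk (α : IntClass r) : ℕ :=
  sSup {n | ∃ x y p, IsChainBetween x p y ∧ cl r x y = α ∧ p.length + 1 = n}

theorem rk_pointInt [IncidenceAxioms r] (X : PointClass r) : rk (pointInt X) = 0 := by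
  refine (congrArg sSup (Set.eq_empty_of_forall_notMem ?_)).trans csSup_empty
  rintro n ⟨x, y, p, hp, e, -⟩
  exact not_isProper_pointInt X (e ▸ (isProper_cl_iff hp.lt.le).2 hp.lt)

theorem IsChainBetween.exists_of_cl_eq_cl [IncidenceAxioms r] {x y x' y' : P} {p : List P}
    (hp : IsChainBetween x p y) (h' : x' ≤ y') (e : cl r x y = cl r x' y') :
    ∃ p', IsChainBetween x' p' y' ∧ p'.length = p.length := by
  have hlt : ∀ {u v u' v' : P}, u < v → u' ≤ v' → cl r u v = cl r u' v' → u' < v' :=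
    fun huv h e => (isProper_cl_iff h).1 (e ▸ (isProper_cl_iff huv.le).2 huv)
  induction p generalizing x x' with
  | nil => exact ⟨[], isChainBetween_nil.2 (hlt hp.lt h' e), rfl⟩
  | cons v p ih =>
    obtain ⟨hxv, hv⟩ := isChainBetween_cons.1 hp
    obtain ⟨v', hxv', hvy', e₁, e₂⟩ := exists_cl_eq_cl hxv.le hv.lt.le h' e
    obtain ⟨p', hp', hlen⟩ := ih hv hvy' e₂
    exact ⟨v' :: p', isChainBetween_cons.2 ⟨hlt hxv hxv' e₁, hp'⟩, congrArg (· + 1) hlen⟩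

variable [IncidenceAxioms r] (hP : ∀ x y : P, (Set.Icc x y).Finite)

include hP

theorem bddAbove_chain_length (α : IntClass r) :
    BddAbove {n | ∃ x y p, IsChainBetween x p y ∧ cl r x y = α ∧ p.length + 1 = n} := by
  obtain ⟨x, y, h, rfl⟩ := exists_cl α
  refine ⟨(Set.Icc x y).ncard + 1, ?_⟩
  rintro _ ⟨x', y', p', hp', e, rfl⟩
  obtain ⟨p, hp, hlen⟩ := hp'.exists_of_cl_eq_cl h e
  exact hlen ▸ Nat.succ_le_succ (hp.length_le (hP x y))

theorem IsChainBetween.length_lt_rk {x y : P} {p : List P} (h : IsChainBetween x p y) :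
    p.length < rk (cl r x y) :=
  le_csSup (bddAbove_chain_length hP _) ⟨x, y, p, h, rfl, rfl⟩

variable (r) in
theorem exists_isChainBetween_length_eq {x y : P} (h : x < y) :
    ∃ p, IsChainBetween x p y ∧ p.length + 1 = rk (cl r x y) := by
  have hne : {n | ∃ x' y' p, IsChainBetween x' p y' ∧ cl r x' y' = cl r x y ∧
      p.length + 1 = n}.Nonempty := ⟨1, x, y, [], isChainBetween_nil.2 h, rfl, rfl⟩
  obtain ⟨x', y', p', hp', e, hlen⟩ := Nat.sSup_mem hne (bddAbove_chain_length hP _)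
  obtain ⟨p, hp, hlen'⟩ := hp'.exists_of_cl_eq_cl h.le e
  exact ⟨p, hp, hlen' ▸ hlen⟩

theorem rk_eq_zero_iff {α : IntClass r} : rk α = 0 ↔ α = pointInt (source α) := by
  refine ⟨?_, fun h => h ▸ rk_pointInt _⟩
  contrapose!
  rw [← isProper_iff_ne_pointInt]
  obtain ⟨x, y, h, rfl⟩ := exists_cl α
  intro hα
  exact ((isChainBetween_nil.2 ((isProper_cl_iff h).1 hα)).length_lt_rk hP).ne'

theorem rk_pos_iff {α : IntClass r} : 0 < rk α ↔ IsProper α := by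
  rw [isProper_iff_ne_pointInt, Nat.pos_iff_ne_zero, Ne, rk_eq_zero_iff hP]

theorem Composes.rk_add_rk_le {α β γ : IntClass r} (h : Composes α β γ) :
    rk α + rk β ≤ rk γ := by
  obtain ⟨x, y, z, hxy, hyz, rfl, rfl, rfl⟩ := h
  rcases hxy.eq_or_lt with rfl | hxy'
  · rw [← pointInt_mk, rk_pointInt, zero_add]
  rcases hyz.eq_or_lt with rfl | hyz'
  · rw [← pointInt_mk y, rk_pointInt, add_zero]
  obtain ⟨p, hp, hplen⟩ := exists_isChainBetween_length_eq r hP hxy'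
  obtain ⟨q, hq, hqlen⟩ := exists_isChainBetween_length_eq r hP hyz'
  have hlt := (isChainBetween_append_cons.2 ⟨hp, hq⟩).length_lt_rk (r := r) hP
  rw [List.length_append, List.length_cons] at hlt
  rw [← cl_of_le hxy, ← cl_of_le hyz, ← cl_of_le]
  lia

end Rank

section RankFiltration

variable {P : Type u} [PartialOrder P] (hP : ∀ x y : P, (Set.Icc x y).Finite)
  {k : Type v} [Field k] {r : Setoid (NonemptyInterval P)} [IncidenceAxioms r]

theorem xi_mul_xi {α β γ : IntClass r} (h : Composes α β γ) : xi k α * xi k β = xi k γ := by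
  rw [red_mul_def, mulLin_xi, xiMul_of h]

theorem xi_mul_xi_of_not {α β : IntClass r} (h : ¬∃ γ, Composes α β γ) :
    xi k α * xi k β = 0 := by
  rw [red_mul_def, mulLin_xi, xiMul_of_not h]

variable (k) in
theorem IsChainBetween.xi_mem_pow {x y : P} {p : List P} (h : IsChainBetween x p y) :
    xi k (cl r x y) ∈ redIdeal k r ^ (p.length + 1) := by
  have hstep : ∀ {u v : P}, u < v → xi k (cl r u v) ∈ redIdeal k r ^ 1 := by
    intro u v huv
    rw [Submodule.pow_one]
    exact Submodule.subset_span ⟨⟨_, (isProper_cl_iff huv.le).2 huv⟩, rfl⟩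
  induction p generalizing x with
  | nil => exact hstep h.lt
  | cons v p ih =>
    obtain ⟨hxv, hv⟩ := isChainBetween_cons.1 h
    rw [← xi_mul_xi (composes_cl hxv.le hv.lt.le), List.length_cons, add_comm]
    exact mul_mem_pow_add (hstep hxv) (ih hv)

variable (k) in
include hP in
theorem xi_mem_pow_rk (α : IntClass r) : xi k α ∈ redIdeal k r ^ rk α := by
  obtain ⟨x, y, h, rfl⟩ := exists_cl α
  rcases h.eq_or_lt with rfl | hlt
  · rw [← pointInt_mk_eq_cl, rk_pointInt, Submodule.pow_zero, Ideal.one_eq_top]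
    exact Submodule.mem_top
  · obtain ⟨p, hp, hlen⟩ := exists_isChainBetween_length_eq r hP hlt
    exact hlen ▸ hp.xi_mem_pow k

variable (k r) in
/-- The span of the `ξ_α` with `α` of rank at least `d`; this is the `d`-th power of `I`. -/
noncomputable def rankSpan (d : ℕ) : Submodule k (RedAlg k r) :=
  Submodule.span k (xi k '' {α | d ≤ rk α})

variable (k r) in
theorem rankSpan_zero : rankSpan k r 0 = ⊤ := by
  refine eq_top_iff.2 fun a _ => ?_
  induction a using red_induction with
  | h0 => exact zero_mem _
  | hadd a b iha ihb => exact add_mem (iha trivial) (ihb trivial)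
  | hsmul c a ih => exact Submodule.smul_mem _ _ (ih trivial)
  | hxi α => exact Submodule.subset_span ⟨α, Nat.zero_le _, rfl⟩

include hP in
theorem rankSpan_mul_le (d e : ℕ) : rankSpan k r d * rankSpan k r e ≤ rankSpan k r (d + e) := by
  rw [rankSpan, rankSpan, Submodule.span_mul_span, Submodule.span_le]
  rintro _ ⟨_, ⟨α, hα, rfl⟩, _, ⟨β, hβ, rfl⟩, rfl⟩
  change xi k α * xi k β ∈ rankSpan k r (d + e)
  by_cases h : ∃ γ, Composes α β γ
  · obtain ⟨γ, hγ⟩ := h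
    rw [xi_mul_xi hγ]
    exact Submodule.subset_span ⟨γ, (add_le_add hα hβ).trans (hγ.rk_add_rk_le hP), rfl⟩
  · rw [xi_mul_xi_of_not h]
    exact zero_mem _

include hP in
theorem redIdeal_le_rankSpan_one : (redIdeal k r).restrictScalars k ≤ rankSpan k r 1 := by
  refine Submodule.span_le.2 ?_
  rintro _ ⟨γ, rfl⟩
  exact Submodule.subset_span ⟨γ, (rk_pos_iff hP).2 γ.2, rfl⟩

include hP in
theorem redIdeal_pow_le_rankSpan (d : ℕ) :
    (redIdeal k r ^ d).restrictScalars k ≤ rankSpan k r d := by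
  induction d with
  | zero => exact (rankSpan_zero k r).symm ▸ le_top
  | succ d ih =>
    intro a ha
    rw [Submodule.restrictScalars_mem, Submodule.pow_succ] at ha
    refine Submodule.mul_induction_on ha (fun b hb c hc => ?_) fun _ _ => add_mem
    exact rankSpan_mul_le hP d 1
      (Submodule.mul_mem_mul (ih hb) (redIdeal_le_rankSpan_one hP hc))

include hP in
theorem mem_redIdeal_pow_iff {d : ℕ} {a : RedAlg k r} :
    a ∈ redIdeal k r ^ d ↔ a ∈ rankSpan k r d := by
  refine ⟨fun ha => redIdeal_pow_le_rankSpan hP d ha, fun ha => ?_⟩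
  suffices h : rankSpan k r d ≤ (redIdeal k r ^ d).restrictScalars k from h ha
  refine Submodule.span_le.2 ?_
  rintro _ ⟨α, hα, rfl⟩
  exact Ideal.pow_le_pow_right hα (xi_mem_pow_rk hP k α)

/-- The coefficient of `ξ_α`. -/
noncomputable def xiCoeff (α : IntClass r) : RedAlg k r →ₗ[k] k :=
  Finsupp.lapply α

open Classical in
theorem xiCoeff_xi (α β : IntClass r) :
    xiCoeff (k := k) α (xi k β) = if β = α then 1 else 0 :=
  Finsupp.single_apply

include hP in
theorem xiCoeff_eq_zero_of_mem_pow {α : IntClass r} {a : RedAlg k r}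
    (ha : a ∈ redIdeal k r ^ (rk α + 1)) : xiCoeff α a = 0 := by
  classical
  suffices h : rankSpan k r (rk α + 1) ≤ (xiCoeff α).ker from h ((mem_redIdeal_pow_iff hP).1 ha)
  refine Submodule.span_le.2 ?_
  rintro _ ⟨β, hβ, rfl⟩
  have hne : β ≠ α := by
    rintro rfl
    exact Nat.not_succ_le_self _ hβ
  exact LinearMap.mem_ker.2 ((xiCoeff_xi α β).trans (if_neg hne))

end RankFiltration

section Zeta

/-- The linear form on `I ^ d / I ^ (d + 1)` induced by a linear form vanishing on
`I ^ (d + 1)`. -/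
noncomputable def grPieceLift {k : Type v} [Field k] {A : Type u} [Ring A] [Algebra k A]
    {I : Ideal A} (d : ℕ) (f : A →ₗ[k] k) (hf : ∀ a ∈ I ^ (d + 1), f a = 0) :
    GrPiece I d →ₗ[k] k :=
  (((I ^ (d + 1)).submoduleOf (I ^ d)).restrictScalars k).liftQ
    (f ∘ₗ (I ^ d).subtype.restrictScalars k) (fun a ha => hf a ha) ∘ₗ
    (Submodule.Quotient.restrictScalarsEquiv k _).symm.toLinearMap

theorem grMk_eq_zero {A : Type u} [Ring A] {I : Ideal A} {d : ℕ} {a : A} (ha : a ∈ I ^ d)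
    (h : a ∈ I ^ (d + 1)) : grMk a ha = 0 :=
  (grMk_eq ha (zero_mem _)).2 (by rwa [sub_zero])

theorem lof_grMk_congr (k : Type v) [Field k] {A : Type u} [Ring A] [Algebra k A] {I : Ideal A}
    {m n : ℕ} {a b : A} (ha : a ∈ I ^ m) (hb : b ∈ I ^ n) (hmn : m = n) (hab : a = b) :
    DirectSum.lof k ℕ (GrPiece I) m (grMk a ha) = DirectSum.lof k ℕ (GrPiece I) n (grMk b hb) := by
  subst hmn hab
  rfl

variable {P : Type u} [PartialOrder P] (hP : ∀ x y : P, (Set.Icc x y).Finite)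
  {k : Type v} [Field k] {r : Setoid (NonemptyInterval P)} [IncidenceAxioms r]

variable (k) in
/-- The class of `ξ_α` in degree `rk α` of the associated graded ring. -/
noncomputable def zeta (α : IntClass r) : RedGr k r :=
  DirectSum.lof k ℕ (GrPiece (redIdeal k r)) (rk α) (grMk (xi k α) (xi_mem_pow_rk hP k α))

theorem zeta_mul_zeta_eq_lof (α β : IntClass r) : zeta hP k α * zeta hP k β =
    DirectSum.lof k ℕ (GrPiece (redIdeal k r)) (rk α + rk β) (grMk (xi k α * xi k β)
      (mul_mem_pow_add (xi_mem_pow_rk hP k α) (xi_mem_pow_rk hP k β))) :=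
  DirectSum.of_mul_of _ _

theorem zeta_mul_zeta {α β γ : IntClass r} (h : Composes α β γ) (hrk : rk γ = rk α + rk β) :
    zeta hP k α * zeta hP k β = zeta hP k γ := by
  rw [zeta_mul_zeta_eq_lof]
  exact lof_grMk_congr k _ _ hrk.symm (xi_mul_xi h)

theorem zeta_mul_zeta_of_not {α β : IntClass r}
    (h : ¬∃ γ, Composes α β γ ∧ rk γ = rk α + rk β) : zeta hP k α * zeta hP k β = 0 := by
  rw [zeta_mul_zeta_eq_lof, grMk_eq_zero, map_zero]
  by_cases hαβ : ∃ γ, Composes α β γ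
  · obtain ⟨γ, hγ⟩ := hαβ
    have hlt : rk α + rk β < rk γ :=
      (hγ.rk_add_rk_le hP).lt_of_ne fun e => h ⟨γ, hγ, e.symm⟩
    rw [xi_mul_xi hγ]
    exact Ideal.pow_le_pow_right hlt (xi_mem_pow_rk hP k γ)
  · rw [xi_mul_xi_of_not hαβ]
    exact zero_mem _

/-- The linear form on the associated graded ring which is dual to `ζ_α`. -/
noncomputable def zetaCoeff (α : IntClass r) : RedGr k r →ₗ[k] k :=
  grPieceLift (rk α) (xiCoeff α) (fun _ h => xiCoeff_eq_zero_of_mem_pow hP h) ∘ₗ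
    DirectSum.component k ℕ _ (rk α)

open Classical in
theorem zetaCoeff_zeta (α β : IntClass r) :
    zetaCoeff hP α (zeta hP k β) = if β = α then 1 else 0 := by
  by_cases h : rk β = rk α
  · have hβ : xi k β ∈ redIdeal k r ^ rk α := h ▸ xi_mem_pow_rk hP k β
    have hz : zeta hP k β = DirectSum.lof k ℕ (GrPiece (redIdeal k r)) (rk α) (grMk _ hβ) :=
      lof_grMk_congr k _ _ h rfl
    have hcomp : DirectSum.component k ℕ (GrPiece (redIdeal k r)) (rk α) (zeta hP k β) =
        grMk (xi k β) hβ := by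
      rw [hz]
      exact DirectSum.component.lof_self k (ι := ℕ) (M := GrPiece (redIdeal k r)) (rk α) _
    rw [zetaCoeff, LinearMap.comp_apply, hcomp]
    exact xiCoeff_xi α β
  · rw [zetaCoeff, LinearMap.comp_apply, zeta, DirectSum.component.of, dif_neg h, map_zero,
      if_neg fun e => h (congrArg rk e)]

theorem linearIndependent_zeta : LinearIndependent k (zeta hP k (r := r)) := by
  classical
  have hcoeff (α : IntClass r) (c : IntClass r →₀ k) :
      zetaCoeff hP α (Finsupp.linearCombination k (zeta hP k) c) = c α := by
    simp only [Finsupp.linearCombination_apply, map_finsuppSum, map_smul, zetaCoeff_zeta,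
      smul_eq_mul, mul_ite, mul_one, mul_zero, Finsupp.sum_ite_eq']
    grind
  intro c c' h
  ext α
  rw [← hcoeff, ← hcoeff, h]

theorem lof_grMk_mem_span_zeta {d : ℕ} {a : RedAlg k r} (ha : a ∈ redIdeal k r ^ d) :
    DirectSum.lof k ℕ (GrPiece (redIdeal k r)) d (grMk a ha) ∈
      Submodule.span k (zeta hP k '' {α | rk α = d}) := by
  have ha' := (mem_redIdeal_pow_iff hP).1 ha
  induction ha' using Submodule.span_induction with
  | mem x hx =>
    obtain ⟨α, hα, rfl⟩ := hx
    rcases (show d ≤ rk α from hα).eq_or_lt with rfl | h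
    · exact Submodule.subset_span ⟨α, rfl, rfl⟩
    · rw [grMk_eq_zero ha (Ideal.pow_le_pow_right h (xi_mem_pow_rk hP k α)), map_zero]
      exact zero_mem _
  | zero =>
    have hzero : grMk (0 : RedAlg k r) ha = 0 := rfl
    rw [hzero, map_zero]
    exact zero_mem _
  | add x y hx hy ihx ihy =>
    have hx' := (mem_redIdeal_pow_iff hP).2 hx
    have hy' := (mem_redIdeal_pow_iff hP).2 hy
    have hadd : grMk (x + y) ha = grMk x hx' + grMk y hy' := rfl
    rw [hadd, map_add]
    exact add_mem (ihx hx') (ihy hy')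
  | smul t x hx ih =>
    have hx' := (mem_redIdeal_pow_iff hP).2 hx
    have hsmul : grMk (t • x) ha = t • grMk x hx' := rfl
    rw [hsmul, map_smul]
    exact Submodule.smul_mem _ _ (ih hx')

theorem redGrading_eq_span_zeta (d : ℕ) :
    redGrading k r d = Submodule.span k (zeta hP k '' {α | rk α = d}) := by
  apply le_antisymm
  · rintro _ ⟨x, rfl⟩
    obtain ⟨a, ha, rfl⟩ := grMk_surj x
    exact lof_grMk_mem_span_zeta hP ha
  · refine Submodule.span_le.2 ?_
    rintro _ ⟨α, rfl, rfl⟩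
    exact ⟨_, rfl⟩

theorem span_zeta_eq_top : Submodule.span k (Set.range (zeta hP k (r := r))) = ⊤ := by
  refine eq_top_iff.2 fun x _ => ?_
  induction x using DirectSum.induction_on with
  | zero => exact zero_mem _
  | of d x =>
    obtain ⟨a, ha, rfl⟩ := grMk_surj x
    exact Submodule.span_mono (Set.image_subset_range _ _) (lof_grMk_mem_span_zeta hP ha)
  | add x y hx hy => exact add_mem (hx trivial) (hy trivial)

variable (k r) in
/-- The basis of the associated graded ring formed by the `ζ_α`. -/
noncomputable def zetaBasis : Module.Basis (IntClass r) k (RedGr k r) :=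
  Module.Basis.mk (linearIndependent_zeta hP) (span_zeta_eq_top hP).ge

theorem zetaBasis_apply (α : IntClass r) : zetaBasis hP k r α = zeta hP k α :=
  Module.Basis.mk_apply _ _ α

theorem zetaBasis_mul {α β γ : IntClass r} (h : Composes α β γ) (hrk : rk γ = rk α + rk β) :
    zetaBasis hP k r α * zetaBasis hP k r β = zetaBasis hP k r γ := by
  simpa only [zetaBasis_apply] using zeta_mul_zeta hP h hrk

theorem zetaBasis_mul_of_not {α β : IntClass r}
    (h : ¬∃ γ, Composes α β γ ∧ rk γ = rk α + rk β) :
    zetaBasis hP k r α * zetaBasis hP k r β = 0 := by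
  simpa only [zetaBasis_apply] using zeta_mul_zeta_of_not hP h

theorem composes_of_repr_mul_ne_zero {α β γ : IntClass r}
    (h : (zetaBasis hP k r).repr (zetaBasis hP k r α * zetaBasis hP k r β) γ ≠ 0) :
    Composes α β γ ∧ rk γ = rk α + rk β := by
  by_cases hαβ : ∃ γ', Composes α β γ' ∧ rk γ' = rk α + rk β
  · obtain ⟨γ', hγ', hrk⟩ := hαβ
    rw [zetaBasis_mul hP hγ' hrk, Module.Basis.repr_self] at h
    obtain rfl : γ' = γ := not_imp_comm.1 Finsupp.single_eq_of_ne' h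
    exact ⟨hγ', hrk⟩
  · rw [zetaBasis_mul_of_not hP hαβ, map_zero] at h
    exact absurd rfl h

variable (k r) in
/-- The associated graded ring of the reduced incidence algebra, with the basis of the `ζ_α`. -/
noncomputable def zetaPeirceBasis : PeirceBasis k (RedGr k r) (PointClass r) (IntClass r) where
  basis := zetaBasis hP k r
  deg := rk
  source := source
  target := target
  idem := pointInt
  source_idem := source_pointInt
  target_idem := target_pointInt
  deg_eq_zero_iff _ := rk_eq_zero_iff hP
  idem_mul _ := zetaBasis_mul hP (pointInt_composes.2 ⟨rfl, rfl⟩) (by rw [rk_pointInt, zero_add])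
  mul_idem _ := zetaBasis_mul hP (composes_pointInt.2 ⟨rfl, rfl⟩) (by rw [rk_pointInt, add_zero])
  mul_support _ _ _ h :=
    have ⟨hγ, hrk⟩ := composes_of_repr_mul_ne_zero hP h
    ⟨hγ.source_eq, hγ.target_eq, hrk⟩

theorem grading_zetaPeirceBasis : (zetaPeirceBasis hP k r).grading = redGrading k r := by
  have hzeta : ⇑(zetaBasis hP k r) = zeta hP k := funext (zetaBasis_apply hP)
  funext d
  rw [redGrading_eq_span_zeta hP, ← hzeta]
  rfl

theorem character_zetaPeirceBasis (X : PointClass r) (a : RedGr k r) :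
    (zetaPeirceBasis hP k r).character X a = pointChar k X a := by
  classical
  suffices h : (zetaPeirceBasis hP k r).character X = (pointChar k X).toLinearMap from
    LinearMap.congr_fun h a
  refine (zetaBasis hP k r).ext fun α => ?_
  have hchar : (zetaPeirceBasis hP k r).character X (zetaBasis hP k r α) =
      if α = pointInt X then 1 else 0 := by
    rw [← Finsupp.single_apply, ← Module.Basis.repr_self (zetaBasis hP k r) α]
    rfl
  rw [hchar, zetaBasis_apply, ← pointCoeff_xi (k := k),
    ← pieceCoeff_grMk k X (xi_mem_pow_rk hP k α)]
  exact (DirectSum.toModule_lof k (rk α) _).symm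

end Zeta

section Product

variable {P : Type u} [PartialOrder P] {r : Setoid (NonemptyInterval P)}

open Classical in
/-- The composite of two classes, with a junk value if they are not composable. -/
noncomputable def comp (α β : IntClass r) : IntClass r :=
  if h : ∃ γ, Composes α β γ then h.choose else α

variable [IncidenceAxioms r]

theorem Composes.comp_eq {α β γ : IntClass r} (h : Composes α β γ) : comp α β = γ := by
  rw [comp, dif_pos ⟨γ, h⟩]
  exact (Exists.choose_spec ⟨γ, h⟩ : Composes α β _).unique h

theorem composes_comp {α β : IntClass r} (h : target α = source β) :
    Composes α β (comp α β) := by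
  obtain ⟨γ, hγ⟩ := exists_composes h
  exact hγ.comp_eq.symm ▸ hγ

theorem comp_pointInt (α : IntClass r) : comp α (pointInt (target α)) = α :=
  (composes_pointInt.2 ⟨rfl, rfl⟩).comp_eq

theorem Composes.comp_eq_comp_comp {α β γ δ : IntClass r} (h : Composes α β γ)
    (hδ : target β = source δ) : comp γ δ = comp α (comp β δ) := by
  have hβδ : Composes β δ (comp β δ) := composes_comp hδ
  have hα : Composes α (comp β δ) (comp α (comp β δ)) :=
    composes_comp (h.target_eq_source.trans hβδ.source_eq.symm)
  obtain ⟨γ', hγ', hε⟩ := (composes_assoc _ _ _ _).2 ⟨_, hβδ, hα⟩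
  exact (hγ'.unique h ▸ hε).comp_eq

/-- The composite of a sequence of classes leading to the point class `Y`. -/
noncomputable def pathProduct (Y : PointClass r) : List (IntClass r) → IntClass r
  | [] => pointInt Y
  | α :: l => comp α (pathProduct Y l)

variable {hP : ∀ x y : P, (Set.Icc x y).Finite} {k : Type v} [Field k] {X Y : PointClass r}
  {α : IntClass r} {l : List (IntClass r)}

theorem source_pathProduct (hl : (zetaPeirceBasis hP k r).IsPath Y X l) :
    source (pathProduct Y l) = X := by
  induction l generalizing X with
  | nil =>
    obtain rfl : X = Y := hl
    exact source_pointInt X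
  | cons α l ih =>
    obtain ⟨rfl, -, hl⟩ := hl
    exact (composes_comp (ih hl).symm).source_eq

theorem composes_pathProduct (h : (zetaPeirceBasis hP k r).IsPath Y X (α :: l)) :
    Composes α (pathProduct Y l) (pathProduct Y (α :: l)) :=
  composes_comp (source_pathProduct h.2.2).symm

theorem target_pathProduct (hl : (zetaPeirceBasis hP k r).IsPath Y X l) :
    target (pathProduct Y l) = Y := by
  induction l generalizing X with
  | nil => exact target_pointInt Y
  | cons α l ih => exact (composes_pathProduct hl).target_eq.trans (ih hl.2.2)

theorem isProper_pathProduct (h : (zetaPeirceBasis hP k r).IsPath Y X (α :: l)) :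
    IsProper (pathProduct Y (α :: l)) :=
  ((rk_pos_iff hP).1 h.2.1).of_left (composes_pathProduct h)

theorem basis_mul_mem_span_composes (hP : ∀ x y : P, (Set.Icc x y).Finite) (α β : IntClass r) :
    (zetaPeirceBasis hP k r).basis α * (zetaPeirceBasis hP k r).basis β ∈
      Submodule.span k ((zetaPeirceBasis hP k r).basis '' {γ | Composes α β γ}) :=
  (zetaBasis hP k r).mem_span_image.2 fun _ hγ =>
    (composes_of_repr_mul_ne_zero hP (Finsupp.mem_support_iff.1 hγ)).1

theorem mergeList_mem_supported_pathProduct (hl : (zetaPeirceBasis hP k r).IsPath Y X l) :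
    (zetaPeirceBasis hP k r).mergeList l ∈
      Finsupp.supported k k (pathProduct Y ⁻¹' {pathProduct Y l}) := by
  induction l generalizing X with
  | nil => exact zero_mem _
  | cons α l ih =>
    rw [PeirceBasis.mergeList]
    refine sub_mem ?_ (PeirceBasis.cons_basis_mem_supported
      (fun m (hm : pathProduct Y m = pathProduct Y l) => congrArg (comp α) hm) (ih hl.2.2))
    cases l with
    | nil =>
      rw [PeirceBasis.mulHead_nil]
      exact zero_mem _
    | cons β l =>
      rw [← PeirceBasis.cons_basis (b := zetaPeirceBasis hP k r), PeirceBasis.mulHead_cons]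
      refine PeirceBasis.cons_mem_supported (fun γ hγ m hm => ?_)
        (basis_mul_mem_span_composes hP α β)
        (Finsupp.single_mem_supported k 1 (Set.mem_singleton l))
      obtain rfl : m = l := hm
      exact Composes.comp_eq_comp_comp hγ (source_pathProduct hl.2.2.2.2).symm

end Product

section Steps

variable {P : Type u} [PartialOrder P] {r : Setoid (NonemptyInterval P)} {x y : P} {p : List P}

variable (r) in
/-- The classes of the successive intervals of the chain `x < p₁ < ⋯ < pₘ < y`. -/
noncomputable def steps : P → List P → P → List (IntClass r)
  | x, [], y => [cl r x y]
  | x, v :: p, y => cl r x v :: steps v p y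

theorem length_steps : (steps r x p y).length = p.length + 1 := by
  induction p generalizing x with
  | nil => rfl
  | cons v p ih => exact congrArg (· + 1) ih

variable [IncidenceAxioms r]

section

variable (hP : ∀ x y : P, (Set.Icc x y).Finite) (k : Type v) [Field k]

theorem IsChainBetween.isPath_steps (h : IsChainBetween x p y) :
    (zetaPeirceBasis hP k r).IsPath (Quotient.mk _ y) (Quotient.mk _ x) (steps r x p y) := by
  have hpos {x y : P} (h : x < y) : 0 < rk (cl r x y) :=
    (rk_pos_iff hP).2 ((isProper_cl_iff h.le).2 h)
  induction p generalizing x with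
  | nil => exact ⟨source_cl h.lt.le, hpos h.lt, target_cl h.lt.le⟩
  | cons v p ih =>
    obtain ⟨hxv, hv⟩ := isChainBetween_cons.1 h
    refine ⟨source_cl hxv.le, hpos hxv, ?_⟩
    change PeirceBasis.IsPath _ _ (target _) _
    rw [target_cl hxv.le]
    exact ih hv

theorem weight_steps_nil :
    (zetaPeirceBasis hP k r).weight (steps r x [] y) = rk (cl r x y) :=
  add_zero _

theorem weight_steps_cons (v : P) : (zetaPeirceBasis hP k r).weight (steps r x (v :: p) y) =
    rk (cl r x v) + (zetaPeirceBasis hP k r).weight (steps r v p y) :=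
  rfl

variable {hP k} in
theorem exists_steps_eq {X Y : PointClass r} {α : IntClass r} {l : List (IntClass r)}
    (hl : (zetaPeirceBasis hP k r).IsPath Y X (α :: l)) (hxy : x ≤ y)
    (h : pathProduct Y (α :: l) = cl r x y) :
    ∃ p, IsChainBetween x p y ∧ steps r x p y = α :: l := by
  induction l generalizing x X α with
  | nil =>
    obtain rfl : target α = Y := hl.2.2
    rw [pathProduct, pathProduct, comp_pointInt] at h
    have hlt : x < y := (isProper_cl_iff hxy).1 (h ▸ (rk_pos_iff hP).1 hl.2.1)
    exact ⟨[], isChainBetween_nil.2 hlt, by rw [steps, h]⟩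
  | cons β l ih =>
    have hcomp : Composes α (pathProduct Y (β :: l)) (cl r x y) := h ▸ composes_pathProduct hl
    obtain ⟨z, hxz, hzy, rfl, hz⟩ := (composes_cl_iff hxy).1 hcomp
    have hlt : x < z := (isProper_cl_iff hxz).1 ((rk_pos_iff hP).1 hl.2.1)
    obtain ⟨p, hp, hsteps⟩ := ih hl.2.2 hzy hz.symm
    exact ⟨z :: p, isChainBetween_cons.2 ⟨hlt, hp⟩, by rw [steps, hsteps]⟩

end

theorem IsChainBetween.pathProduct_steps (h : IsChainBetween x p y) :
    pathProduct (Quotient.mk _ y) (steps r x p y) = cl r x y := by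
  induction p generalizing x with
  | nil =>
    rw [steps, pathProduct, pathProduct, ← target_cl h.lt.le, comp_pointInt]
  | cons v p ih =>
    obtain ⟨hxv, hv⟩ := isChainBetween_cons.1 h
    rw [steps, pathProduct, ih hv]
    exact (composes_cl hxv.le hv.lt.le).comp_eq

theorem IsChainBetween.eq_of_steps_eq {q : List P} (hp : IsChainBetween x p y)
    (hq : IsChainBetween x q y) (h : steps r x p y = steps r x q y) : p = q := by
  induction p generalizing x q with
  | nil =>
    have hlen := congrArg List.length h
    rw [length_steps, length_steps] at hlen
    exact (List.length_eq_zero_iff.1 (Nat.succ_injective hlen).symm).symm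
  | cons v p ih =>
    cases q with
    | nil =>
      have hlen := congrArg List.length h
      rw [length_steps, length_steps] at hlen
      cases hlen
    | cons w q =>
      obtain ⟨hxv, hv⟩ := isChainBetween_cons.1 hp
      obtain ⟨hxw, hw⟩ := isChainBetween_cons.1 hq
      obtain ⟨hhead, htail⟩ := List.cons_eq_cons.1 h
      have hy : cl r v y = cl r w y := by
        rw [← hv.pathProduct_steps, htail, hw.pathProduct_steps]
      obtain rfl : v = w := eq_of_cl_eq_cl hxv.le hv.lt.le hxw.le hw.lt.le hhead hy
      rw [ih hv hw htail]

variable (r) (hP : ∀ x y : P, (Set.Icc x y).Finite) (k : Type v) [Field k]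

theorem IsChainBetween.exists_refinement (h : IsChainBetween x p y) :
    ∃ q, IsChainBetween x q y ∧ p ⊆ q ∧
      (q.length : ℤ) + 1 = (zetaPeirceBasis hP k r).weight (steps r x p y) := by
  induction p generalizing x with
  | nil =>
    obtain ⟨q, hq, hlen⟩ := exists_isChainBetween_length_eq r hP h.lt
    exact ⟨q, hq, List.nil_subset q, by
      rw [weight_steps_nil]
      exact_mod_cast hlen⟩
  | cons v p ih =>
    obtain ⟨hxv, hv⟩ := isChainBetween_cons.1 h
    obtain ⟨q, hq, hlen⟩ := exists_isChainBetween_length_eq r hP hxv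
    obtain ⟨q', hq', hsub, hlen'⟩ := ih hv
    refine ⟨q ++ v :: q', isChainBetween_append_cons.2 ⟨hq, hq'⟩,
      List.subset_append_of_subset_right q (List.cons_subset_cons v hsub), ?_⟩
    rw [weight_steps_cons, ← hlen', List.length_append, List.length_cons, ← hlen]
    push_cast
    ring

theorem IsChainBetween.length_lt_weight {q : List P} (hp : IsChainBetween x p y)
    (hq : IsChainBetween x q y) (hsub : p ⊆ q) :
    (q.length : ℤ) < (zetaPeirceBasis hP k r).weight (steps r x p y) := by
  induction p generalizing x q with
  | nil =>
    have hlt := hq.length_lt_rk (r := r) hP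
    rw [weight_steps_nil]
    exact_mod_cast hlt
  | cons v p ih =>
    have hv : IsChainBetween v p y := (isChainBetween_cons.1 hp).2
    obtain ⟨q₁, q₂, rfl⟩ := List.append_of_mem (hsub List.mem_cons_self)
    obtain ⟨hq₁, hq₂⟩ := isChainBetween_append_cons.1 hq
    have hsub₂ : p ⊆ q₂ := fun z hz => by
      have hvz : v < z := (hv.mem_Ioo hz).1
      rcases List.mem_append.1 (hsub (List.mem_cons_of_mem v hz)) with hz₁ | hz₂
      · exact absurd (hq₁.mem_Ioo hz₁).2 hvz.not_gt
      · exact (List.mem_cons.1 hz₂).resolve_left hvz.ne'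
    have hlt₁ := hq₁.length_lt_rk (r := r) hP
    have hlt₂ := ih hv hq₂ hsub₂
    rw [weight_steps_cons, List.length_append, List.length_cons]
    lia

end Steps

section Chains

variable {V : Type u} [PartialOrder V]

open Classical in
theorem exists_pairwise_toFinset_eq {F : Finset V} (h : IsChain (· ≤ ·) (F : Set V)) :
    ∃ p : List V, p.Pairwise (· < ·) ∧ p.toFinset = F := by
  induction F using Finset.strongInduction with
  | H F ih =>
    rcases F.eq_empty_or_nonempty with rfl | hF
    · exact ⟨[], List.Pairwise.nil, rfl⟩
    · obtain ⟨m, hm⟩ := F.exists_minimal hF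
      obtain ⟨p, hp, hpF⟩ := ih (F.erase m) (Finset.erase_ssubset hm.1)
        (h.mono (Finset.coe_subset.2 (Finset.erase_subset _ _)))
      refine ⟨m :: p, List.pairwise_cons.2 ⟨fun z hz => ?_, hp⟩, ?_⟩
      · rw [← List.mem_toFinset, hpF, Finset.mem_erase] at hz
        have hle : m ≤ z := (h hm.1 hz.2 hz.1.symm).elim id (hm.2 hz.2)
        exact hle.lt_of_ne hz.1.symm
      · rw [List.toFinset_cons, hpF, Finset.insert_erase hm.1]

open Classical in
theorem eq_of_pairwise_of_toFinset_eq {p q : List V} (hp : p.Pairwise (· < ·))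
    (hq : q.Pairwise (· < ·)) (h : p.toFinset = q.toFinset) : p = q :=
  List.Perm.eq_of_pairwise (fun _ _ _ _ hab hba => (lt_asymm hab hba).elim) hp hq
    (List.perm_of_nodup_nodup_toFinset_eq (hp.imp fun hlt => hlt.ne) (hq.imp fun hlt => hlt.ne) h)

variable {x y : V}

open Classical in
theorem IsChainBetween.card_toFinset {p : List V} (hp : IsChainBetween x p y) :
    p.toFinset.card = p.length :=
  List.toFinset_card_of_nodup (hp.pairwise.imp fun h => h.ne)

open Classical in
theorem mem_orderComplex_Ioo_iff (hxy : x < y) {F : Finset V} :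
    F ∈ (orderComplex (Set.Ioo x y)).faces ↔ ∃ p, IsChainBetween x p y ∧ p.toFinset = F := by
  constructor
  · rintro ⟨hF, hchain⟩
    obtain ⟨p, hp, rfl⟩ := exists_pairwise_toFinset_eq hchain
    exact ⟨p, isChainBetween_iff.2 ⟨hxy, hp, fun z hz => hF (List.mem_toFinset.2 hz)⟩, rfl⟩
  · rintro ⟨p, hp, rfl⟩
    refine ⟨fun z hz => hp.mem_Ioo (List.mem_toFinset.1 hz), fun a ha b hb hab => ?_⟩
    have hcomparable : p.Pairwise fun a b => a ≤ b ∨ b ≤ a := hp.pairwise.imp fun h => Or.inl h.le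
    have : Std.Symm fun a b : V => a ≤ b ∨ b ≤ a := ⟨fun _ _ => Or.symm⟩
    exact hcomparable.forall (List.mem_toFinset.1 ha) (List.mem_toFinset.1 hb) hab

end Chains

section Cone

variable (k : Type v) [Field k] {V : Type u}

theorem chains_le {k : Type v} [Field k] {Δ : FaceComplex V} {n : ℤ}
    {N : Submodule k (ChainSpace k V)}
    (h : ∀ F ∈ Δ.faces, (F.card : ℤ) - 1 = n → face k F ∈ N) : Δ.chains k n ≤ N := by
  refine Submodule.span_le.2 ?_
  rintro _ ⟨F, ⟨hF, hn⟩, rfl⟩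
  exact h F hF hn

theorem face_mem_chains {Δ : FaceComplex V} {n : ℤ} {F : Finset V} (h : F ∈ Δ.faces)
    (hn : (F.card : ℤ) - 1 = n) : face k F ∈ Δ.chains k n :=
  Submodule.subset_span ⟨F, ⟨h, hn⟩, rfl⟩

open Classical in
/-- The cone operator with apex `v` on simplicial chains, the linear extension of
`F ↦ F ∪ {v}`. -/
noncomputable def cone (v : V) : ChainSpace k V →ₗ[k] ChainSpace k V :=
  Finsupp.linearCombination k fun F => face k (insert v F)

open Classical in
theorem cone_face (v : V) (F : Finset V) : cone k v (face k F) = face k (insert v F) := by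
  unfold cone face
  erw [Finsupp.linearCombination_single, one_smul]

variable [PartialOrder V]

theorem boundary_mem_chains (Δ : FaceComplex V) (n : ℤ) {c : ChainSpace k V}
    (hc : c ∈ Δ.chains k n) : boundary k c ∈ Δ.chains k (n - 1) := by
  classical
  suffices hle : Δ.chains k n ≤ (Δ.chains k (n - 1)).comap (boundary k) from hle hc
  refine chains_le fun F hF hn => ?_
  rw [Submodule.mem_comap, boundary_face]
  refine sum_mem fun v hv => Submodule.smul_mem _ _ (face_mem_chains k
    (Δ.down_closed hF (Finset.erase_subset _ _)) ?_)
  have hcard := Finset.card_erase_add_one hv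
  lia

open Classical in
theorem boundary_face_insert {v : V} {F : Finset V} (h : ∀ u ∈ F, v < u) :
    boundary k (face k (insert v F)) = face k F - cone k v (boundary k (face k F)) := by
  have hv : v ∉ F := fun hv => lt_irrefl v (h v hv)
  rw [boundary_face, Finset.sum_insert hv, boundary_face, map_sum, sub_eq_add_neg,
    ← Finset.sum_neg_distrib]
  congr 1
  · have hmin : (insert v F).filter (· < v) = ∅ := by
      rw [Finset.filter_eq_empty_iff, Finset.forall_mem_insert]
      exact ⟨lt_irrefl v, fun u hu => (h u hu).asymm⟩
    rw [hmin, Finset.card_empty, pow_zero, one_smul, Finset.erase_insert hv]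
  · refine Finset.sum_congr rfl fun u hu => ?_
    have hvu := h u hu
    rw [map_smul, cone_face, Finset.filter_insert, if_pos hvu, Finset.card_insert_of_notMem
      (fun hv' => hv (Finset.mem_filter.1 hv').1), pow_succ, mul_neg_one, neg_smul,
      Finset.erase_insert_of_ne hvu.ne]

end Cone

section Comparison

variable {P : Type u} [PartialOrder P] (k : Type v) [Field k] (r : Setoid (NonemptyInterval P))

open Classical in
/-- The map from the chains of the order complex of `(x, y)` to combinations of lists which sends
the face `{p₁ < ⋯ < pₘ}` to the classes of the successive intervals of `x < p₁ < ⋯ < pₘ < y`. -/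
noncomputable def chainSteps (x y : P) : ChainSpace k P →ₗ[k] (List (IntClass r) →₀ k) :=
  Finsupp.linearCombination k fun F =>
    if h : ∃ p, IsChainBetween x p y ∧ p.toFinset = F then
      Finsupp.single (steps r x h.choose y) 1 else 0

variable {x y : P} {p : List P}

open Classical in
theorem chainSteps_face (hp : IsChainBetween x p y) :
    chainSteps k r x y (face k p.toFinset) = Finsupp.single (steps r x p y) 1 := by
  have h : ∃ q, IsChainBetween x q y ∧ q.toFinset = p.toFinset := ⟨p, hp, rfl⟩
  unfold chainSteps face
  erw [Finsupp.linearCombination_single, one_smul]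
  rw [dif_pos h, eq_of_pairwise_of_toFinset_eq h.choose_spec.1.pairwise hp.pairwise
    h.choose_spec.2]

theorem IsChainBetween.exists_steps_eq_cl_cons (h : IsChainBetween x p y) :
    ∃ u l, x < u ∧ ∀ w, steps r w p y = cl r w u :: l := by
  cases p with
  | nil => exact ⟨y, [], h.lt, fun _ => rfl⟩
  | cons u p => exact ⟨u, steps r u p y, (isChainBetween_cons.1 h).1, fun _ => rfl⟩

variable [IncidenceAxioms r] (hP : ∀ x y : P, (Set.Icc x y).Finite) {r}

theorem chainSteps_cone {v : P} (hxv : x < v) (hvy : v < y) {n : ℤ} {c : ChainSpace k P}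
    (hc : c ∈ (orderComplex (Set.Ioo v y)).chains k n) :
    chainSteps k r x y (cone k v c) =
      (zetaPeirceBasis hP k r).cons ((zetaPeirceBasis hP k r).basis (cl r x v))
        (chainSteps k r v y c) := by
  classical
  suffices hle : (orderComplex (Set.Ioo v y)).chains k n ≤ LinearMap.eqLocus
      (chainSteps k r x y ∘ₗ cone k v)
      ((zetaPeirceBasis hP k r).cons ((zetaPeirceBasis hP k r).basis (cl r x v)) ∘ₗ
        chainSteps k r v y) from hle hc
  refine chains_le fun F hF _ => ?_
  obtain ⟨q, hq, rfl⟩ := (mem_orderComplex_Ioo_iff hvy).1 hF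
  rw [LinearMap.mem_eqLocus, LinearMap.comp_apply, LinearMap.comp_apply, cone_face,
    ← List.toFinset_cons, chainSteps_face k r (isChainBetween_cons.2 ⟨hxv, hq⟩),
    chainSteps_face k r hq, PeirceBasis.cons_basis, steps]

theorem single_steps_sub_mulHead_mem {v : P} (hxv : x < v) (hp : IsChainBetween v p y) :
    Finsupp.single (steps r x p y) 1 - (zetaPeirceBasis hP k r).mulHead
        ((zetaPeirceBasis hP k r).basis (cl r x v)) (Finsupp.single (steps r v p y) 1) ∈
      Finsupp.supported k k {l | (zetaPeirceBasis hP k r).weight (steps r x (v :: p) y) <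
        (zetaPeirceBasis hP k r).weight l} := by
  obtain ⟨u, l, hvu, hsteps⟩ := hp.exists_steps_eq_cl_cons r
  have hcomp : Composes (cl r x v) (cl r v u) (cl r x u) := composes_cl hxv.le hvu.le
  rw [weight_steps_cons, hsteps, hsteps, PeirceBasis.weight_cons,
    ← PeirceBasis.cons_basis (b := zetaPeirceBasis hP k r) (cl r v u), PeirceBasis.mulHead_cons]
  rcases (hcomp.rk_add_rk_le hP).eq_or_lt with hrk | hrk
  · have hmul : (zetaPeirceBasis hP k r).basis (cl r x v) *
        (zetaPeirceBasis hP k r).basis (cl r v u) = (zetaPeirceBasis hP k r).basis (cl r x u) :=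
      zetaBasis_mul hP hcomp hrk.symm
    rw [hmul, PeirceBasis.cons_basis, sub_self]
    exact zero_mem _
  · have hmul : (zetaPeirceBasis hP k r).basis (cl r x v) *
        (zetaPeirceBasis hP k r).basis (cl r v u) = 0 :=
      zetaBasis_mul_of_not hP fun ⟨γ, hγ, hγrk⟩ => hrk.ne (hγ.unique hcomp ▸ hγrk.symm)
    rw [hmul, map_zero, LinearMap.zero_apply, sub_zero]
    refine Finsupp.single_mem_supported k 1 ?_
    change (rk (cl r x v) : ℤ) + (rk (cl r v u) + (zetaPeirceBasis hP k r).weight l) <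
      rk (cl r x u) + (zetaPeirceBasis hP k r).weight l
    lia

open Classical in
theorem chainSteps_boundary_face_sub_mergeList_mem (hp : IsChainBetween x p y) :
    chainSteps k r x y (boundary k (face k p.toFinset)) -
        (zetaPeirceBasis hP k r).mergeList (steps r x p y) ∈
      Finsupp.supported k k {l | (zetaPeirceBasis hP k r).weight (steps r x p y) <
        (zetaPeirceBasis hP k r).weight l} := by
  induction p generalizing x with
  | nil =>
    rw [List.toFinset_nil, boundary_face, Finset.sum_empty, map_zero, steps,
      PeirceBasis.mergeList, PeirceBasis.mergeList, PeirceBasis.mulHead_nil, map_zero, sub_zero,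
      sub_zero]
    exact zero_mem _
  | cons v p ih =>
    obtain ⟨hxv, hv⟩ := isChainBetween_cons.1 hp
    have hmin : ∀ u ∈ p.toFinset, v < u := fun u hu => (hv.mem_Ioo (List.mem_toFinset.1 hu)).1
    have hx : IsChainBetween x p y := isChainBetween_iff.2
      ⟨hp.lt, hv.pairwise, fun z hz => hp.mem_Ioo (List.mem_cons_of_mem v hz)⟩
    have hface : face k p.toFinset ∈ (orderComplex (Set.Ioo v y)).chains k _ :=
      face_mem_chains k ((mem_orderComplex_Ioo_iff hv.lt).2 ⟨p, hv, rfl⟩) rfl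
    rw [List.toFinset_cons, boundary_face_insert k hmin, map_sub, chainSteps_face k r hx,
      chainSteps_cone k hP hxv hv.lt (boundary_mem_chains k _ _ hface), steps,
      PeirceBasis.mergeList, sub_sub_sub_comm, ← map_sub]
    refine sub_mem (single_steps_sub_mulHead_mem k hP hxv hv)
      (PeirceBasis.cons_basis_mem_supported (fun l hl => ?_) (ih hv))
    have hlt : (zetaPeirceBasis hP k r).weight (steps r v p y) <
      (zetaPeirceBasis hP k r).weight l := hl
    exact Int.add_lt_add_left hlt _

end Comparison

section Layers

variable {P : Type u} [PartialOrder P] {r : Setoid (NonemptyInterval P)} [IncidenceAxioms r]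
  (hP : ∀ x y : P, (Set.Icc x y).Finite) (k : Type v) [Field k]

/-- The span of the paths of length `i` and total degree `j` whose composite is `α`. -/
noncomputable def factorSpan (α : IntClass r) (j : ℤ) (i : ℕ) :
    Submodule k (List (IntClass r) →₀ k) :=
  Finsupp.supported k k (pathProduct (target α) ⁻¹' {α}) ⊓
    ((zetaPeirceBasis hP k r).weightSpan j ⊓
      (zetaPeirceBasis hP k r).pathSpan (source α) (target α) i)

theorem factorSpan_eq_supported (α : IntClass r) (j : ℤ) (i : ℕ) :
    factorSpan hP k α j i = Finsupp.supported k k {l | pathProduct (target α) l = α ∧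
      (zetaPeirceBasis hP k r).weight l = j ∧
      (zetaPeirceBasis hP k r).IsPath (target α) (source α) l ∧ l.length = i} := by
  rw [factorSpan, PeirceBasis.weightSpan, PeirceBasis.pathSpan, ← Finsupp.supported_inter,
    ← Finsupp.supported_inter]
  rfl

variable (r) {x y : P}

open Classical in
theorem mem_layer_iff (hxy : x < y) (t : ℤ) {F : Finset P} :
    F ∈ ((orderComplex (Set.Ioo x y)).layer t).faces ↔ ∃ p, IsChainBetween x p y ∧
      p.toFinset = F ∧ t + 2 ≤ (zetaPeirceBasis hP k r).weight (steps r x p y) := by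
  constructor
  · rintro ⟨G, hG, hFG, ht⟩
    obtain ⟨q, hq, rfl⟩ := (mem_orderComplex_Ioo_iff hxy).1 hG
    obtain ⟨p, hp, rfl⟩ := (mem_orderComplex_Ioo_iff hxy).1
      ((orderComplex (Set.Ioo x y)).down_closed hG hFG)
    have hsub : p ⊆ q := fun z hz => List.mem_toFinset.1 (hFG (List.mem_toFinset.2 hz))
    have hlt := hp.length_lt_weight r hP k hq hsub
    rw [hq.card_toFinset] at ht
    exact ⟨p, hp, rfl, by lia⟩
  · rintro ⟨p, hp, rfl, ht⟩
    obtain ⟨q, hq, hsub, hlen⟩ := hp.exists_refinement r hP k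
    refine ⟨q.toFinset, (mem_orderComplex_Ioo_iff hxy).2 ⟨q, hq, rfl⟩,
      fun z hz => List.mem_toFinset.2 (hsub (List.mem_toFinset.1 hz)), ?_⟩
    rw [hq.card_toFinset]
    lia

/-- The component of degree `j` of `chainSteps`. It identifies the relative chains of the layers
`j - 2` and `j - 1` of the order complex of `(x, y)` with the paths of degree `j` with composite
`[x, y]`. -/
noncomputable def gradedChainSteps (j : ℤ) (x y : P) :
    ChainSpace k P →ₗ[k] (List (IntClass r) →₀ k) :=
  labelProj (zetaPeirceBasis hP k r).weight j ∘ₗ chainSteps k r x y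

open Classical in
theorem gradedChainSteps_face (j : ℤ) {p : List P} (hp : IsChainBetween x p y) :
    gradedChainSteps r hP k j x y (face k p.toFinset) =
      if (zetaPeirceBasis hP k r).weight (steps r x p y) = j then
        Finsupp.single (steps r x p y) 1 else 0 := by
  rw [gradedChainSteps, LinearMap.comp_apply, chainSteps_face k r hp, labelProj_single]

theorem map_chains_gradedChainSteps (hxy : x < y) (j : ℤ) {n : ℤ} {i : ℕ} (hi : i ≠ 0)
    (hn : n + 2 = i) :
    (((orderComplex (Set.Ioo x y)).layer (j - 2)).chains k n).map
      (gradedChainSteps r hP k j x y) = factorSpan hP k (cl r x y) j i := by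
  classical
  rw [factorSpan_eq_supported, source_cl hxy.le, target_cl hxy.le]
  apply le_antisymm
  · refine Submodule.map_le_iff_le_comap.2 (chains_le fun F hF hFn => ?_)
    obtain ⟨p, hp, rfl, -⟩ := (mem_layer_iff r hP k hxy _).1 hF
    rw [Submodule.mem_comap, gradedChainSteps_face r hP k j hp]
    rw [hp.card_toFinset] at hFn
    split_ifs with hj
    · refine Finsupp.single_mem_supported k 1
        ⟨hp.pathProduct_steps, hj, hp.isPath_steps hP k, ?_⟩
      rw [length_steps]
      lia
    · exact zero_mem _
  · refine supported_le fun l hl => ?_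
    obtain ⟨hprod, hj, hpath, rfl⟩ := hl
    obtain ⟨α, l, rfl⟩ := List.exists_cons_of_length_pos (Nat.pos_of_ne_zero hi)
    obtain ⟨p, hp, hsteps⟩ := exists_steps_eq hpath hxy.le hprod
    rw [← hsteps] at hj hn ⊢
    rw [length_steps] at hn
    refine ⟨face k p.toFinset, face_mem_chains k
      ((mem_layer_iff r hP k hxy _).2 ⟨p, hp, rfl, by lia⟩) ?_, ?_⟩
    · rw [hp.card_toFinset]
      lia
    · rw [gradedChainSteps_face r hP k j hp, if_pos hj]

theorem gradedChainSteps_boundary (hxy : x < y) (j : ℤ) {n : ℤ} {z : ChainSpace k P}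
    (hz : z ∈ ((orderComplex (Set.Ioo x y)).layer (j - 2)).chains k n) :
    gradedChainSteps r hP k j x y (boundary k z) =
      (zetaPeirceBasis hP k r).merge (gradedChainSteps r hP k j x y z) := by
  classical
  suffices hle : ((orderComplex (Set.Ioo x y)).layer (j - 2)).chains k n ≤ LinearMap.eqLocus
      (gradedChainSteps r hP k j x y ∘ₗ boundary k)
      ((zetaPeirceBasis hP k r).merge ∘ₗ gradedChainSteps r hP k j x y) from hle hz
  refine chains_le fun F hF _ => ?_
  obtain ⟨p, hp, rfl, hj⟩ := (mem_layer_iff r hP k hxy _).1 hF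
  -- The differentials agree up to lists of degree exceeding `j`, which the projection kills.
  have hdiff := labelProj_eq_zero (l := j) (label := (zetaPeirceBasis hP k r).weight)
    (fun l (hl : (zetaPeirceBasis hP k r).weight (steps r x p y) <
      (zetaPeirceBasis hP k r).weight l) => by lia)
    (chainSteps_boundary_face_sub_mergeList_mem k hP hp)
  rw [map_sub, sub_eq_zero] at hdiff
  rw [LinearMap.mem_eqLocus, LinearMap.comp_apply, LinearMap.comp_apply, gradedChainSteps,
    LinearMap.comp_apply, LinearMap.comp_apply, hdiff, ← PeirceBasis.merge_single,
    PeirceBasis.labelProj_merge, chainSteps_face k r hp]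

open Classical in
/-- The inverse of `chainSteps` on combinations of lists of the form `steps r x p y`. -/
noncomputable def stepsChain (x y : P) : (List (IntClass r) →₀ k) →ₗ[k] ChainSpace k P :=
  Finsupp.linearCombination k fun l =>
    if h : ∃ p, IsChainBetween x p y ∧ steps r x p y = l then face k h.choose.toFinset else 0

open Classical in
theorem stepsChain_single {p : List P} (hp : IsChainBetween x p y) :
    stepsChain r k x y (Finsupp.single (steps r x p y) 1) = face k p.toFinset := by
  have h : ∃ q, IsChainBetween x q y ∧ steps r x q y = steps r x p y := ⟨p, hp, rfl⟩
  rw [stepsChain, Finsupp.linearCombination_single, one_smul, dif_pos h,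
    h.choose_spec.1.eq_of_steps_eq hp h.choose_spec.2]

theorem sub_stepsChain_mem (hxy : x < y) (j : ℤ) {n : ℤ} {z : ChainSpace k P}
    (hz : z ∈ ((orderComplex (Set.Ioo x y)).layer (j - 2)).chains k n) :
    z - stepsChain r k x y (gradedChainSteps r hP k j x y z) ∈
      ((orderComplex (Set.Ioo x y)).layer (j - 1)).chains k n := by
  classical
  suffices hle : ((orderComplex (Set.Ioo x y)).layer (j - 2)).chains k n ≤
      (((orderComplex (Set.Ioo x y)).layer (j - 1)).chains k n).comap
        (LinearMap.id - stepsChain r k x y ∘ₗ gradedChainSteps r hP k j x y) from hle hz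
  refine chains_le fun F hF hn => ?_
  obtain ⟨p, hp, rfl, hj⟩ := (mem_layer_iff r hP k hxy _).1 hF
  rw [Submodule.mem_comap, LinearMap.sub_apply, LinearMap.id_apply, LinearMap.comp_apply,
    gradedChainSteps_face r hP k j hp]
  split_ifs with h
  · rw [stepsChain_single r k hp, sub_self]
    exact zero_mem _
  · rw [map_zero, sub_zero]
    exact face_mem_chains k ((mem_layer_iff r hP k hxy _).2 ⟨p, hp, rfl, by lia⟩) hn

theorem gradedChainSteps_eq_zero_iff (hxy : x < y) (j : ℤ) {n : ℤ} {z : ChainSpace k P}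
    (hz : z ∈ ((orderComplex (Set.Ioo x y)).layer (j - 2)).chains k n) :
    gradedChainSteps r hP k j x y z = 0 ↔
      z ∈ ((orderComplex (Set.Ioo x y)).layer (j - 1)).chains k n := by
  classical
  constructor
  · intro h
    have hmem := sub_stepsChain_mem r hP k hxy j hz
    rwa [h, map_zero, sub_zero] at hmem
  · suffices hle : ((orderComplex (Set.Ioo x y)).layer (j - 1)).chains k n ≤
        LinearMap.ker (gradedChainSteps r hP k j x y) from fun h => hle h
    refine chains_le fun F hF _ => ?_
    obtain ⟨p, hp, rfl, hj⟩ := (mem_layer_iff r hP k hxy _).1 hF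
    rw [LinearMap.mem_ker, gradedChainSteps_face r hP k j hp, if_neg (by lia)]

theorem nonempty_relHomology_equiv (hxy : x < y) {i : ℕ} (hi : i ≠ 0) (j : ℤ) :
    Nonempty (Subquotient (factorSpan hP k (cl r x y) j i ⊓
        LinearMap.ker (zetaPeirceBasis hP k r).merge)
        ((factorSpan hP k (cl r x y) j (i + 1)).map (zetaPeirceBasis hP k r).merge) ≃ₗ[k]
      RelHomology k ((orderComplex (Set.Ioo x y)).layer (j - 2))
        ((orderComplex (Set.Ioo x y)).layer (j - 1)) ((i : ℤ) - 2)) := by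
  have hsub : ((orderComplex (Set.Ioo x y)).layer (j - 1)).chains k ((i : ℤ) - 2) ≤
      ((orderComplex (Set.Ioo x y)).layer (j - 2)).chains k ((i : ℤ) - 2) :=
    chains_le fun F ⟨G, hG, hFG, hj⟩ hn => face_mem_chains k ⟨G, hG, hFG, by lia⟩ hn
  obtain ⟨e⟩ := nonempty_relative_subquotientEquiv (gradedChainSteps r hP k j x y)
    (map_chains_gradedChainSteps r hP k hxy j (n := i - 2) hi (by lia))
    (map_chains_gradedChainSteps r hP k hxy j (n := i - 2 + 1) i.succ_ne_zero (by push_cast; lia))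
    (fun _ hz => gradedChainSteps_eq_zero_iff r hP k hxy j hz)
    (fun _ hz => gradedChainSteps_eq_zero_iff r hP k hxy j (boundary_mem_chains k _ _ hz)) hsub
    (fun _ hz => add_sub_cancel_right ((i : ℤ) - 2) 1 ▸ boundary_mem_chains k _ _ hz)
    (fun _ hz => gradedChainSteps_boundary r hP k hxy j hz)
    (fun _ hz => gradedChainSteps_boundary r hP k hxy j hz)
  exact ⟨e.symm⟩

end Layers

namespace PeirceBasis

section DegreeZero

variable {k : Type*} [Field k] {R : Type*} [Ring R] [Algebra k R] {V E : Type*}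
  (b : PeirceBasis k R V E) {X Y : V}

theorem pathSpan_zero_of_ne (h : X ≠ Y) : b.pathSpan X Y 0 = ⊥ := by
  have hempty : {l | b.IsPath Y X l ∧ l.length = 0} = ∅ := by
    refine Set.eq_empty_of_forall_notMem fun l hl => h ?_
    obtain rfl := List.length_eq_zero_iff.1 hl.2
    exact hl.1
  rw [pathSpan, hempty, Finsupp.supported_empty]

theorem subsingleton_pathHomology_zero (h : X ≠ Y) : Subsingleton (b.PathHomology X Y 0) := by
  have hZ : b.pathSpan X Y 0 ⊓ LinearMap.ker b.merge = ⊥ := by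
    rw [b.pathSpan_zero_of_ne h, bot_inf_eq]
  have : Subsingleton ↥(b.pathSpan X Y 0 ⊓ LinearMap.ker b.merge) :=
    Submodule.subsingleton_iff_eq_bot.2 hZ
  exact Quot.Subsingleton

theorem pathSpan_self_zero (X : V) :
    b.pathSpan X X 0 = Finsupp.supported k k {([] : List E)} := by
  refine congrArg (Finsupp.supported k k) (Set.ext fun l => ⟨fun hl => ?_, ?_⟩)
  · exact List.length_eq_zero_iff.1 hl.2
  · rintro rfl
    exact ⟨rfl, rfl⟩

theorem nonempty_pathHomology_zero_equiv (X : V) : Nonempty (b.PathHomology X X 0 ≃ₗ[k] k) := by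
  have hZ : b.pathSpan X X 0 ⊓ LinearMap.ker b.merge = Finsupp.supported k k {([] : List E)} := by
    rw [← b.pathSpan_self_zero X]
    exact inf_eq_left.2 fun v hv => LinearMap.mem_ker.2 (merge_eq_zero hv zero_le_one)
  have hB : ((b.pathSpan X X 1).map b.merge).submoduleOf
      (b.pathSpan X X 0 ⊓ LinearMap.ker b.merge) = ⊥ := by
    refine (Submodule.eq_bot_iff _).2 ?_
    rintro ⟨_, _⟩ ⟨v, hv, rfl⟩
    exact Subtype.ext (merge_eq_zero hv le_rfl)
  exact ⟨(Submodule.quotEquivOfEqBot _ hB).trans <| (LinearEquiv.ofEq _ _ hZ).trans <|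
    (Finsupp.supportedEquivFinsupp _).trans (Finsupp.uniqueLinearEquiv k k ⟨[], rfl⟩)⟩

theorem pathHomologyDegree_zero_zero (X Y : V) : b.pathHomologyDegree X Y 0 0 = ⊤ := by
  have hle : b.pathSpan X Y 0 ⊓ LinearMap.ker b.merge ≤ b.weightSpan 0 :=
    inf_le_left.trans <| Finsupp.supported_mono fun l hl => by
      obtain rfl := List.length_eq_zero_iff.1 hl.2
      rfl
  rw [pathHomologyDegree, subquotientPart, Submodule.submoduleOf_eq_top.2 hle, Submodule.map_top]
  exact Submodule.range_mkQ _

end DegreeZero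

end PeirceBasis

section Decomposition

variable {P : Type u} [PartialOrder P] {r : Setoid (NonemptyInterval P)} [IncidenceAxioms r]
  (hP : ∀ x y : P, (Set.Icc x y).Finite) (k : Type v) [Field k] {X Y : PointClass r}

theorem labelProj_pathProduct_merge {i : ℕ} {v : List (IntClass r) →₀ k}
    (hv : v ∈ (zetaPeirceBasis hP k r).pathSpan X Y i) (α : IntClass r) :
    labelProj (pathProduct Y) α ((zetaPeirceBasis hP k r).merge v) =
      (zetaPeirceBasis hP k r).merge (labelProj (pathProduct Y) α v) := by
  refine labelProj_comm (fun l hl => ?_) hv α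
  rw [PeirceBasis.merge_single]
  exact mergeList_mem_supported_pathProduct hl.1

/-- The homology at the paths of length `i`, degree `j` and composite `α`. -/
abbrev FactorHomology (α : IntClass r) (j : ℤ) (i : ℕ) : Type _ :=
  Subquotient (factorSpan hP k α j i ⊓ LinearMap.ker (zetaPeirceBasis hP k r).merge)
    ((factorSpan hP k α j (i + 1)).map (zetaPeirceBasis hP k r).merge)

theorem isInternal_pathHomologyDegree_pathProduct [DecidableEq (IntClass r)]
    (X Y : PointClass r) {i : ℕ} (hi : i ≠ 0) (j : ℤ) :
    DirectSum.IsInternal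
      fun α : {α : IntClass r // IsProper α ∧ source α = X ∧ target α = Y} =>
        subquotientPart ((zetaPeirceBasis hP k r).weightSpan j ⊓
          ((zetaPeirceBasis hP k r).pathSpan X Y i ⊓
            LinearMap.ker (zetaPeirceBasis hP k r).merge))
          (((zetaPeirceBasis hP k r).pathSpan X Y (i + 1)).map (zetaPeirceBasis hP k r).merge)
          (Finsupp.supported k k (pathProduct Y ⁻¹' {α.1})) := by
  refine isInternal_subquotientPart (fun α v hv => ?_) (fun α v hv => ?_)
    Subtype.val_injective fun v hv l hl => ?_
  · obtain ⟨hj, hpath, hker⟩ := hv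
    refine ⟨labelProj_mem_supported hj α, labelProj_mem_supported hpath α, ?_⟩
    refine LinearMap.mem_ker.2 ?_
    rw [← labelProj_pathProduct_merge hP k hpath, LinearMap.mem_ker.1 hker, map_zero]
  · obtain ⟨w, hw, rfl⟩ := hv
    exact ⟨_, labelProj_mem_supported hw α, (labelProj_pathProduct_merge hP k hw α).symm⟩
  · obtain ⟨hpath, hlen⟩ := hv.2.1 hl
    obtain ⟨α, l, rfl⟩ := List.exists_cons_of_ne_nil (List.ne_nil_of_length_pos
      (hlen.trans_gt (Nat.pos_of_ne_zero hi)))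
    exact ⟨⟨_, isProper_pathProduct hpath, source_pathProduct hpath, target_pathProduct hpath⟩,
      rfl⟩

theorem mem_map_merge_factorSpan_iff {α : IntClass r} {j : ℤ} {i : ℕ}
    {v : List (IntClass r) →₀ k} (hv : v ∈ factorSpan hP k α j i) :
    v ∈ (factorSpan hP k α j (i + 1)).map (zetaPeirceBasis hP k r).merge ↔
      v ∈ ((zetaPeirceBasis hP k r).pathSpan (source α) (target α) (i + 1)).map
        (zetaPeirceBasis hP k r).merge := by
  refine ⟨fun h => Submodule.map_mono (inf_le_right.trans inf_le_right) h, ?_⟩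
  rintro ⟨w, hw, rfl⟩
  have hw' := labelProj_mem_supported (label := (zetaPeirceBasis hP k r).weight) hw j
  refine ⟨labelProj (pathProduct (target α)) α
    (labelProj (zetaPeirceBasis hP k r).weight j w), ⟨labelProj_mem _ _,
      labelProj_mem_supported (labelProj_mem _ _) _, labelProj_mem_supported hw' _⟩, ?_⟩
  rw [← labelProj_pathProduct_merge hP k hw', ← PeirceBasis.labelProj_merge,
    labelProj_of_mem hv.2.1, labelProj_of_mem hv.1]

theorem nonempty_pathHomologyDegree_equiv (X Y : PointClass r) {i : ℕ} (hi : i ≠ 0) (j : ℤ) :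
    Nonempty ((zetaPeirceBasis hP k r).pathHomologyDegree X Y i j ≃ₗ[k]
      ⨁ α : {α : IntClass r // IsProper α ∧ source α = X ∧ target α = Y},
        FactorHomology hP k α.1 j i) := by
  classical
  refine ⟨(subquotientPartEquiv ..).symm.trans (internalEquivDirectSum
    (isInternal_pathHomologyDegree_pathProduct hP k X Y hi j) fun α =>
      (subquotientPartEquiv ..).symm.trans (subquotientEquiv LinearMap.id ?_ ?_ ?_))⟩
  all_goals obtain ⟨α, -, rfl, rfl⟩ := α
  · exact fun v hv => ⟨⟨hv.1, hv.2.1, hv.2.2.1⟩, hv.2.2.2⟩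
  · exact fun v hv => mem_map_merge_factorSpan_iff hP k ⟨hv.1, hv.2.1, hv.2.2.1⟩
  · refine fun v hv => ⟨v, ⟨hv.1.1, hv.1.2.1, hv.1.2.2, hv.2⟩, ?_⟩
    rw [LinearMap.id_apply, sub_self]
    exact zero_mem _

end Decomposition

section PointModules

variable {P : Type u} [PartialOrder P] (k : Type v) [Field k] {r : Setoid (NonemptyInterval P)}

/-- The underlying vector space of `k_x~` is `k`. -/
noncomputable def pointModuleEquiv (X : PointClass r) : PointModule k X ≃ₗ[k] k :=
  LinearEquiv.refl k k

theorem pointDegree_zero (X : PointClass r) : pointDegree k X 0 = ⊤ := if_pos rfl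

theorem pointDegree_of_ne (X : PointClass r) {j : ℤ} (h : j ≠ 0) : pointDegree k X j = ⊥ :=
  if_neg h

theorem isInternal_pointDegree (X : PointClass r) : DirectSum.IsInternal (pointDegree k X) := by
  rw [DirectSum.isInternal_submodule_iff_iSupIndep_and_iSup_eq_top]
  constructor
  · refine iSupIndep_of_separating (fun j => if j = 0 then LinearMap.id else 0)
      (fun j x hx => ?_) fun i j hij x hx => ?_
    · split_ifs with hj
      · rfl
      · rwa [pointDegree_of_ne k X hj, Submodule.mem_bot, eq_comm] at hx
    · split_ifs with hi
      · rwa [pointDegree_of_ne k X (hi ▸ hij.symm), Submodule.mem_bot] at hx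
      · rfl
  · exact top_le_iff.1 ((pointDegree_zero k X).ge.trans (le_iSup _ 0))

variable [IncidenceAxioms r] (hP : ∀ x y : P, (Set.Icc x y).Finite)

theorem smul_pointModule (X : PointClass r) (x : RedGr k r) (n : PointModule k X) :
    x • n = (zetaPeirceBasis hP k r).character X x • n := by
  rw [character_zetaPeirceBasis]
  rfl

theorem op_smul_pointModule (X : PointClass r) (x : RedGr k r) (m : PointModule k X) :
    MulOpposite.op x • m = (zetaPeirceBasis hP k r).character X x • m := by
  rw [character_zetaPeirceBasis]
  rfl

include hP in
theorem nonempty_gradedProjectiveResolution (Y : PointClass r) :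
    Nonempty (GradedProjectiveResolution.{max u v, v, max u v} k (R := RedGr k r)
      (redGrading k r) (PointModule k Y) (pointDegree k Y)) := by
  rw [← grading_zetaPeirceBasis hP]
  exact ⟨PeirceBasis.barResolution (N := PointModule k Y) (pointModuleEquiv k Y).symm
    (smul_pointModule k hP Y) (pointDegree_zero k Y)⟩

theorem exists_torEquiv_pointModule (X Y : PointClass r)
    (Q : GradedProjectiveResolution.{max u v, v, w} k (R := RedGr k r) (redGrading k r)
      (PointModule k Y) (pointDegree k Y)) (i : ℕ) :
    ∃ e : Q.Tor (PointModule k X) i ≃ₗ[k] (zetaPeirceBasis hP k r).PathHomology X Y i,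
      ∀ j, (Q.torDegree (pointDegree k X) i j).map e.toLinearMap =
        (zetaPeirceBasis hP k r).pathHomologyDegree X Y i j := by
  revert Q
  rw [← grading_zetaPeirceBasis hP]
  intro Q
  exact PeirceBasis.exists_torEquiv_pathHomology (b := zetaPeirceBasis hP k r)
    (M := PointModule k X) (N := PointModule k Y) (pointModuleEquiv k X)
    (op_smul_pointModule k hP X)
    (η := (pointModuleEquiv k Y).symm)
    (hN := smul_pointModule k hP Y) Q
    (pointDegree_zero k Y) (isInternal_pointDegree k Y) (pointDegree_zero k X)
    (fun _ hj => pointDegree_of_ne k X hj) i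

theorem nonempty_relHomology_equiv_of_isProper {rep : IntClass r → NonemptyInterval P}
    (hrep : ∀ α, Quotient.mk r (rep α) = α) {α : IntClass r} (hα : IsProper α) {i : ℕ}
    (hi : i ≠ 0) (j : ℤ) :
    Nonempty (FactorHomology hP k α j i ≃ₗ[k] RelHomology k
      ((orderComplex (Set.Ioo (rep α).fst (rep α).snd)).layer (j - 2))
      ((orderComplex (Set.Ioo (rep α).fst (rep α).snd)).layer (j - 1)) ((i : ℤ) - 2)) := by
  have hcl : cl r (rep α).fst (rep α).snd = α := (cl_of_le (rep α).fst_le_snd).trans (hrep α)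
  have hlt : (rep α).fst < (rep α).snd :=
    (isProper_cl_iff (r := r) (rep α).fst_le_snd).1 (hcl.symm ▸ hα)
  have h := nonempty_relHomology_equiv r hP k hlt hi j
  rwa [hcl] at h

theorem nonempty_pathHomologyDegree_equiv_relHomology {rep : IntClass r → NonemptyInterval P}
    (hrep : ∀ α, Quotient.mk r (rep α) = α) (X Y : PointClass r) {i : ℕ} (hi : i ≠ 0) (j : ℤ) :
    Nonempty ((zetaPeirceBasis hP k r).pathHomologyDegree X Y i j ≃ₗ[k]
      ⨁ α : {α : IntClass r // IsProper α ∧ source α = X ∧ target α = Y},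
        RelHomology k
          ((orderComplex (Set.Ioo (rep α.1).fst (rep α.1).snd)).layer (j - 2))
          ((orderComplex (Set.Ioo (rep α.1).fst (rep α.1).snd)).layer (j - 1))
          ((i : ℤ) - 2)) := by
  obtain ⟨e⟩ := nonempty_pathHomologyDegree_equiv hP k X Y hi j
  exact ⟨e.trans <| DFinsupp.mapRange.linearEquiv fun α =>
    (nonempty_relHomology_equiv_of_isProper k hP hrep α.2.1 hi j).some⟩

end PointModules

end RedInc

theorem corollary4p7 {P : Type u} [PartialOrder P] (hP : ∀ x y : P, (Set.Icc x y).Finite)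
    (k : Type v) [Field k] (r : Setoid (NonemptyInterval P)) [IncidenceAxioms r]
    (rep : IntClass r → NonemptyInterval P) (hrep : ∀ α, Quotient.mk r (rep α) = α)
    (X Y : PointClass r) :
    Nonempty (GradedProjectiveResolution.{max u v, v, max u v} k (R := RedGr k r) (redGrading k r)
      (PointModule k Y) (pointDegree k Y)) ∧
    ∀ Q : GradedProjectiveResolution.{max u v, v, w} k (R := RedGr k r) (redGrading k r)
        (PointModule k Y) (pointDegree k Y),
      (∀ i, DirectSum.IsInternal (Q.torDegree (pointDegree k X) i)) ∧
      (X = Y → Nonempty (Q.Tor (PointModule k X) 0 ≃ₗ[k] k) ∧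
        Q.torDegree (pointDegree k X) 0 0 = ⊤) ∧
      (X ≠ Y → Subsingleton (Q.Tor (PointModule k X) 0)) ∧
      ∀ (i : ℕ) (j : ℤ), 1 ≤ i →
        Nonempty (Q.torDegree (pointDegree k X) i j ≃ₗ[k]
          ⨁ α : {α : IntClass r // IsProper α ∧ source α = X ∧ target α = Y},
            RelHomology k
              ((orderComplex (Set.Ioo (rep α.1).fst (rep α.1).snd)).layer (j - 2))
              ((orderComplex (Set.Ioo (rep α.1).fst (rep α.1).snd)).layer (j - 1))
              ((i : ℤ) - 2)) := by
  refine ⟨nonempty_gradedProjectiveResolution k hP Y, fun Q => ?_⟩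
  choose e he using exists_torEquiv_pointModule k hP X Y Q
  refine ⟨fun i => ?_, ?_, fun h => ?_, fun i j hi => ?_⟩
  · refine isInternal_of_map_equiv (e i) ?_
    rw [funext (he i)]
    exact (zetaPeirceBasis hP k r).isInternal_pathHomologyDegree X Y i
  · rintro rfl
    obtain ⟨e₀⟩ := (zetaPeirceBasis hP k r).nonempty_pathHomology_zero_equiv X
    exact ⟨⟨(e 0).trans e₀⟩, (Submodule.map_eq_top_iff (e := e 0)).1 <|
      (he 0 0).trans ((zetaPeirceBasis hP k r).pathHomologyDegree_zero_zero X X)⟩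
  · have := (zetaPeirceBasis hP k r).subsingleton_pathHomology_zero h
    exact (e 0).toEquiv.subsingleton
  · exact (nonempty_pathHomologyDegree_equiv_relHomology k hP hrep X Y
      (Nat.one_le_iff_ne_zero.1 hi) j).map ((e i).ofSubmodules _ _ (he i j)).trans
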